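/- **Conventions.** A *word* over an alphabet $A$ is an element of the free monoid $A^*$. The exponent of periodicity $\exp(w)$ of a word $w$ is the greatest $e\in\mathbb N$ such that $w=u\,p^{e}\,v$ for words $u,p,v$ with $p$ nonempty, and $\exp(L)=\sup\{\exp(w): w\in L\}\in\mathbb N\cup\{\infty\}$ for a language $L\subseteq A^*$. For elements $u,p,v$ of a group put $up^*v=\{up^nv: n\in\mathbb N\}$. **Graph product and its normal form.** Let $J$ be a finite linearly ordered set, let $I\subseteq J\times J$ be irreflexive and symmetric, and for each $i\in J$ let $G_i$ be a group, $\Gamma_i$ a finite alphabet, $\pi_i:\Gamma_i^*\to G_i$ an epimorphism and $\mathrm{nf}_i:G_i\to\Gamma_i^*$ a map with $\pi_i(\mathrm{nf}_i(g))=g$ for all $g\in G_i$. Let $\mathbb G$ be the graph product, that is, the quotient of the free product of the $G_i$ by the relations $xy=yx$ for $x\in G_j$, $y\in G_k$, $(j,k)\in I$ (it is finitely generated). Let $\Sigma$ be the disjoint union of the sets $G_i\setminus\{1\}$ and $\Gamma$ the disjoint union of the $\Gamma_i$; every letter of $\Sigma$ or $\Gamma$ has a color in $J$, two letters are independent if their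 colors are related by $I$, and $M(\Sigma,I)$, $M(\Gamma,I)$ denote the quotients of $\Sigma^*$, $\Gamma^*$ by $ab=ba$ for independent letters $a,b$. Every $x\in\mathbb G$ is the image of a unique element of $M(\Sigma,I)$ that is reduced, i.e. has no factor $ab$ with letters $a,b$ of equal color. Replacing in it every letter $g\in G_i\setminus\{1\}$ by $\mathrm{nf}_i(g)$ gives an element of $M(\Gamma,I)$; let $\mathrm{nf}_{\mathbb G}(x)\in\Gamma^*$ be the lexicographically first word representing this element, where $\Gamma$ is ordered first by color and, within a color, by an arbitrary linear order on $\Gamma_i$. **Equations.** Let $\mathcal X=\mathcal X^+\cup\{X^{-1}:X\in\mathcal X^+\}$ be a set of variables and $F(\mathcal X)$ the free group with basis $\mathcal X^+$. A quadratic system is a finite set $\mathcal S\subseteq\mathbb G* F(\mathcal X)$ such that for each $X\in\mathcal X^+$ the total number of occurrences of $X$ and $X^{-1}$ in the reduced words representing the elements of $\mathcal S$ is at most $2$. A recognizable constraint is a family of recognizable subsets $L_X\subseteq\mathbb G$ ($X\in\mathcal X^+$), where $L\subseteq\mathbb G$ is recognizable if $L=\mu^{-1}(\mu(L))$ for some homomorphism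 $\mu$ from $\mathbb G$ to a finite monoid. A solution is a homomorphism $\sigma:\mathbb G* F(\mathcal X)\to\mathbb G$ that is the identity on $\mathbb G$, with $\sigma(W)=1$ for all $W\in\mathcal S$ and $\sigma(X)\in L_X$ for all $X\in\mathcal X^+$. The full solution set is $$\mathrm{Sol}=\{\sigma(X): \sigma \text{ a solution},\ X\in\mathcal X\}\subseteq\mathbb G.$$ **Statement.** Suppose that for every $i\in J$: 1. for every $g\in G_i$ the set $\{h\in G_i: h^2=g\}$ is finite; 2. for all $u,p,v\in G_i$ with $p\neq1$ we have $\exp(\mathrm{nf}_i(up^*v))=\infty$. Then, for every quadratic system over $\mathbb G$ with a recognizable constraint, either the full solution set $\mathrm{Sol}$ is finite or $\exp(\mathrm{nf}_{\mathbb G}(\mathrm{Sol}))=\infty$. -/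

import Mathlib

noncomputable section

namespace GPQuad

/-! ### Exponent of periodicity -/

section Periodicity

variable {A : Type*}

/-- The exponent of periodicity of a word `w`: the greatest `e` such that `w = u p ^ e v` for some
words `u`, `p`, `v` with `p` nonempty (the set below is bounded by the length of `w`). -/
def wordExp (w : FreeMonoid A) : ℕ :=
  sSup {e : ℕ | ∃ u p v : FreeMonoid A, p ≠ 1 ∧ w = u * p ^ e * v}

/-- The exponent of periodicity of a language, an element of `ℕ ∪ {∞}`. -/
def langExp (L : Set (FreeMonoid A)) : ℕ∞ :=
  ⨆ w ∈ L, (wordExp w : ℕ∞)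

end Periodicity

/-- The set `u p^* v = {u p ^ n v | n ∈ ℕ}`. -/
def pumpSet {M : Type*} [Monoid M] (u p v : M) : Set M :=
  Set.range fun n : ℕ => u * p ^ n * v

/-! ### Trace monoids (free partially commutative monoids) -/

section Trace

variable {A : Type*} (I : SimpleGraph A)

/-- The congruence on `A^*` generated by `ab = ba` for independent letters `a`, `b`. -/
def traceCon : Con (FreeMonoid A) :=
  conGen fun x y => ∃ a b : A, I.Adj a b ∧
    x = FreeMonoid.of a * FreeMonoid.of b ∧ y = FreeMonoid.of b * FreeMonoid.of a

/-- The trace monoid `M(A, I)`; the independence relation is the adjacency relation of `I`. -/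
abbrev TraceMonoid : Type _ := (traceCon I).Quotient

/-- The canonical epimorphism `A^* → M(A, I)`. -/
def toTrace : FreeMonoid A →* TraceMonoid I := (traceCon I).mk'

theorem toTrace_surjective : Function.Surjective (toTrace I) := (traceCon I).mk'_surjective

theorem perm_of_toTrace_eq {v w : FreeMonoid A} (h : toTrace I v = toTrace I w) :
    v.toList.Perm w.toList := by
  let f : FreeMonoid A →* Multiplicative (Multiset A) :=
    FreeMonoid.lift fun a => Multiplicative.ofAdd ({a} : Multiset A)
  have hf : ∀ w : FreeMonoid A, f w = Multiplicative.ofAdd (w.toList : Multiset A) := by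
    intro w
    induction w using FreeMonoid.inductionOn' with
    | one => rfl
    | of_mul a w ih =>
      rw [map_mul, ih, FreeMonoid.lift_eval_of, ← ofAdd_add]
      rfl
  have hle : traceCon I ≤ Con.ker f := by
    refine Con.conGen_le.2 ?_
    rintro x y ⟨a, b, -, rfl, rfl⟩
    change f _ = f _
    rw [map_mul, map_mul, mul_comm]
  have h1 : f v = f w := hle ((Con.eq _).1 h)
  rw [hf, hf] at h1
  exact Multiset.coe_eq_coe.1 (Multiplicative.ofAdd.injective h1)

theorem exists_lex_first [LinearOrder A] (t : TraceMonoid I) :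
    ∃ w : FreeMonoid A, toTrace I w = t ∧
      ∀ w' : FreeMonoid A, toTrace I w' = t → w.toList ≤ w'.toList := by
  obtain ⟨w₀, rfl⟩ := toTrace_surjective I t
  have hfin : {l : List A | toTrace I (FreeMonoid.ofList l) = toTrace I w₀}.Finite := by
    refine (List.finite_toSet w₀.toList.permutations).subset ?_
    intro l hl
    exact List.mem_permutations.2 (perm_of_toTrace_eq I hl)
  obtain ⟨l, hl, hmin⟩ := Set.exists_min_image _ id hfin ⟨w₀.toList, rfl⟩
  exact ⟨FreeMonoid.ofList l, hl, fun w' hw' => hmin w'.toList hw'⟩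

/-- The lexicographic normal form of a trace: the lexicographically first word representing it. -/
def nfLex [LinearOrder A] (t : TraceMonoid I) : FreeMonoid A :=
  Classical.choose (exists_lex_first I t)

/-- The homomorphism from a trace monoid induced by a map on letters sending independent letters
to commuting elements. -/
def traceLift {N : Type*} [Monoid N] (f : A → N)
    (hf : ∀ a b, I.Adj a b → f a * f b = f b * f a) : TraceMonoid I →* N :=
  (traceCon I).lift (FreeMonoid.lift f) (Con.conGen_le.2 (by
    rintro x y ⟨a, b, hab, rfl, rfl⟩
    change FreeMonoid.lift f _ = FreeMonoid.lift f _
    simpa using hf a b hab))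

theorem traceLift_of {N : Type*} [Monoid N] (f : A → N)
    (hf : ∀ a b, I.Adj a b → f a * f b = f b * f a) (a : A) :
    traceLift I f hf (toTrace I (FreeMonoid.of a)) = f a :=
  FreeMonoid.lift_eval_of f a

end Trace

/-! ### Graph products -/

section GraphProduct

variable {J : Type*} (I : SimpleGraph J) (M : J → Type*)

section Monoid

variable [∀ i, Monoid (M i)]

/-- The congruence on the free product of the local monoids that makes elements of `M j` and `M k`
commute whenever `j` and `k` are adjacent. -/
def graphProductCon : Con (Monoid.CoprodI M) :=
  conGen fun x y => ∃ (j k : J) (a : M j) (b : M k), I.Adj j k ∧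
    x = Monoid.CoprodI.of a * Monoid.CoprodI.of b ∧
    y = Monoid.CoprodI.of b * Monoid.CoprodI.of a

/-- The graph product of the family `M` over the independence alphabet `(J, I)`. -/
abbrev GraphProduct : Type _ := (graphProductCon I M).Quotient

/-- The canonical homomorphism from a local monoid to the graph product. -/
def GraphProduct.of (i : J) : M i →* GraphProduct I M :=
  (graphProductCon I M).mk'.comp Monoid.CoprodI.of

theorem GraphProduct.of_comm {j k : J} (h : I.Adj j k) (a : M j) (b : M k) :
    GraphProduct.of I M j a * GraphProduct.of I M k b =
      GraphProduct.of I M k b * GraphProduct.of I M j a :=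
  (Con.eq _).2 (ConGen.Rel.of _ _ ⟨j, k, a, b, h, rfl, rfl⟩)

/-- The alphabet `Σ`: the disjoint union of the sets `M i \ {1}`. The first component of a
letter is its color. -/
abbrev Syllable : Type _ := Σ i, {x : M i // x ≠ 1}

/-- The independence relation on `Σ` induced by the colors. -/
def syllableGraph : SimpleGraph (Syllable M) := I.comap Sigma.fst

/-- The canonical homomorphism `ψ : M(Σ, I) → GraphProduct I M`. -/
def evalTrace : TraceMonoid (syllableGraph I M) →* GraphProduct I M :=
  traceLift (syllableGraph I M) (fun s => GraphProduct.of I M s.1 s.2.1)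
    (fun s t h => GraphProduct.of_comm I M h s.2.1 t.2.1)

/-- A trace over `Σ` is reduced if it has no factor consisting of two letters of the same color. -/
def IsReducedTrace (t : TraceMonoid (syllableGraph I M)) : Prop :=
  ∀ (y z : TraceMonoid (syllableGraph I M)) (a b : Syllable M),
    t = y * toTrace _ (FreeMonoid.of a) * toTrace _ (FreeMonoid.of b) * z → a.1 ≠ b.1

theorem evalTrace_of (s : Syllable M) :
    evalTrace I M (toTrace _ (FreeMonoid.of s)) = GraphProduct.of I M s.1 s.2.1 :=
  traceLift_of _ _ _ s

theorem evalTrace_surjective : Function.Surjective (evalTrace I M) := by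
  classical
  intro x
  obtain ⟨c, rfl⟩ := (graphProductCon I M).mk'_surjective x
  induction c using Monoid.CoprodI.induction_on with
  | one => exact ⟨1, by rw [map_one, map_one]⟩
  | of i m =>
    by_cases hm : m = 1
    · exact ⟨1, by rw [hm, map_one, map_one, map_one]⟩
    · exact ⟨toTrace _ (FreeMonoid.of ⟨i, m, hm⟩), evalTrace_of I M ⟨i, m, hm⟩⟩
  | mul c d hc hd =>
    obtain ⟨s, hs⟩ := hc
    obtain ⟨t, ht⟩ := hd
    exact ⟨s * t, by rw [map_mul, hs, ht, map_mul]⟩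

theorem exists_reducedTrace (x : GraphProduct I M) :
    ∃ t : TraceMonoid (syllableGraph I M), IsReducedTrace I M t ∧ evalTrace I M t = x := by
  classical
  have hex : ∃ n : ℕ, ∃ w : FreeMonoid (Syllable M),
      evalTrace I M (toTrace _ w) = x ∧ w.toList.length = n := by
    obtain ⟨t, ht⟩ := evalTrace_surjective I M x
    obtain ⟨w, rfl⟩ := toTrace_surjective _ t
    exact ⟨_, w, ht, rfl⟩
  obtain ⟨w, hw, hlen⟩ := Nat.find_spec hex
  have hmin : ∀ w' : FreeMonoid (Syllable M), evalTrace I M (toTrace _ w') = x →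
      w.toList.length ≤ w'.toList.length := by
    intro w' hw'
    rw [hlen]
    exact Nat.find_min' hex ⟨w', hw', rfl⟩
  refine ⟨toTrace _ w, ?_, hw⟩
  rintro y z ⟨i, a⟩ ⟨j, b⟩ h hij
  change i = j at hij
  subst hij
  obtain ⟨y, rfl⟩ := toTrace_surjective _ y
  obtain ⟨z, rfl⟩ := toTrace_surjective _ z
  have hl : w.toList.length = y.toList.length + 2 + z.toList.length := by
    rw [← map_mul, ← map_mul, ← map_mul] at h
    rw [(perm_of_toTrace_eq _ h).length_eq]
    simp [FreeMonoid.toList_mul]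
    omega
  have hx : evalTrace I M (toTrace _ y) * GraphProduct.of I M i (a.1 * b.1) *
      evalTrace I M (toTrace _ z) = x := by
    simp only [← hw, h, map_mul, evalTrace_of, mul_assoc]
  by_cases hab : a.1 * b.1 = 1
  · have := hmin (y * z) (by rw [map_mul, map_mul, ← hx, hab, map_one, mul_one])
    simp [FreeMonoid.toList_mul] at this
    omega
  · have := hmin (y * FreeMonoid.of ⟨i, a.1 * b.1, hab⟩ * z)
      (by rw [map_mul, map_mul, map_mul, map_mul, evalTrace_of, ← hx])
    simp [FreeMonoid.toList_mul] at this
    omega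

/-- The (unique) reduced trace representation `nf_Σ(x) ∈ M(Σ, I)` of an element `x` of the graph
product. -/
def nfSyllable (x : GraphProduct I M) : TraceMonoid (syllableGraph I M) :=
  Classical.choose (exists_reducedTrace I M x)

/-! #### The global normal form -/

variable (Γ : J → Type*)

/-- The alphabet `Γ`: the disjoint union of the alphabets `Γ i`. It is ordered first by color, then
by the orders of the alphabets `Γ i`. -/
abbrev Letter : Type _ := Σₗ i, Γ i

/-- The independence relation on `Γ` induced by the colors. -/
def letterGraph : SimpleGraph (Letter Γ) := I.comap fun a => (ofLex a).1

/-- The inclusion `(Γ i)^* → Γ^*`. -/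
def includeWord (i : J) : FreeMonoid (Γ i) →* FreeMonoid (Letter Γ) :=
  FreeMonoid.map fun a => toLex ⟨i, a⟩

theorem includeWord_comm {i j : J} (h : I.Adj i j) (v : FreeMonoid (Γ i)) (w : FreeMonoid (Γ j)) :
    toTrace (letterGraph I Γ) (includeWord Γ i v) * toTrace (letterGraph I Γ) (includeWord Γ j w) =
      toTrace (letterGraph I Γ) (includeWord Γ j w) *
        toTrace (letterGraph I Γ) (includeWord Γ i v) := by
  have h1 : ∀ (a : Γ i) (w : FreeMonoid (Γ j)),
      Commute (toTrace (letterGraph I Γ) (includeWord Γ i (FreeMonoid.of a)))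
        (toTrace (letterGraph I Γ) (includeWord Γ j w)) := by
    intro a w
    induction w using FreeMonoid.inductionOn' with
    | one => rw [map_one, map_one]; exact Commute.one_right _
    | of_mul b w ih =>
      rw [map_mul, map_mul]
      exact Commute.mul_right
        ((Con.eq _).2 (ConGen.Rel.of _ _ ⟨toLex ⟨i, a⟩, toLex ⟨j, b⟩, h, rfl, rfl⟩)) ih
  change Commute _ _
  induction v using FreeMonoid.inductionOn' with
  | one => rw [map_one, map_one]; exact Commute.one_left _
  | of_mul a v ih =>
    rw [map_mul, map_mul]
    exact Commute.mul_left (h1 a w) ih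

variable {M Γ}

/-- The homomorphism `M(Σ, I) → M(Γ, I)` replacing each letter `x ∈ M i \ {1}` by `nf i x`. -/
def expandTrace (nf : ∀ i, M i → FreeMonoid (Γ i)) :
    TraceMonoid (syllableGraph I M) →* TraceMonoid (letterGraph I Γ) :=
  traceLift (syllableGraph I M)
    (fun s => toTrace (letterGraph I Γ) (includeWord Γ s.1 (nf s.1 s.2.1)))
    (fun s t h => includeWord_comm I Γ h (nf s.1 s.2.1) (nf t.1 t.2.1))

/-- The normal form `GraphProduct I M → Γ^*` associated with local normal forms `nf i`: take the
reduced trace representation, replace its letters by their local normal forms, and take the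
lexicographic normal form of the resulting trace over `Γ`. -/
def globalNF [LinearOrder J] [∀ i, LinearOrder (Γ i)] (nf : ∀ i, M i → FreeMonoid (Γ i))
    (x : GraphProduct I M) : FreeMonoid (Letter Γ) :=
  nfLex (letterGraph I Γ) (expandTrace I nf (nfSyllable I M x))

end Monoid

end GraphProduct

/-! ### Equations with recognizable constraints -/

/-- A subset `L` of a monoid is recognizable if `L = μ⁻¹(μ(L))` for some homomorphism `μ` to a finite
monoid. -/
def IsRecognizable {M : Type*} [Monoid M] (L : Set M) : Prop :=
  ∃ (N : Type) (_ : Monoid N) (_ : Finite N) (μ : M →* N), μ ⁻¹' (μ '' L) = L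

section Equations

variable (G : Type*) [Group G] (X : Type*)

/-- The group `G[𝒳] = G * F(𝒳)`; its elements are the equations over `G` in the variables `X`. -/
abbrev EquationGroup : Type _ := Monoid.Coprod G (FreeGroup X)

variable {X}

/-- The variable `x` (for `b = true`) or its inverse (for `b = false`), as an element of `F(𝒳)`. -/
def signedVar (x : X) (b : Bool) : FreeGroup X :=
  if b then FreeGroup.of x else (FreeGroup.of x)⁻¹

variable {G}

/-- The element of `G[𝒳]` given by a letter: an element of `G` or a signed variable. -/
def evalLetter : G ⊕ (X × Bool) → EquationGroup G X
  | Sum.inl g => Monoid.Coprod.inl g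
  | Sum.inr (x, b) => Monoid.Coprod.inr (signedVar x b)

/-- The element of `G[𝒳]` represented by a word. -/
def evalWord (l : List (G ⊕ (X × Bool))) : EquationGroup G X :=
  (l.map evalLetter).prod

/-- Two letters that may be adjacent in a reduced word: not both in `G`, and not mutually inverse
variables. -/
def LetterCompat : G ⊕ (X × Bool) → G ⊕ (X × Bool) → Prop
  | Sum.inl _, Sum.inl _ => False
  | Sum.inr (x, b), Sum.inr (y, c) => ¬ (x = y ∧ b = !c)
  | _, _ => True

/-- Reduced words of the free product `G * F(𝒳)`. -/
def IsReducedWord (l : List (G ⊕ (X × Bool))) : Prop :=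
  Sum.inl 1 ∉ l ∧ l.IsChain LetterCompat

theorem exists_word (W : EquationGroup G X) : ∃ l, evalWord l = W := by
  induction W using Monoid.Coprod.induction_on with
  | inl g => exact ⟨[Sum.inl g], by simp [evalWord, evalLetter]⟩
  | inr f =>
    induction f using FreeGroup.induction_on with
    | C1 => exact ⟨[], by simp [evalWord]⟩
    | of x => exact ⟨[Sum.inr (x, true)], by simp [evalWord, evalLetter, signedVar]⟩
    | inv_of x _ => exact ⟨[Sum.inr (x, false)], by simp [evalWord, evalLetter, signedVar]⟩
    | mul f g hf hg =>
      obtain ⟨l, hl⟩ := hf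
      obtain ⟨m, hm⟩ := hg
      exact ⟨l ++ m, by rw [map_mul, ← hl, ← hm]; simp [evalWord]⟩
  | mul V W hV hW =>
    obtain ⟨l, rfl⟩ := hV
    obtain ⟨m, rfl⟩ := hW
    exact ⟨l ++ m, by simp [evalWord]⟩

theorem exists_reducedWord (W : EquationGroup G X) :
    ∃ l : List (G ⊕ (X × Bool)), IsReducedWord l ∧ evalWord l = W := by
  classical
  have hex : ∃ n : ℕ, ∃ l : List (G ⊕ (X × Bool)), evalWord l = W ∧ l.length = n := by
    obtain ⟨l, hl⟩ := exists_word W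
    exact ⟨_, l, hl, rfl⟩
  obtain ⟨l, hl, hlen⟩ := Nat.find_spec hex
  have hmin : ∀ l' : List (G ⊕ (X × Bool)), evalWord l' = W → l.length ≤ l'.length := by
    intro l' hl'
    rw [hlen]
    exact Nat.find_min' hex ⟨l', hl', rfl⟩
  refine ⟨l, ⟨?_, ?_⟩, hl⟩
  · intro h
    obtain ⟨u, v, rfl⟩ := List.append_of_mem h
    have := hmin (u ++ v) (by rw [← hl]; simp [evalWord, evalLetter])
    simp at this
  · rw [List.isChain_iff_forall_rel_of_append_cons_cons]
    rintro a b u v rfl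
    rcases a with g | ⟨x, b'⟩ <;> rcases b with h | ⟨y, c⟩
    · have := hmin (u ++ Sum.inl (g * h) :: v)
        (by rw [← hl]; simp [evalWord, evalLetter, mul_assoc])
      simp at this
    · trivial
    · trivial
    · rintro ⟨rfl, rfl⟩
      have := hmin (u ++ v) (by
        rw [← hl]
        cases c <;> simp [evalWord, evalLetter, signedVar])
      simp at this

/-- The (unique) reduced word representing an element of `G[𝒳]`. -/
def reducedWord (W : EquationGroup G X) : List (G ⊕ (X × Bool)) :=
  Classical.choose (exists_reducedWord W)

open Classical in
/-- The number of occurrences of the signed variable `(x, b)` in the reduced word representing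
`W`. -/
def occurrences (W : EquationGroup G X) (x : X) (b : Bool) : ℕ :=
  (reducedWord W).count (Sum.inr (x, b))

/-- A finite system of equations is quadratic if every variable occurs at most twice in it,
occurrences of its inverse included. -/
def IsQuadratic (S : Finset (EquationGroup G X)) : Prop :=
  ∀ x : X, ∑ W ∈ S, occurrences W x true + ∑ W ∈ S, occurrences W x false ≤ 2

/-- `σ` is a solution of the system `S` satisfying the constraints `σ(x) ∈ L x`. (The constraint
`L x` on `x` is the same as the constraint `(L x)⁻¹` on the inverse variable.) -/
def IsSolution (S : Finset (EquationGroup G X)) (L : X → Set G) (σ : EquationGroup G X →* G) :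
    Prop :=
  (∀ g : G, σ (Monoid.Coprod.inl g) = g) ∧ (∀ W ∈ S, σ W = 1) ∧
    ∀ x : X, σ (Monoid.Coprod.inr (FreeGroup.of x)) ∈ L x

/-- The full solution set: all images, under all solutions, of the variables and their inverses. -/
def solutionSet (S : Finset (EquationGroup G X)) (L : X → Set G) : Set G :=
  {g | ∃ (σ : EquationGroup G X →* G) (x : X) (b : Bool),
    IsSolution S L σ ∧ g = σ (Monoid.Coprod.inr (signedVar x b))}

end Equations

end GPQuad

end

noncomputable section
namespace GPQuad

/-! ### Quadratic systems over groups with finitely many square roots -/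

section QuadraticSystems

variable {G : Type*} {X : Type*}

/-! Two facts about the graph product reduce the theorem to a statement about abstract groups: the
normal forms of every set u p^* v with p ≠ 1 have unbounded exponent (`langExp_globalNF_pumpSet`),
and every element has finitely many square roots (`finite_sqrt_graphProduct`). The first also gives
torsion-freeness, because a language of unbounded exponent is infinite. It remains to show that over
a nontrivial torsion-free group with finitely many square roots the full solution set is finite or
contains some u p^* v with p ≠ 1 (`solutionSet_finite_or_pumpSet_subset`).

For this dichotomy (`finite_or_pumps`) the constraints depend only on residues in a finite group, so
multiplying by kernel elements is harmless. A variable occurring exactly once in some equation is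
eliminated. When no such variable is left, each variable occurs nowhere, or twice in a single
equation. A free variable is pumped by powers of a kernel element. A variable occurring with both
signs enters only through a conjugate, so it is pumped along a centralizer. If an equation has two
variables of constant sign, fixing a suitable product of them turns it into a conjugacy equation,
which is pumped as before. What is left is a X b X c = 1, that is (X b)² = a⁻¹ c⁻¹ b, and this has
finitely many solutions.

For powers, p is shortened by conjugation until its reduced word s falls into one of two cases.
Either s has a letter that commutes with all the others; then that letter contributes a single
syllable x dⁿ y and the hypothesis on the local group applies. Or no colour is both a head and a
tail of s; then u pⁿ v has reduced words x sᵏ y, with n − k constant. The lexicographic normal form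
may shuffle the copies of s, but it still contains high powers (`exists_power_of_factor_of_power`).
In a long factor all of whose long pieces contain every colour in play, compare a position at a
letter of maximal colour with the position one period later. Maximality forces the colour counts
before the two positions to agree after the shift, so the continuations coincide and the factor is
periodic. A long piece that misses a colour is treated by induction on the set of colours.

For square roots, the reduced word of a square is described precisely enough (`exists_isSquareOf`)
that a root is one of the following: a prefix of a word for g, a local root times a root of a
shorter element, or a conjugate by a first letter of g of a root of a shorter element. All of this
uses uniqueness of reduced words up to commutation, obtained from an action of the graph product on
reduced words. -/

open Classical in
/-- The number of letters of a word that are the variable `x` or its inverse. -/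
def varCount (x : X) (w : List (G ⊕ (X × Bool))) : ℕ :=
  w.countP fun l => ∃ b, l = Sum.inr (x, b)

@[simp] theorem varCount_nil (x : X) : varCount (G := G) x [] = 0 := rfl

@[simp] theorem varCount_inl (x : X) (g : G) (w : List (G ⊕ (X × Bool))) :
    varCount x (Sum.inl g :: w) = varCount x w := by simp [varCount]

@[simp] theorem varCount_self (x : X) (b : Bool) (w : List (G ⊕ (X × Bool))) :
    varCount x (Sum.inr (x, b) :: w) = varCount x w + 1 := by
  simp [varCount]

theorem varCount_ne {x y : X} (h : y ≠ x) (b : Bool) (w : List (G ⊕ (X × Bool))) :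
    varCount x (Sum.inr (y, b) :: w) = varCount x w := by
  simp [varCount, h]

@[simp] theorem varCount_append (x : X) (v w : List (G ⊕ (X × Bool))) :
    varCount x (v ++ w) = varCount x v + varCount x w := by simp [varCount]

theorem exists_first_occurrence {x : X} {w : List (G ⊕ (X × Bool))} {k : ℕ}
    (h : varCount x w = k + 1) :
    ∃ A b B, w = A ++ Sum.inr (x, b) :: B ∧ varCount x A = 0 ∧ varCount x B = k := by
  induction w with
  | nil => simp at h
  | cons l w ih =>
    have key : (∃ b, l = Sum.inr (x, b)) ∨ ∀ v, varCount x (l :: v) = varCount x v := by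
      rcases l with g | ⟨y, b⟩
      · right; simp
      · by_cases hy : y = x
        · left; exact ⟨b, by rw [hy]⟩
        · right; exact varCount_ne hy b
    rcases key with ⟨b, rfl⟩ | hl
    · exact ⟨[], b, w, rfl, rfl, by simpa using h⟩
    · obtain ⟨A, b, B, rfl, hA, hB⟩ := ih (by rw [← hl, h])
      exact ⟨l :: A, b, B, rfl, by rw [hl, hA], hB⟩

theorem exists_two_occurrences {x : X} {w : List (G ⊕ (X × Bool))} (h : varCount x w = 2) :
    ∃ A b B c C, w = A ++ Sum.inr (x, b) :: (B ++ Sum.inr (x, c) :: C) ∧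
      varCount x A = 0 ∧ varCount x B = 0 ∧ varCount x C = 0 := by
  obtain ⟨A, b, D, rfl, hA, hD⟩ := exists_first_occurrence h
  obtain ⟨B, c, C, rfl, hB, hC⟩ := exists_first_occurrence hD
  exact ⟨A, b, B, c, C, rfl, hA, hB, hC⟩

/-- The words in which all occurrences of `x` have the sign `s`. -/
def HasSign (x : X) (s : Bool) (w : List (G ⊕ (X × Bool))) : Prop := Sum.inr (x, !s) ∉ w

theorem HasSign.exists_two_occurrences {x : X} {s : Bool} {w : List (G ⊕ (X × Bool))}
    (hs : HasSign x s w) (h : varCount x w = 2) :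
    ∃ A B C, w = A ++ Sum.inr (x, s) :: (B ++ Sum.inr (x, s) :: C) ∧
      varCount x A = 0 ∧ varCount x B = 0 ∧ varCount x C = 0 := by
  obtain ⟨A, b, B, c, C, rfl, hA, hB, hC⟩ := GPQuad.exists_two_occurrences h
  simp [HasSign] at hs
  have hb : b = s := by
    have := hs.2.1; cases b <;> cases s <;> simp at this ⊢
  have hc : c = s := by
    have := hs.2.2.2.1; cases c <;> cases s <;> simp at this ⊢
  subst hb hc
  exact ⟨A, B, C, rfl, hA, hB, hC⟩

theorem HasSign.exists_occurrence {x : X} {s : Bool} {w : List (G ⊕ (X × Bool))}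
    (hs : HasSign x s w) (h : varCount x w = 1) :
    ∃ A B, w = A ++ Sum.inr (x, s) :: B ∧ varCount x A = 0 ∧ varCount x B = 0 := by
  obtain ⟨A, b, B, rfl, hA, hB⟩ := exists_first_occurrence h
  simp [HasSign] at hs
  have hb : b = s := by
    have := hs.2.1; cases b <;> cases s <;> simp at this ⊢
  subst hb
  exact ⟨A, B, rfl, hA, hB⟩

/-- The number of occurrences of a variable in a system. -/
def totalCount (x : X) (E : List (List (G ⊕ (X × Bool)))) : ℕ := (E.map (varCount x)).sum

@[simp] theorem totalCount_cons (x : X) (w : List (G ⊕ (X × Bool))) (E) :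
    totalCount x (w :: E) = varCount x w + totalCount x E := by simp [totalCount]

@[simp] theorem totalCount_append (x : X) (E F : List (List (G ⊕ (X × Bool)))) :
    totalCount x (E ++ F) = totalCount x E + totalCount x F := by simp [totalCount]

theorem varCount_le_totalCount (x : X) {w : List (G ⊕ (X × Bool))} {E} (h : w ∈ E) :
    varCount x w ≤ totalCount x E :=
  List.single_le_sum (by simp) _ (List.mem_map_of_mem h)

/-- Two distinct words of a system share the occurrences of a variable. -/
theorem varCount_add_le_totalCount (x : X) {w w' : List (G ⊕ (X × Bool))} {E}
    (h : w ∈ E) (h' : w' ∈ E) (hne : w' ≠ w) :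
    varCount x w + varCount x w' ≤ totalCount x E := by
  let _ : DecidableEq (List (G ⊕ (X × Bool))) := Classical.decEq _
  have hp := List.perm_cons_erase h
  have : totalCount x E = totalCount x (w :: E.erase w) := (hp.map (varCount x)).sum_eq
  rw [this, totalCount_cons]
  gcongr
  exact varCount_le_totalCount x ((List.mem_erase_of_ne hne).2 h')

/-! ### Evaluation, inversion and substitution of words. -/

variable [Group G]

/-- The value of a letter under an assignment of the variables. -/
def letterAt (f : X → G) : G ⊕ (X × Bool) → G
  | Sum.inl g => g
  | Sum.inr (x, true) => f x
  | Sum.inr (x, false) => (f x)⁻¹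

/-- The value of a word under an assignment of the variables. -/
def evalAt (f : X → G) (w : List (G ⊕ (X × Bool))) : G := (w.map (letterAt f)).prod

@[simp] theorem evalAt_nil (f : X → G) : evalAt f [] = 1 := rfl

@[simp] theorem evalAt_cons (f : X → G) (l : G ⊕ (X × Bool)) (w : List (G ⊕ (X × Bool))) :
    evalAt f (l :: w) = letterAt f l * evalAt f w := by simp [evalAt]

@[simp] theorem evalAt_append (f : X → G) (v w : List (G ⊕ (X × Bool))) :
    evalAt f (v ++ w) = evalAt f v * evalAt f w := by simp [evalAt]

theorem evalAt_congr {f f' : X → G} {w : List (G ⊕ (X × Bool))}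
    (h : ∀ x, varCount x w ≠ 0 → f x = f' x) : evalAt f w = evalAt f' w := by
  induction w with
  | nil => rfl
  | cons l w ih =>
    have ih' : evalAt f w = evalAt f' w := ih fun x hx => h x (by
      have := varCount_append x [l] w
      simp only [List.singleton_append] at this
      omega)
    rw [evalAt_cons, evalAt_cons, ih']
    rcases l with g | ⟨x, b⟩
    · rfl
    · have := h x (by simp)
      cases b <;> simp [letterAt, this]

theorem evalAt_update_of_varCount {f : X → G} {w : List (G ⊕ (X × Bool))} [DecidableEq X] {x : X}
    (h : varCount x w = 0) (g : G) : evalAt (Function.update f x g) w = evalAt f w :=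
  evalAt_congr fun y hy => Function.update_of_ne (by rintro rfl; exact hy h) _ _

/-- Lets a constraint survive elimination: a constraint on the eliminated variable becomes one on
the others that still depends only on residues. -/
theorem map_evalAt_congr {Q : Type*} [Group Q] (φ : G →* Q) {f f' : X → G}
    (h : ∀ x, φ (f x) = φ (f' x)) (w : List (G ⊕ (X × Bool))) :
    φ (evalAt f w) = φ (evalAt f' w) := by
  induction w with
  | nil => rfl
  | cons l w ih =>
    rw [evalAt_cons, evalAt_cons, map_mul, map_mul, ih]
    rcases l with g | ⟨x, b⟩
    · rfl
    · cases b <;> simp [letterAt, h]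

/-- The formal inverse of a letter. -/
def invLetter : G ⊕ (X × Bool) → G ⊕ (X × Bool)
  | Sum.inl g => Sum.inl g⁻¹
  | Sum.inr (x, b) => Sum.inr (x, !b)

/-- The formal inverse of a word. -/
def invWord (w : List (G ⊕ (X × Bool))) : List (G ⊕ (X × Bool)) := (w.map invLetter).reverse

@[simp] theorem evalAt_invWord (f : X → G) (w : List (G ⊕ (X × Bool))) :
    evalAt f (invWord w) = (evalAt f w)⁻¹ := by
  induction w with
  | nil => simp [invWord]
  | cons l w ih =>
    have : invWord (l :: w) = invWord w ++ [invLetter l] := by simp [invWord]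
    rw [this, evalAt_append, ih]
    rcases l with g | ⟨x, _ | _⟩ <;> simp [letterAt, invLetter]

@[simp] theorem varCount_invWord (x : X) (w : List (G ⊕ (X × Bool))) :
    varCount x (invWord w) = varCount x w := by
  induction w with
  | nil => simp [invWord]
  | cons l w ih =>
    have : invWord (l :: w) = invWord w ++ [invLetter l] := by simp [invWord]
    rw [this, varCount_append, ih]
    rcases l with g | ⟨y, b⟩
    · simp [invLetter]
    · by_cases h : y = x
      · subst h; simp [invLetter]
      · simp [invLetter, varCount_ne h]

open Classical in
/-- Substitution of the word `r` for the variable `x` in a letter. -/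
def substLetter (x : X) (r : List (G ⊕ (X × Bool))) : G ⊕ (X × Bool) → List (G ⊕ (X × Bool))
  | Sum.inl g => [Sum.inl g]
  | Sum.inr (y, b) => if y = x then (if b then r else invWord r) else [Sum.inr (y, b)]

/-- Substitution of the word `r` for the variable `x`. -/
def substWord (x : X) (r w : List (G ⊕ (X × Bool))) : List (G ⊕ (X × Bool)) :=
  w.flatMap (substLetter x r)

theorem evalAt_substWord [DecidableEq X] (f : X → G) (x : X) (r w : List (G ⊕ (X × Bool))) :
    evalAt f (substWord x r w) = evalAt (Function.update f x (evalAt f r)) w := by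
  induction w with
  | nil => rfl
  | cons l w ih =>
    have : substWord x r (l :: w) = substLetter x r l ++ substWord x r w := by simp [substWord]
    rw [this, evalAt_append, evalAt_cons, ih]
    congr 1
    rcases l with g | ⟨y, b⟩
    · simp [substLetter, letterAt]
    · by_cases h : y = x
      · subst h; cases b <;> simp [substLetter, letterAt]
      · cases b <;> simp [substLetter, letterAt, h]

theorem varCount_substWord (x y : X) (r w : List (G ⊕ (X × Bool))) (h : y ≠ x) :
    varCount y (substWord x r w) = varCount y w + varCount x w * varCount y r := by
  induction w with
  | nil => simp [substWord]
  | cons l w ih =>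
    have : substWord x r (l :: w) = substLetter x r l ++ substWord x r w := by simp [substWord]
    rw [this, varCount_append, ih]
    rcases l with g | ⟨z, b⟩
    · simp [substLetter]
    · by_cases hz : z = x
      · subst hz
        rw [varCount_self, varCount_ne h.symm]
        cases b <;> simp [substLetter] <;> ring
      · rw [varCount_ne hz]
        have : substLetter x r (Sum.inr (z, b)) = [Sum.inr (z, b)] := by simp [substLetter, hz]
        rw [this, ← add_assoc, ← varCount_append]
        rfl

theorem varCount_substWord_self (x : X) (r w : List (G ⊕ (X × Bool))) (h : varCount x r = 0) :
    varCount x (substWord x r w) = 0 := by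
  induction w with
  | nil => rfl
  | cons l w ih =>
    have : substWord x r (l :: w) = substLetter x r l ++ substWord x r w := by simp [substWord]
    rw [this, varCount_append, ih]
    rcases l with g | ⟨z, b⟩
    · simp [substLetter]
    · by_cases hz : z = x
      · subst hz
        cases b <;> simp [substLetter, h]
      · have : substLetter x r (Sum.inr (z, b)) = [Sum.inr (z, b)] := by simp [substLetter, hz]
        rw [this, varCount_ne hz]
        rfl

/-- The assignments that solve the system `E` and satisfy the constraint `P`. -/
def solutions (E : List (List (G ⊕ (X × Bool)))) (P : (X → G) → Prop) : Set (X → G) :=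
  {f | (∀ w ∈ E, evalAt f w = 1) ∧ P f}

/-- The value of a variable, pumped along the assignments in `T`, contains a set `u p^* v`. -/
def Pumps (T : Set (X → G)) (x : X) : Prop :=
  ∃ u p v : G, p ≠ 1 ∧ ∀ n : ℕ, ∃ f ∈ T, f x = u * p ^ n * v

/-- Serves back-substitution: an eliminated variable is the value of a word in variables already
known to take finitely many values. -/
theorem finite_evalAt {T : Set (X → G)} {w : List (G ⊕ (X × Bool))}
    (h : ∀ x, varCount x w ≠ 0 → ((fun f : X → G => f x) '' T).Finite) :
    ((fun f => evalAt f w) '' T).Finite := by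
  induction w with
  | nil => exact (Set.finite_singleton 1).subset (by rintro _ ⟨f, -, rfl⟩; rfl)
  | cons l w ih =>
    have ih' := ih fun x hx => h x (by
      have := varCount_append x [l] w
      simp only [List.singleton_append] at this
      omega)
    have hl : ((fun f => letterAt f l) '' T).Finite := by
      rcases l with g | ⟨x, b⟩
      · exact (Set.finite_singleton g).subset (by rintro _ ⟨f, -, rfl⟩; rfl)
      · have hx := h x (by simp)
        cases b
        · refine (hx.image (·⁻¹)).subset ?_
          rintro _ ⟨f, hf, rfl⟩
          exact ⟨f x, ⟨f, hf, rfl⟩, rfl⟩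
        · exact hx
    refine (Set.Finite.image2 (· * ·) hl ih').subset ?_
    rintro _ ⟨f, hf, rfl⟩
    exact ⟨_, ⟨f, hf, rfl⟩, _, ⟨f, hf, rfl⟩, by simp⟩

/-! ### Pumping a single equation in a group. -/

section Pumping

variable {Q : Type*} [Group Q] [Finite Q] (φ : G →* Q)

/-- By Lagrange the exponent k = |Q| kills every residue, and torsion-freeness keeps the power
nontrivial. -/
theorem exists_ne_one_map_eq_one
    (htf : ∀ p : G, p ≠ 1 → ∀ n : ℕ, n ≠ 0 → p ^ n ≠ 1) (a : G) (ha : a ≠ 1) :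
    ∃ k : ℕ, a ^ k ≠ 1 ∧ φ (a ^ k) = 1 :=
  ⟨Nat.card Q, htf a ha _ Nat.card_pos.ne', by rw [map_pow, pow_card_eq_one']⟩

/-- The solutions `z` of `z a z⁻¹ = b` with prescribed image under `φ` can be pumped. -/
theorem pump_conjugator [Nontrivial G]
    (htf : ∀ p : G, p ≠ 1 → ∀ n : ℕ, n ≠ 0 → p ^ n ≠ 1) (z a : G) :
    ∃ u p v : G, p ≠ 1 ∧ ∀ n : ℕ, φ (u * p ^ n * v) = φ z ∧
      (u * p ^ n * v) * a * (u * p ^ n * v)⁻¹ = z * a * z⁻¹ := by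
  -- For a = 1 there is no condition on z, so any nontrivial kernel element may be used for pumping.
  by_cases ha : a = 1
  · obtain ⟨g, hg⟩ := exists_ne (1 : G)
    obtain ⟨k, hk, hφ⟩ := exists_ne_one_map_eq_one φ htf g hg
    refine ⟨z, g ^ k, 1, hk, fun n => ⟨by simp only [map_mul, map_pow φ (g ^ k), hφ]; simp, ?_⟩⟩
    simp [ha]
  -- Otherwise z is multiplied on the right by powers of a, which centralize a.
  · obtain ⟨k, hk, hφ⟩ := exists_ne_one_map_eq_one φ htf a ha
    refine ⟨z, a ^ k, 1, hk, fun n => ⟨by simp only [map_mul, map_pow φ (a ^ k), hφ]; simp, ?_⟩⟩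
    have : Commute ((a ^ k) ^ n) a := ((Commute.refl a).pow_left k).pow_left n
    rw [mul_one, mul_assoc z, this.eq]
    group

/-- Keep q = x c z fixed and put y = z⁻¹, so x = q y c⁻¹. The left side becomes q · y (c⁻¹ b q d)
y⁻¹ · e, which sees y only through a conjugate. -/
theorem pump_two_nested [Nontrivial G]
    (htf : ∀ p : G, p ≠ 1 → ∀ n : ℕ, n ≠ 0 → p ^ n ≠ 1)
    {x z b c d e : G} (h : x * b * x * c * z * d * z * e = 1) :
    ∃ u p v : G, p ≠ 1 ∧ ∀ n : ℕ, ∃ x' z' : G, φ x' = φ x ∧ φ z' = φ z ∧ z' = u * p ^ n * v ∧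
      x' * b * x' * c * z' * d * z' * e = 1 := by
  obtain ⟨u, p, v, hp, H⟩ := pump_conjugator φ htf z⁻¹ (c⁻¹ * b * (x * c * z) * d)
  refine ⟨v⁻¹, p⁻¹, u⁻¹, inv_ne_one.2 hp, fun n => ?_⟩
  obtain ⟨h1, h2⟩ := H n
  set y := u * p ^ n * v with hy
  have hyz : φ y⁻¹ = φ z := by rw [map_inv, h1, map_inv, inv_inv]
  refine ⟨x * c * z * y * c⁻¹, y⁻¹, ?_, hyz, by rw [hy]; simp [mul_assoc], ?_⟩
  · have : φ y = (φ z)⁻¹ := by rw [h1, map_inv]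
    simp only [map_mul, this, map_inv]; group
  · have e1 : x * c * z * y * c⁻¹ * b * (x * c * z * y * c⁻¹) * c * y⁻¹ * d * y⁻¹ * e
        = x * c * z * (y * (c⁻¹ * b * (x * c * z) * d) * y⁻¹) * e := by group
    rw [e1, h2, ← h]; group

/-- Keep q = x b z fixed and put y = z⁻¹, so x = q y b⁻¹. The left side becomes q c q · y (b⁻¹ d)
y⁻¹ · e, again a conjugacy condition on y. -/
theorem pump_two_crossed [Nontrivial G]
    (htf : ∀ p : G, p ≠ 1 → ∀ n : ℕ, n ≠ 0 → p ^ n ≠ 1)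
    {x z b c d e : G} (h : x * b * z * c * x * d * z * e = 1) :
    ∃ u p v : G, p ≠ 1 ∧ ∀ n : ℕ, ∃ x' z' : G, φ x' = φ x ∧ φ z' = φ z ∧ z' = u * p ^ n * v ∧
      x' * b * z' * c * x' * d * z' * e = 1 := by
  obtain ⟨u, p, v, hp, H⟩ := pump_conjugator φ htf z⁻¹ (b⁻¹ * d)
  refine ⟨v⁻¹, p⁻¹, u⁻¹, inv_ne_one.2 hp, fun n => ?_⟩
  obtain ⟨h1, h2⟩ := H n
  set y := u * p ^ n * v with hy
  have hyz : φ y⁻¹ = φ z := by rw [map_inv, h1, map_inv, inv_inv]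
  refine ⟨x * b * z * y * b⁻¹, y⁻¹, ?_, hyz, by rw [hy]; simp [mul_assoc], ?_⟩
  · have : φ y = (φ z)⁻¹ := by rw [h1, map_inv]
    simp only [map_mul, this, map_inv]; group
  · have e1 : x * b * z * y * b⁻¹ * b * y⁻¹ * c * (x * b * z * y * b⁻¹) * d * y⁻¹ * e
        = x * b * z * c * (x * b * z) * (y * (b⁻¹ * d) * y⁻¹) * e := by group
    rw [e1, h2, ← h]; group

end Pumping

/-! ### Pumping in quadratic systems, elimination, and the dichotomy. -/

section Dichotomy

variable {Q : Type*} [Group Q] (φ : G →* Q)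

/-- The element `g` or its inverse, according to a sign. -/
def signed (b : Bool) (g : G) : G := if b then g else g⁻¹

theorem letterAt_var (f : X → G) (x : X) (b : Bool) :
    letterAt f (Sum.inr (x, b)) = signed b (f x) := by
  cases b <;> rfl

@[simp] theorem signed_signed (b : Bool) (g : G) : signed b (signed b g) = g := by
  cases b <;> simp [signed]

theorem map_signed (b : Bool) (g : G) : φ (signed b g) = signed b (φ g) := by
  cases b <;> simp [signed]

theorem signed_injective (b : Bool) : Function.Injective (signed b : G → G) :=
  fun g h e => by rw [← signed_signed b g, e, signed_signed]

theorem Pumps.of_signed {T : Set (X → G)} {x : X} (b : Bool) {u p v : G} (hp : p ≠ 1)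
    (h : ∀ n : ℕ, ∃ f ∈ T, signed b (f x) = u * p ^ n * v) : Pumps T x := by
  cases b
  · refine ⟨v⁻¹, p⁻¹, u⁻¹, inv_ne_one.2 hp, fun n => ?_⟩
    obtain ⟨f, hf, e⟩ := h n
    refine ⟨f, hf, ?_⟩
    rw [← inv_inv (f x)]
    change (signed false (f x))⁻¹ = _
    rw [e]
    simp [mul_assoc]
  · exact ⟨u, p, v, hp, h⟩

/-- A variable that uses up both its occurrences in w is absent from all other words, so changing it
affects no other equation. This is where quadraticity enters the pumping arguments. -/
theorem mem_solutions_of_eq_off {E : List (List (G ⊕ (X × Bool)))} {P : (X → G) → Prop}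
    (hP : ∀ f f' : X → G, (∀ x, φ (f x) = φ (f' x)) → P f → P f')
    (hE : ∀ x, totalCount x E ≤ 2) {w : List (G ⊕ (X × Bool))} (hw : w ∈ E) {f f' : X → G}
    (hf : f ∈ solutions E P) (hφ : ∀ x, φ (f x) = φ (f' x))
    (hoff : ∀ x, f x ≠ f' x → 2 ≤ varCount x w) (hw' : evalAt f' w = 1) : f' ∈ solutions E P := by
  refine ⟨fun w' hw'' => ?_, hP f f' hφ hf.2⟩
  by_cases h : w' = w
  · rw [h, hw']
  · rw [← hf.1 w' hw'']
    refine (evalAt_congr fun x hx => ?_).symm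
    by_contra hne
    have := varCount_add_le_totalCount x hw hw'' h
    have := hoff x hne
    have := hE x
    omega

/-- Only the constraint restricts such a variable, and powers of a kernel element do not change
residues. -/
theorem pumps_of_not_occurring [Finite Q] [Nontrivial G]
    (htf : ∀ p : G, p ≠ 1 → ∀ n : ℕ, n ≠ 0 → p ^ n ≠ 1)
    {E : List (List (G ⊕ (X × Bool)))} {P : (X → G) → Prop}
    (hP : ∀ f f' : X → G, (∀ x, φ (f x) = φ (f' x)) → P f → P f') {x : X}
    (hx : totalCount x E = 0) {f : X → G} (hf : f ∈ solutions E P) :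
    Pumps (solutions E P) x := by
  classical
  obtain ⟨g, hg⟩ := exists_ne (1 : G)
  obtain ⟨k, hk, hφ⟩ := exists_ne_one_map_eq_one φ htf g hg
  refine ⟨f x, g ^ k, 1, hk, fun n =>
    ⟨Function.update f x (f x * (g ^ k) ^ n * 1), ⟨fun w hw => ?_, ?_⟩, by simp⟩⟩
  · rw [evalAt_update_of_varCount (Nat.le_zero.1 (hx ▸ varCount_le_totalCount x hw))]
    exact hf.1 w hw
  · refine hP f _ (fun y => ?_) hf.2
    by_cases hy : y = x
    · subst hy
      rw [Function.update_self, map_mul, map_mul, map_pow φ (g ^ k), hφ]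
      simp
    · rw [Function.update_of_ne hy]

/-- The value of x enters the equation only by conjugating the value of B, so `pump_conjugator`
applies. -/
theorem pumps_of_opposite [Finite Q] [Nontrivial G]
    (htf : ∀ p : G, p ≠ 1 → ∀ n : ℕ, n ≠ 0 → p ^ n ≠ 1)
    {E : List (List (G ⊕ (X × Bool)))} {P : (X → G) → Prop}
    (hP : ∀ f f' : X → G, (∀ x, φ (f x) = φ (f' x)) → P f → P f')
    (hE : ∀ x, totalCount x E ≤ 2) {x : X} {b : Bool} {A B C : List (G ⊕ (X × Bool))}
    (hw : A ++ Sum.inr (x, b) :: (B ++ Sum.inr (x, !b) :: C) ∈ E)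
    (hA : varCount x A = 0) (hB : varCount x B = 0) (hC : varCount x C = 0)
    {f : X → G} (hf : f ∈ solutions E P) : Pumps (solutions E P) x := by
  classical
  obtain ⟨u, p, v, hp, H⟩ := pump_conjugator φ htf (signed b (f x)) (evalAt f B)
  have hinv : ∀ g : G, signed (!b) g = (signed b g)⁻¹ := by cases b <;> simp [signed]
  refine Pumps.of_signed b (u := u) (v := v) hp fun n =>
    ⟨Function.update f x (signed b (u * p ^ n * v)), ?_, by simp⟩
  obtain ⟨h1, h2⟩ := H n
  refine mem_solutions_of_eq_off φ hP hE hw hf (fun y => ?_) (fun y hy => ?_) ?_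
  · by_cases hy : y = x
    · subst hy
      rw [Function.update_self, map_signed, h1, map_signed, signed_signed]
    · rw [Function.update_of_ne hy]
  · by_cases hyx : y = x
    · subst hyx; simp; omega
    · rw [Function.update_of_ne hyx] at hy; exact absurd rfl hy
  · have h0 := hf.1 _ hw
    simp only [evalAt_append, evalAt_cons, letterAt_var, hinv] at h0 ⊢
    rw [evalAt_update_of_varCount hA, evalAt_update_of_varCount hB, evalAt_update_of_varCount hC,
      Function.update_self, signed_signed, ← h0, ← mul_assoc _ (evalAt f B),
      ← mul_assoc _ _ (evalAt f C), h2]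
    simp only [mul_assoc]

/-- Pumping the second of two variables, given that the equation can be pumped in the group. -/
theorem pumps_of_pair {E : List (List (G ⊕ (X × Bool)))} {P : (X → G) → Prop}
    (hP : ∀ f f' : X → G, (∀ x, φ (f x) = φ (f' x)) → P f → P f')
    (hE : ∀ x, totalCount x E ≤ 2) {x z : X} (hxz : x ≠ z) (s t : Bool)
    {w : List (G ⊕ (X × Bool))} (hw : w ∈ E) (hx : 2 ≤ varCount x w) (hz : 2 ≤ varCount z w)
    {f : X → G} (hf : f ∈ solutions E P) (Eq : G → G → Prop)
    (hEq : ∀ f' : X → G, (∀ y, y ≠ x → y ≠ z → f' y = f y) →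
      (evalAt f' w = 1 ↔ Eq (signed s (f' x)) (signed t (f' z))))
    (h : Eq (signed s (f x)) (signed t (f z)) → ∃ u p v : G, p ≠ 1 ∧ ∀ n : ℕ, ∃ x' z' : G,
      φ x' = φ (signed s (f x)) ∧ φ z' = φ (signed t (f z)) ∧ z' = u * p ^ n * v ∧ Eq x' z') :
    Pumps (solutions E P) z := by
  classical
  obtain ⟨u, p, v, hp, H⟩ := h ((hEq f fun _ _ _ => rfl).1 (hf.1 w hw))
  refine Pumps.of_signed t (u := u) (v := v) hp fun n => ?_
  obtain ⟨x', z', h1, h2, h3, h4⟩ := H n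
  refine ⟨Function.update (Function.update f x (signed s x')) z (signed t z'), ?_, by simp [h3]⟩
  refine mem_solutions_of_eq_off φ hP hE hw hf (fun y => ?_) (fun y hy => ?_) ?_
  · by_cases hy : y = z
    · subst hy
      rw [Function.update_self, map_signed, h2, map_signed, signed_signed]
    · rw [Function.update_of_ne hy]
      by_cases hy : y = x
      · subst hy
        rw [Function.update_self, map_signed, h1, map_signed, signed_signed]
      · rw [Function.update_of_ne hy]
  · by_cases hyz : y = z
    · rwa [hyz]
    · by_cases hyx : y = x
      · rwa [hyx]
      · rw [Function.update_of_ne hyz, Function.update_of_ne hyx] at hy; exact absurd rfl hy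
  · refine (hEq _ fun y hyx hyz => ?_).2 ?_
    · rw [Function.update_of_ne hyz, Function.update_of_ne hyx]
    · rw [Function.update_self, Function.update_of_ne hxz, Function.update_self]
      simpa using h4

theorem evalAt_congr_pair {x z : X} {f f' : X → G} (h : ∀ y, y ≠ x → y ≠ z → f' y = f y)
    {w : List (G ⊕ (X × Bool))} (hx : varCount x w = 0) (hz : varCount z w = 0) :
    evalAt f' w = evalAt f w :=
  evalAt_congr fun y hy => h y (by rintro rfl; exact hy hx) (by rintro rfl; exact hy hz)

/-- The two occurrences of x cut the cyclic word w into two arcs; here both occurrences of z lie in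
the same arc. -/
theorem pumps_of_nested [Finite Q] [Nontrivial G]
    (htf : ∀ p : G, p ≠ 1 → ∀ n : ℕ, n ≠ 0 → p ^ n ≠ 1)
    {E : List (List (G ⊕ (X × Bool)))} {P : (X → G) → Prop}
    (hP : ∀ f f' : X → G, (∀ x, φ (f x) = φ (f' x)) → P f → P f')
    (hE : ∀ x, totalCount x E ≤ 2) {x z : X} (hxz : x ≠ z) {s t : Bool}
    {w : List (G ⊕ (X × Bool))} (hw : w ∈ E) (hx : 2 ≤ varCount x w) (hz : 2 ≤ varCount z w)
    {B D : List (G ⊕ (X × Bool))}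
    (hrot : ∀ f : X → G, evalAt f w = 1 ↔
      evalAt f (Sum.inr (x, s) :: B ++ Sum.inr (x, s) :: D) = 1)
    (hBx : varCount x B = 0) (hDx : varCount x D = 0) (hBz : varCount z B = 0)
    (hDz : varCount z D = 2) (hDt : HasSign z t D) {f : X → G} (hf : f ∈ solutions E P) :
    Pumps (solutions E P) z := by
  obtain ⟨D₁, D₂, D₃, rfl, h1, h2, h3⟩ := hDt.exists_two_occurrences hDz
  simp [varCount_ne hxz.symm] at hDx
  refine pumps_of_pair φ hP hE hxz s t hw hx hz hf
    (fun a b => a * evalAt f B * a * evalAt f D₁ * b * evalAt f D₂ * b * evalAt f D₃ = 1)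
    (fun f' hf' => ?_) (pump_two_nested φ htf)
  rw [hrot]
  simp only [List.cons_append, evalAt_append, evalAt_cons, letterAt_var]
  rw [evalAt_congr_pair hf' hBx hBz, evalAt_congr_pair hf' (by omega) h1,
    evalAt_congr_pair hf' (by omega) h2, evalAt_congr_pair hf' (by omega) h3]
  simp only [mul_assoc]

/-- Here each of the two arcs between the occurrences of x contains one occurrence of z. -/
theorem pumps_of_crossed [Finite Q] [Nontrivial G]
    (htf : ∀ p : G, p ≠ 1 → ∀ n : ℕ, n ≠ 0 → p ^ n ≠ 1)
    {E : List (List (G ⊕ (X × Bool)))} {P : (X → G) → Prop}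
    (hP : ∀ f f' : X → G, (∀ x, φ (f x) = φ (f' x)) → P f → P f')
    (hE : ∀ x, totalCount x E ≤ 2) {x z : X} (hxz : x ≠ z) {s t : Bool}
    {w : List (G ⊕ (X × Bool))} (hw : w ∈ E) (hx : 2 ≤ varCount x w) (hz : 2 ≤ varCount z w)
    {B D : List (G ⊕ (X × Bool))}
    (hrot : ∀ f : X → G, evalAt f w = 1 ↔
      evalAt f (Sum.inr (x, s) :: B ++ Sum.inr (x, s) :: D) = 1)
    (hBx : varCount x B = 0) (hDx : varCount x D = 0) (hBz : varCount z B = 1)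
    (hDz : varCount z D = 1) (hBt : HasSign z t B) (hDt : HasSign z t D)
    {f : X → G} (hf : f ∈ solutions E P) : Pumps (solutions E P) z := by
  obtain ⟨B₁, B₂, rfl, h1, h2⟩ := hBt.exists_occurrence hBz
  obtain ⟨D₁, D₂, rfl, h3, h4⟩ := hDt.exists_occurrence hDz
  simp [varCount_ne hxz.symm] at hDx hBx
  refine pumps_of_pair φ hP hE hxz s t hw hx hz hf
    (fun a b => a * evalAt f B₁ * b * evalAt f B₂ * a * evalAt f D₁ * b * evalAt f D₂ = 1)
    (fun f' hf' => ?_) (pump_two_crossed φ htf)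
  rw [hrot]
  simp only [List.cons_append, evalAt_append, evalAt_cons, letterAt_var]
  rw [evalAt_congr_pair hf' (by omega) h1, evalAt_congr_pair hf' (by omega) h2,
    evalAt_congr_pair hf' (by omega) h3, evalAt_congr_pair hf' (by omega) h4]
  simp only [mul_assoc]

/-- A word containing two variables, each of them twice and with a constant sign. -/
theorem pumps_of_two_variables [Finite Q] [Nontrivial G]
    (htf : ∀ p : G, p ≠ 1 → ∀ n : ℕ, n ≠ 0 → p ^ n ≠ 1)
    {E : List (List (G ⊕ (X × Bool)))} {P : (X → G) → Prop}
    (hP : ∀ f f' : X → G, (∀ x, φ (f x) = φ (f' x)) → P f → P f')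
    (hE : ∀ x, totalCount x E ≤ 2) {x z : X} (hxz : x ≠ z) {s t : Bool}
    {w : List (G ⊕ (X × Bool))} (hw : w ∈ E) (hx : varCount x w = 2) (hz : varCount z w = 2)
    (hs : HasSign x s w) (ht : HasSign z t w) {f : X → G} (hf : f ∈ solutions E P) :
    Pumps (solutions E P) z := by
  obtain ⟨A, B, C, rfl, hA, hB, hC⟩ := hs.exists_two_occurrences hx
  have hCA : varCount x (C ++ A) = 0 := by simp [hA, hC]
  -- Being 1 is invariant under cyclic permutation, so the word may be read from either occurrence
  -- of x. The two readings exchange the arcs B and C A.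
  have rot : ∀ f : X → G, evalAt f (A ++ Sum.inr (x, s) :: (B ++ Sum.inr (x, s) :: C)) = 1 ↔
      evalAt f (Sum.inr (x, s) :: B ++ Sum.inr (x, s) :: (C ++ A)) = 1 := fun f => by
    simp only [List.cons_append, evalAt_append, evalAt_cons]
    rw [mul_eq_one_iff_eq_inv', ← mul_eq_one_iff_eq_inv]
    simp only [mul_assoc]
  have rot' : ∀ f : X → G, evalAt f (A ++ Sum.inr (x, s) :: (B ++ Sum.inr (x, s) :: C)) = 1 ↔
      evalAt f (Sum.inr (x, s) :: (C ++ A) ++ Sum.inr (x, s) :: B) = 1 := fun f => by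
    rw [rot]
    simp only [List.cons_append, evalAt_append, evalAt_cons]
    rw [← mul_assoc, mul_eq_one_iff_eq_inv', ← mul_eq_one_iff_eq_inv]
    simp only [mul_assoc]
  have hsum : varCount z B + varCount z (C ++ A) = 2 := by
    simp [varCount_ne hxz] at hz ⊢; omega
  have htB : HasSign z t B := by simp [HasSign] at ht ⊢; tauto
  have htCA : HasSign z t (C ++ A) := by simp [HasSign] at ht ⊢; tauto
  obtain h | h | h : varCount z B = 0 ∨ varCount z B = 1 ∨ varCount z B = 2 := by omega
  · exact pumps_of_nested φ htf hP hE hxz hw hx.ge hz.ge rot hB hCA h (by omega) htCA hf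
  · exact pumps_of_crossed φ htf hP hE hxz hw hx.ge hz.ge rot hB hCA h (by omega) htB htCA hf
  · exact pumps_of_nested φ htf hP hE hxz hw hx.ge hz.ge rot' hCA hB (by omega) h htB hf

/-- A single variable occurring twice with the same sign is determined by a square. -/
theorem finite_of_single_variable (hsq : ∀ g : G, {h : G | h ^ 2 = g}.Finite)
    {T : Set (X → G)} {x : X} {s : Bool} {w : List (G ⊕ (X × Bool))}
    (hT : ∀ f ∈ T, evalAt f w = 1) (hx : varCount x w = 2) (hs : HasSign x s w)
    (hother : ∀ z, z ≠ x → varCount z w = 0) : ((fun f : X → G => f x) '' T).Finite := by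
  obtain ⟨A, B, C, rfl, hA, hB, hC⟩ := hs.exists_two_occurrences hx
  rcases T.eq_empty_or_nonempty with rfl | ⟨f₀, hf₀⟩
  · simp
  have hconst : ∀ D : List (G ⊕ (X × Bool)), varCount x D = 0 →
      (∀ z, z ≠ x → varCount z D = 0) → ∀ f : X → G, evalAt f D = evalAt f₀ D :=
    fun D h h' f => evalAt_congr fun y hy => by
      by_cases hyx : y = x
      · subst hyx; exact absurd h hy
      · exact absurd (h' y hyx) hy
  have hz : ∀ z, z ≠ x → varCount z A = 0 ∧ varCount z B = 0 ∧ varCount z C = 0 := fun z hz => by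
    have := hother z hz
    simp [varCount_ne hz.symm] at this; omega
  set a := evalAt f₀ A
  set b := evalAt f₀ B
  set c := evalAt f₀ C
  -- With y the signed value of x, the equation a y b y c = 1 says (y b)² = a⁻¹ c⁻¹ b.
  refine (((hsq (a⁻¹ * c⁻¹ * b)).image (· * b⁻¹)).image (signed s)).subset ?_
  rintro _ ⟨f, hf, rfl⟩
  have h := hT f hf
  simp only [evalAt_append, evalAt_cons, letterAt_var] at h
  rw [hconst A hA fun z h => (hz z h).1, hconst B hB fun z h => (hz z h).2.1,
    hconst C hC fun z h => (hz z h).2.2] at h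
  refine ⟨_, ⟨signed s (f x) * b, ?_, rfl⟩, by simp⟩
  have h2 : a * (signed s (f x) * b * signed s (f x)) * c = 1 := by rw [← h]; simp only [mul_assoc]; rfl
  have h3 : signed s (f x) * b * signed s (f x) = a⁻¹ * c⁻¹ := by
    rw [mul_eq_one_iff_eq_inv] at h2
    rw [← h2]; group
  change (_ * _) ^ 2 = _
  rw [← h3, pow_two]; group

/-- The solutions of a system in which some word contains `x` exactly once: `x` is eliminated. -/
theorem exists_elimination {E : List (List (G ⊕ (X × Bool)))} {P : (X → G) → Prop}
    (hP : ∀ f f' : X → G, (∀ x, φ (f x) = φ (f' x)) → P f → P f')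
    (hE : ∀ x, totalCount x E ≤ 2) {x : X} {w : List (G ⊕ (X × Bool))} (hw : w ∈ E)
    (hx : varCount x w = 1) [DecidableEq X] :
    ∃ (r : List (G ⊕ (X × Bool))) (E' : List (List (G ⊕ (X × Bool)))) (P' : (X → G) → Prop),
      (∀ f f' : X → G, (∀ x, φ (f x) = φ (f' x)) → P' f → P' f') ∧
      (∀ y, totalCount y E' ≤ totalCount y E) ∧ totalCount x E' = 0 ∧
      (∀ y, varCount y r ≠ 0 → y ≠ x ∧ totalCount y E ≠ 0) ∧
      (∀ f ∈ solutions E P, f ∈ solutions E' P' ∧ f x = evalAt f r) ∧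
      ∀ f ∈ solutions E' P', Function.update f x (evalAt f r) ∈ solutions E P := by
  obtain ⟨A, b, B, rfl, hA, hB⟩ := exists_first_occurrence hx
  obtain ⟨E₁, E₂, rfl⟩ := List.append_of_mem hw
  -- The equation A x B = 1 gives x = A⁻¹ B⁻¹, and A x⁻¹ B = 1 gives x = B A.
  let r : List (G ⊕ (X × Bool)) := if b then invWord A ++ invWord B else B ++ A
  have hr : ∀ f : X → G, evalAt f r = signed b ((evalAt f A)⁻¹ * (evalAt f B)⁻¹) := by
    intro f; cases b <;> simp [r, signed]
  have hrv : ∀ y, varCount y r = varCount y A + varCount y B := by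
    intro y; cases b <;> simp [r, add_comm]
  have hw1 : ∀ f : X → G, evalAt f (A ++ Sum.inr (x, b) :: B) = 1 ↔ f x = evalAt f r := by
    intro f
    rw [hr, ← (signed_injective b).eq_iff (a := f x), signed_signed]
    simp only [evalAt_append, evalAt_cons, letterAt_var]
    constructor
    · intro h
      rw [mul_eq_one_iff_eq_inv'] at h
      rw [← h]; group
    · intro h; rw [h]; group
  have hxr : varCount x r = 0 := by rw [hrv, hA, hB]
  have hcount : ∀ y, y ≠ x → varCount y r = varCount y (A ++ Sum.inr (x, b) :: B) := by
    intro y hy; rw [hrv]; simp [varCount_ne hy.symm]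
  have hrest : varCount x (A ++ Sum.inr (x, b) :: B) + totalCount x (E₁ ++ E₂) ≤ 2 := by
    have := hE x; simp at this ⊢; omega
  have hsub : ∀ (y : X) (F : List (List (G ⊕ (X × Bool)))), y ≠ x →
      totalCount y (F.map (substWord x r)) = totalCount y F + totalCount x F * varCount y r := by
    intro y F hy
    induction F with
    | nil => simp [totalCount]
    | cons v F ih => simp only [List.map_cons, totalCount_cons, ih, varCount_substWord x y r v hy]; ring
  refine ⟨r, (E₁ ++ E₂).map (substWord x r), fun f => P (Function.update f x (evalAt f r)),
    fun f f' h => hP _ _ fun y => ?_, fun y => ?_, ?_, fun y hy => ?_, fun f hf => ?_,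
    fun f hf => ⟨fun v hv => ?_, hf.2⟩⟩
  · by_cases hy : y = x
    · subst hy; simpa using map_evalAt_congr φ h r
    · simp [hy, h]
  · by_cases hy : y = x
    · subst hy
      refine (Nat.le_zero.2 ?_).trans (Nat.zero_le _)
      refine List.sum_eq_zero fun n hn => ?_
      simp only [List.map_map, List.mem_map] at hn
      obtain ⟨v, -, rfl⟩ := hn
      exact varCount_substWord_self y r v hxr
    · rw [hsub y _ hy]
      -- Outside w the variable x occurs at most once, so at most one copy of r is inserted. Its
      -- variables are paid for by the occurrences in w, which is dropped; hence the system stays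
      -- quadratic.
      have : totalCount x (E₁ ++ E₂) * varCount y r ≤ 1 * varCount y r :=
        Nat.mul_le_mul_right _ (by rw [hx] at hrest; omega)
      rw [hcount y hy] at this ⊢
      simp only [totalCount_append, totalCount_cons] at this ⊢
      omega
  · refine List.sum_eq_zero fun n hn => ?_
    simp only [List.map_map, List.mem_map] at hn
    obtain ⟨v, -, rfl⟩ := hn
    exact varCount_substWord_self x r v hxr
  · have hyx : y ≠ x := by rintro rfl; exact hy hxr
    refine ⟨hyx, fun h => hy ?_⟩
    rw [hcount y hyx]
    have := varCount_le_totalCount y hw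
    omega
  · have h1 : f x = evalAt f r := (hw1 f).1 (hf.1 _ hw)
    have h2 : Function.update f x (evalAt f r) = f := by rw [← h1, Function.update_eq_self]
    refine ⟨⟨fun v hv => ?_, by simpa only [h2] using hf.2⟩, h1⟩
    obtain ⟨v, hvE, rfl⟩ := List.mem_map.1 hv
    rw [evalAt_substWord, h2]
    exact hf.1 v (by simp at hvE ⊢; tauto)
  · have hv' : v = A ++ Sum.inr (x, b) :: B ∨ v ∈ E₁ ++ E₂ := by simp at hv ⊢; tauto
    rcases hv' with rfl | hv'
    · rw [hw1, Function.update_self]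
      exact (evalAt_update_of_varCount hxr _).symm
    · rw [← evalAt_substWord]
      exact hf.1 _ (List.mem_map_of_mem hv')

/-- In a torsion-free group with finitely many square roots, the solutions of a quadratic system with
a constraint modulo a normal subgroup of finite index take finitely many values, unless a variable
can be pumped. -/
theorem finite_or_pumps [Finite Q] [Nontrivial G]
    (htf : ∀ p : G, p ≠ 1 → ∀ n : ℕ, n ≠ 0 → p ^ n ≠ 1)
    (hsq : ∀ g : G, {h : G | h ^ 2 = g}.Finite) (V : Finset X) :
    ∀ (E : List (List (G ⊕ (X × Bool)))) (P : (X → G) → Prop),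
    (∀ f f' : X → G, (∀ x, φ (f x) = φ (f' x)) → P f → P f') →
    (∀ x, totalCount x E ≤ 2) → (∀ x, totalCount x E ≠ 0 → x ∈ V) →
    (∀ x ∈ V, ((fun f : X → G => f x) '' solutions E P).Finite) ∨
      ∃ x ∈ V, Pumps (solutions E P) x := by
  classical
  induction V using Finset.strongInduction with
  | H V ih =>
  intro E P hP hE hV
  by_cases helim : ∃ x ∈ V, ∃ w ∈ E, varCount x w = 1
  · obtain ⟨x, hxV, w, hw, hx⟩ := helim
    obtain ⟨r, E', P', hP', hle, hx0, hr, hto, hfrom⟩ := exists_elimination φ hP hE hw hx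
    rcases ih (V.erase x) (Finset.erase_ssubset hxV) E' P' hP'
      (fun y => (hle y).trans (hE y)) (fun y hy => Finset.mem_erase.2
        ⟨by rintro rfl; exact hy hx0, hV y fun h => hy (Nat.le_zero.1 (h ▸ hle y))⟩)
      with hfin | ⟨y, hy, u, p, v, hp, H⟩
    · left
      have hfin' : ∀ y ∈ V, y ≠ x → ((fun f : X → G => f y) '' solutions E P).Finite :=
        fun y hy hyx => (hfin y (Finset.mem_erase.2 ⟨hyx, hy⟩)).subset
          (Set.image_mono fun f hf => (hto f hf).1)
      intro y hy
      by_cases hyx : y = x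
      · subst hyx
        refine (finite_evalAt (w := r) (T := solutions E P) fun z hz =>
          hfin' z (hV z (hr z hz).2) (hr z hz).1).subset ?_
        rintro _ ⟨f, hf, rfl⟩
        exact ⟨f, hf, (hto f hf).2.symm⟩
      · exact hfin' y hy hyx
    · right
      obtain ⟨hyx, hyV⟩ := Finset.mem_erase.1 hy
      refine ⟨y, hyV, u, p, v, hp, fun n => ?_⟩
      obtain ⟨f, hf, e⟩ := H n
      exact ⟨_, hfrom f hf, by rw [Function.update_of_ne hyx, e]⟩
  · push Not at helim
    refine or_iff_not_imp_right.2 fun hpump => ?_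
    push Not at hpump
    intro x hxV
    rcases (solutions E P).eq_empty_or_nonempty with h0 | ⟨f₀, hf₀⟩
    · simp [h0]
    -- With nothing left to eliminate, a word containing a variable contains both of its
    -- occurrences.
    have htwo : ∀ y ∈ V, ∀ w ∈ E, varCount y w ≠ 0 → varCount y w = 2 := fun y hy w hw h => by
      have := helim y hy w hw
      have := (varCount_le_totalCount y hw).trans (hE y)
      omega
    have hsign : ∀ y ∈ V, ∀ w ∈ E, varCount y w = 2 → ∃ s, HasSign y s w := by
      intro y hy w hw h
      obtain ⟨A, b, B, c, C, rfl, hA, hB, hC⟩ := exists_two_occurrences h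
      have hno : ∀ (D : List (G ⊕ (X × Bool))) (b : Bool), varCount y D = 0 →
          Sum.inr (y, b) ∉ D := by
        intro D b hD hmem
        obtain ⟨D₁, D₂, rfl⟩ := List.append_of_mem hmem
        simp at hD
      have hbc : c = b := by
        by_contra hne
        have hcb : c = !b := by cases b <;> cases c <;> simp at hne ⊢
        subst hcb
        exact hpump y hy (pumps_of_opposite φ htf hP hE hw hA hB hC hf₀)
      subst hbc
      exact ⟨c, by simp [HasSign, hno A _ hA, hno B _ hB, hno C _ hC]⟩
    have hocc : totalCount x E ≠ 0 := fun h =>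
      hpump x hxV (pumps_of_not_occurring φ htf hP h hf₀)
    obtain ⟨w, hw, hxw⟩ : ∃ w ∈ E, varCount x w ≠ 0 := by
      by_contra hno
      push Not at hno
      exact hocc (List.sum_eq_zero fun n hn => by
        obtain ⟨v, hv, rfl⟩ := List.mem_map.1 hn
        exact hno v hv)
    have hx2 := htwo x hxV w hw hxw
    obtain ⟨s, hs⟩ := hsign x hxV w hw hx2
    -- A second variable z in w would also occur twice with constant sign and could be pumped, so x
    -- is alone in w.
    refine finite_of_single_variable hsq (fun f hf => hf.1 w hw) hx2 hs fun z hzx => ?_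
    by_contra hz
    have hzV : z ∈ V := hV z fun h => hz (Nat.le_zero.1 (h ▸ varCount_le_totalCount z hw))
    have hz2 := htwo z hzV w hw hz
    obtain ⟨t, ht⟩ := hsign z hzV w hw hz2
    exact hpump z hzV (pumps_of_two_variables φ htf hP hE hzx.symm hw hx2 hz2 hs ht hf₀)

end Dichotomy

end QuadraticSystems
end GPQuad
end

noncomputable section
namespace GPQuad

/-! ### From systems in the free product to words, and the full solution set. -/

section FullSolutionSet

variable {G : Type*} {X : Type*}

theorem finite_setOf_varCount_ne_zero (w : List (G ⊕ (X × Bool))) :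
    {x | varCount x w ≠ 0}.Finite := by
  induction w with
  | nil => simp
  | cons a w ih =>
    rcases a with g | ⟨y, b⟩
    · simpa using ih
    · refine (ih.insert y).subset fun x hx => ?_
      by_cases h : y = x
      · exact Or.inl h.symm
      · exact Or.inr (by simpa [varCount_ne h] using hx)

theorem finite_setOf_totalCount_ne_zero (E : List (List (G ⊕ (X × Bool)))) :
    {x | totalCount x E ≠ 0}.Finite := by
  induction E with
  | nil => simp [totalCount]
  | cons w E ih =>
    refine ((finite_setOf_varCount_ne_zero w).union ih).subset fun x hx => ?_
    simp only [Set.mem_ofPred_eq, totalCount_cons, Set.mem_union] at hx ⊢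
    omega

variable [Group G]

/-- The homomorphism `G[𝒳] → G` over `G` given by an assignment of the variables. -/
def assignHom (f : X → G) : EquationGroup G X →* G :=
  Monoid.Coprod.lift (MonoidHom.id G) (FreeGroup.lift f)

theorem assignHom_evalWord (f : X → G) (l : List (G ⊕ (X × Bool))) :
    assignHom f (evalWord l) = evalAt f l := by
  rw [evalWord, map_list_prod, List.map_map, evalAt]
  congr 1
  refine List.map_congr_left fun a _ => ?_
  rcases a with g | ⟨x, _ | _⟩ <;> simp [evalLetter, assignHom, letterAt, signedVar]

theorem hom_eq_assignHom (σ : EquationGroup G X →* G)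
    (hσ : ∀ g : G, σ (Monoid.Coprod.inl g) = g) :
    σ = assignHom fun x => σ (Monoid.Coprod.inr (FreeGroup.of x)) := by
  refine Monoid.Coprod.hom_ext (MonoidHom.ext fun g => ?_) (FreeGroup.ext_hom _ _ fun x => ?_)
  · simp [assignHom, hσ]
  · simp [assignHom]

theorem evalWord_reducedWord (W : EquationGroup G X) : evalWord (reducedWord W) = W :=
  (Classical.choose_spec (exists_reducedWord W)).2

theorem varCount_reducedWord (W : EquationGroup G X) (x : X) :
    varCount x (reducedWord W) = occurrences W x true + occurrences W x false := by
  classical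
  unfold occurrences
  induction reducedWord W with
  | nil => simp
  | cons a l ih =>
    rw [List.count_cons, List.count_cons]
    rcases a with g | ⟨y, b⟩
    · rw [varCount_inl, ih]
      rfl
    · change _ = _ + (if ((y, b) == (x, true)) = true then 1 else 0) +
        (_ + if ((y, b) == (x, false)) = true then 1 else 0)
      by_cases h : y = x
      · subst h
        cases b <;> simp [ih] <;> omega
      · rw [varCount_ne h, ih]
        simp [h]

/-- The words of a system. -/
def systemWords (S : Finset (EquationGroup G X)) : List (List (G ⊕ (X × Bool))) :=
  S.toList.map reducedWord

theorem totalCount_systemWords (S : Finset (EquationGroup G X)) (x : X) :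
    totalCount x (systemWords S) =
      ∑ W ∈ S, occurrences W x true + ∑ W ∈ S, occurrences W x false := by
  rw [← Finset.sum_add_distrib, totalCount, systemWords, List.map_map, ← Finset.sum_map_toList]
  congr 1
  exact List.map_congr_left fun W _ => varCount_reducedWord W x

theorem isSolution_assignHom_iff (S : Finset (EquationGroup G X)) (L : X → Set G) (f : X → G) :
    IsSolution S L (assignHom f) ↔ (∀ w ∈ systemWords S, evalAt f w = 1) ∧ ∀ x, f x ∈ L x := by
  have h1 : ∀ g : G, assignHom f (Monoid.Coprod.inl g) = g := by simp [assignHom]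
  have h2 : ∀ x, assignHom f (Monoid.Coprod.inr (FreeGroup.of x)) = f x := by simp [assignHom]
  have h3 : ∀ W, assignHom f W = evalAt f (reducedWord W) := fun W => by
    rw [← assignHom_evalWord, evalWord_reducedWord]
  simp [IsSolution, h1, h2, h3, systemWords]

/-- A homomorphism from a group to a monoid has its values among the units, so the finite monoid may
be replaced by its finite unit group. -/
theorem IsRecognizable.exists_hom {L : Set G} (h : IsRecognizable L) :
    ∃ (N : Type) (_ : Group N) (_ : Finite N) (μ : G →* N),
      ∀ g h : G, μ g = μ h → g ∈ L → h ∈ L := by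
  obtain ⟨N, _, _, μ, hμ⟩ := h
  refine ⟨Nˣ, inferInstance, inferInstance, μ.toHomUnits, fun g h e hg => ?_⟩
  rw [← hμ]
  exact ⟨g, hg, congrArg Units.val e⟩

/-- Over a torsion-free group with finitely many square roots, the full solution set of a quadratic
system with recognizable constraints is finite or contains a set `u p^* v` with `p ≠ 1`. -/
theorem solutionSet_finite_or_pumpSet_subset [Nontrivial G]
    (htf : ∀ p : G, p ≠ 1 → ∀ n : ℕ, n ≠ 0 → p ^ n ≠ 1)
    (hsq : ∀ g : G, {h : G | h ^ 2 = g}.Finite) (S : Finset (EquationGroup G X))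
    (hS : IsQuadratic S) (L : X → Set G) (hL : ∀ x, IsRecognizable (L x)) :
    (solutionSet S L).Finite ∨ ∃ u p v : G, p ≠ 1 ∧ pumpSet u p v ⊆ solutionSet S L := by
  classical
  have hmem : ∀ f : X → G, (∀ w ∈ systemWords S, evalAt f w = 1) → (∀ x, f x ∈ L x) →
      ∀ x, f x ∈ solutionSet S L := fun f h1 h2 x =>
    ⟨assignHom f, x, true, (isSolution_assignHom_iff S L f).2 ⟨h1, h2⟩, by
      simp [signedVar, assignHom]⟩
  by_cases hsol : ∃ σ, IsSolution S L σ
  swap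
  · left
    refine Set.finite_empty.subset ?_
    rintro _ ⟨σ, x, b, hσ, -⟩
    exact hsol ⟨σ, hσ⟩
  obtain ⟨σ, hσ⟩ := hsol
  obtain ⟨f₀, hf₀⟩ : ∃ f₀ : X → G,
      (∀ w ∈ systemWords S, evalAt f₀ w = 1) ∧ ∀ x, f₀ x ∈ L x := by
    rw [hom_eq_assignHom σ hσ.1] at hσ
    exact ⟨_, (isSolution_assignHom_iff S L _).1 hσ⟩
  choose N hN hNfin μ hμ using fun x => (hL x).exists_hom
  let V : Finset X := (finite_setOf_totalCount_ne_zero (systemWords S)).toFinset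
  have hV : ∀ x, totalCount x (systemWords S) ≠ 0 → x ∈ V := fun x hx => by simpa [V] using hx
  -- The set of variables may be infinite. A variable outside the finite set V is free and is pumped
  -- subject to its own constraint alone, so a product over infinitely many finite groups is never
  -- needed.
  by_cases hall : ∀ x, x ∈ V
  swap
  · right
    push Not at hall
    obtain ⟨x, hx⟩ := hall
    have hx0 : totalCount x (systemWords S) = 0 := by
      by_contra h; exact hx (hV x h)
    obtain ⟨u, p, v, hp, H⟩ := pumps_of_not_occurring (μ x) htf
      (E := systemWords S) (P := fun f => f x ∈ L x)
      (fun f f' h hf => hμ x _ _ (h x) hf) hx0 ⟨hf₀.1, hf₀.2 x⟩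
    refine ⟨u, p, v, hp, ?_⟩
    rintro _ ⟨n, rfl⟩
    obtain ⟨f, hf, e⟩ := H n
    -- The pumped assignment f respects the constraint at x only, so just its value at x is kept and
    -- everything else comes from f₀.
    have hval : Function.update f₀ x (f x) x = u * p ^ n * v := by rw [Function.update_self, e]
    change u * p ^ n * v ∈ _
    rw [← hval]
    refine hmem _ (fun w hw => ?_) (fun y => ?_) x
    · rw [evalAt_update_of_varCount (Nat.le_zero.1 (hx0 ▸ varCount_le_totalCount x hw))]
      exact hf₀.1 w hw
    · by_cases hy : y = x
      · subst hy; rw [Function.update_self]; exact hf.2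
      · rw [Function.update_of_ne hy]; exact hf₀.2 y
  -- All variables lie in the finite set V, so this target is a finite group that controls every
  -- constraint at once.
  · let φ : G →* ∀ x : V, N x := MonoidHom.pi fun x => μ x
    rcases finite_or_pumps φ htf hsq V (systemWords S) (fun f => ∀ x, f x ∈ L x)
      (fun f f' h hf x => hμ x _ _ (congrFun (h x) ⟨x, hall x⟩) (hf x))
      (fun x => (totalCount_systemWords S x).trans_le (hS x)) hV with hfin | ⟨x, -, u, p, v, hp, H⟩
    · left
      have h1 := V.finite_toSet.biUnion hfin
      refine (h1.union (h1.image (·⁻¹))).subset ?_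
      rintro _ ⟨σ, x, b, hσ, rfl⟩
      have hf := hσ
      rw [hom_eq_assignHom σ hσ.1, isSolution_assignHom_iff] at hf
      have hx : σ (Monoid.Coprod.inr (FreeGroup.of x)) ∈ ⋃ x ∈ (V : Set X),
          (fun f : X → G => f x) '' solutions (systemWords S) (fun f => ∀ x, f x ∈ L x) :=
        Set.mem_biUnion (hall x) ⟨_, hf, rfl⟩
      cases b
      · exact Or.inr ⟨_, hx, by simp [signedVar]⟩
      · exact Or.inl (by simpa [signedVar] using hx)
    · right
      refine ⟨u, p, v, hp, ?_⟩
      rintro _ ⟨n, rfl⟩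
      obtain ⟨f, hf, e⟩ := H n
      change u * p ^ n * v ∈ _
      rw [← e]
      exact hmem f hf.1 hf.2 x

end FullSolutionSet
end GPQuad
end

noncomputable section
namespace GPQuad

/-! ### Words over a coloured alphabet up to commutation -/

section ColouredWords

variable {J : Type*} (I : SimpleGraph J) {α : Type*} (col : α → J)

/-- Equality of words modulo the commutation of adjacent letters with adjacent colours. -/
inductive TraceEq : List α → List α → Prop
  | nil : TraceEq [] []
  | cons (a : α) {u v : List α} : TraceEq u v → TraceEq (a :: u) (a :: v)
  | swap (a b : α) (u : List α) : I.Adj (col a) (col b) → TraceEq (a :: b :: u) (b :: a :: u)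
  | trans {u v w : List α} : TraceEq u v → TraceEq v w → TraceEq u w

/-- The colour `i` occurs in the word, and all letters before its first occurrence are adjacent
to it. -/
def IsHead (i : J) : List J → Prop
  | [] => False
  | j :: l => i = j ∨ (I.Adj i j ∧ IsHead i l)

/-- The colour `i` occurs in the word, and all letters after its last occurrence are adjacent
to it. -/
def IsTail (i : J) (l : List J) : Prop := IsHead I i l.reverse

/-- Words without two equal colours that can be made neighbours by commutations. -/
def Red : List J → Prop
  | [] => True
  | i :: l => ¬ IsHead I i l ∧ Red l

/-- Words in which no letter can be moved by commutations in front of a larger one. -/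
def LexNF [LT J] : List J → Prop
  | [] => True
  | i :: l => (∀ j, I.Adj j i → IsHead I j l → ¬ j < i) ∧ LexNF l

variable {I col}

namespace TraceEq

theorem refl (u : List α) : TraceEq I col u u := by
  induction u with
  | nil => exact nil
  | cons a u ih => exact cons a ih

theorem of_eq {u v : List α} (h : u = v) : TraceEq I col u v := h ▸ refl u

theorem symm {u v : List α} (h : TraceEq I col u v) : TraceEq I col v u := by
  induction h with
  | nil => exact nil
  | cons a _ ih => exact cons a ih
  | swap a b u h => exact swap b a u h.symm
  | trans _ _ ih₁ ih₂ => exact ih₂.trans ih₁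

theorem append_left (w : List α) {u v : List α} (h : TraceEq I col u v) :
    TraceEq I col (w ++ u) (w ++ v) := by
  induction w with
  | nil => exact h
  | cons a w ih => exact cons a ih

theorem append_right (w : List α) {u v : List α} (h : TraceEq I col u v) :
    TraceEq I col (u ++ w) (v ++ w) := by
  induction h with
  | nil => exact refl _
  | cons a _ ih => exact cons a ih
  | swap a b u h => exact swap a b _ h
  | trans _ _ ih₁ ih₂ => exact ih₁.trans ih₂

theorem append {u v u' v' : List α} (h : TraceEq I col u v) (h' : TraceEq I col u' v') :
    TraceEq I col (u ++ u') (v ++ v') := (h.append_right _).trans (h'.append_left _)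

theorem perm {u v : List α} (h : TraceEq I col u v) : u.Perm v := by
  induction h with
  | nil => exact .nil
  | cons a _ ih => exact ih.cons a
  | swap a b u _ => exact .swap b a u
  | trans _ _ ih₁ ih₂ => exact ih₁.trans ih₂

theorem map {β : Type*} {col' : β → J} (f : α → β) (hf : ∀ a, col' (f a) = col a)
    {u v : List α} (h : TraceEq I col u v) : TraceEq I col' (u.map f) (v.map f) := by
  induction h with
  | nil => exact nil
  | cons a _ ih => exact cons _ ih
  | swap a b u h => exact swap _ _ _ (by rwa [hf, hf])
  | trans _ _ ih₁ ih₂ => exact ih₁.trans ih₂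

theorem colours {u v : List α} (h : TraceEq I col u v) :
    TraceEq I id (u.map col) (v.map col) := h.map col fun _ => rfl

theorem reverse {u v : List α} (h : TraceEq I col u v) :
    TraceEq I col u.reverse v.reverse := by
  induction h with
  | nil => exact nil
  | cons a _ ih => simpa using ih.append_right [a]
  | swap a b u h =>
    simp only [List.reverse_cons, List.append_assoc]
    exact append_left _ (swap b a [] h.symm)
  | trans _ _ ih₁ ih₂ => exact ih₁.trans ih₂

theorem filter (p : α → Bool) {u v : List α} (h : TraceEq I col u v) :
    TraceEq I col (u.filter p) (v.filter p) := by
  induction h with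
  | nil => exact nil
  | cons a _ ih =>
    rw [List.filter_cons, List.filter_cons]
    split
    · exact cons a ih
    · exact ih
  | swap a b u h =>
    cases ha : p a <;> cases hb : p b <;> simp [ha, hb]
    · exact refl _
    · exact refl _
    · exact refl _
    · exact swap a b _ h
  | trans _ _ ih₁ ih₂ => exact ih₁.trans ih₂

/-- Projections to letters with pairwise non-adjacent colours do not depend on the representing
word. -/
theorem filter_eq (p : α → Bool) (hp : ∀ a b, p a = true → p b = true → ¬ I.Adj (col a) (col b))
    {u v : List α} (h : TraceEq I col u v) : u.filter p = v.filter p := by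
  induction h with
  | nil => rfl
  | cons a _ ih => rw [List.filter_cons, List.filter_cons, ih]
  | swap a b u h =>
    cases ha : p a <;> cases hb : p b <;> simp [ha, hb]
    exact absurd h (hp a b ha hb)
  | trans _ _ ih₁ ih₂ => exact ih₁.trans ih₂

theorem move_front {a : α} {v : List α} (h : ∀ c ∈ v, I.Adj (col a) (col c)) (w : List α) :
    TraceEq I col (v ++ a :: w) (a :: (v ++ w)) := by
  induction v with
  | nil => exact refl _
  | cons c v ih =>
    exact (cons c (ih fun d hd => h d (List.mem_cons_of_mem _ hd))).trans
      (swap c a _ (h c List.mem_cons_self).symm)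

/-- A commutation moves positions, so decorations of the letters travel with them. This makes it
possible to trace where the letters of a normal form come from. -/
theorem lift {β : Type*} (f : β → α) {u v : List α} (h : TraceEq I col u v) :
    ∀ y : List β, y.map f = u → ∃ y', y'.map f = v ∧ TraceEq I (col ∘ f) y y' := by
  induction h with
  | nil => intro y hy; exact ⟨y, hy, refl _⟩
  | cons a _ ih =>
    intro y hy
    obtain ⟨b, z, rfl, rfl, hz⟩ := List.map_eq_cons_iff.1 hy
    obtain ⟨y', hy', h'⟩ := ih z hz
    exact ⟨b :: y', by simp [hy'], cons b h'⟩
  | swap a b u h =>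
    intro y hy
    obtain ⟨a', z, rfl, rfl, hz⟩ := List.map_eq_cons_iff.1 hy
    obtain ⟨b', z, rfl, rfl, rfl⟩ := List.map_eq_cons_iff.1 hz
    exact ⟨b' :: a' :: z, rfl, swap a' b' z h⟩
  | trans _ _ ih₁ ih₂ =>
    intro y hy
    obtain ⟨y₁, h₁, e₁⟩ := ih₁ y hy
    obtain ⟨y₂, h₂, e₂⟩ := ih₂ y₁ h₁
    exact ⟨y₂, h₂, e₁.trans e₂⟩

end TraceEq

/-! ### Heads, tails, reduced words and lexicographic normal forms. -/

section Heads

theorem isHead_append {i : J} {l m : List J} :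
    IsHead I i (l ++ m) ↔ IsHead I i l ∨ ((∀ c ∈ l, I.Adj i c) ∧ IsHead I i m) := by
  induction l with
  | nil => simp [IsHead]
  | cons j l ih =>
    simp only [List.cons_append, IsHead, ih, List.forall_mem_cons]
    tauto

theorem IsHead.mem {i : J} {l : List J} (h : IsHead I i l) : i ∈ l := by
  induction l with
  | nil => exact h.elim
  | cons j l ih =>
    rcases h with rfl | ⟨-, h⟩
    · exact List.mem_cons_self
    · exact List.mem_cons_of_mem _ (ih h)

theorem IsTail.mem {i : J} {l : List J} (h : IsTail I i l) : i ∈ l :=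
  List.mem_reverse.1 (IsHead.mem h)

theorem isTail_append {i : J} {l m : List J} :
    IsTail I i (l ++ m) ↔ IsTail I i m ∨ ((∀ c ∈ m, I.Adj i c) ∧ IsTail I i l) := by
  simp [IsTail, isHead_append]

@[simp] theorem isHead_singleton {i j : J} : IsHead I i [j] ↔ i = j := by simp [IsHead]

@[simp] theorem isTail_singleton {i j : J} : IsTail I i [j] ↔ i = j := by simp [IsTail]

theorem isTail_cons {i j : J} {l : List J} :
    IsTail I i (j :: l) ↔ IsTail I i l ∨ ((∀ c ∈ l, I.Adj i c) ∧ i = j) := by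
  rw [← List.singleton_append, isTail_append, isTail_singleton]

theorem isTail_reverse {i : J} {l : List J} : IsTail I i l.reverse ↔ IsHead I i l := by
  simp [IsTail]

theorem IsHead.congr {i : J} {l m : List J} (h : TraceEq I id l m) :
    IsHead I i l ↔ IsHead I i m := by
  induction h with
  | nil => rfl
  | cons a _ ih => simp only [IsHead, ih]
  | swap a b u h =>
    simp only [IsHead]
    have h' : I.Adj a b := h
    constructor
    · rintro (rfl | ⟨h1, rfl | h2⟩)
      · exact Or.inr ⟨h', Or.inl rfl⟩
      · exact Or.inl rfl
      · exact Or.inr ⟨h2.1, Or.inr ⟨h1, h2.2⟩⟩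
    · rintro (rfl | ⟨h1, rfl | h2⟩)
      · exact Or.inr ⟨h'.symm, Or.inl rfl⟩
      · exact Or.inl rfl
      · exact Or.inr ⟨h2.1, Or.inr ⟨h1, h2.2⟩⟩
  | trans _ _ ih₁ ih₂ => exact ih₁.trans ih₂

theorem IsTail.congr {i : J} {l m : List J} (h : TraceEq I id l m) :
    IsTail I i l ↔ IsTail I i m := IsHead.congr h.reverse

/-- Two equal colours in different factors can meet only if nothing blocks them on either side of
the junction: one is a tail of l, the other a head of m. -/
theorem red_append {l m : List J} :
    Red I (l ++ m) ↔ Red I l ∧ Red I m ∧ ∀ i, IsTail I i l → ¬ IsHead I i m := by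
  induction l with
  | nil => simp [Red, IsTail, IsHead]
  | cons j l ih =>
    simp only [List.cons_append, Red, ih, isHead_append, isTail_cons]
    constructor
    · rintro ⟨h1, h2, h3, h4⟩
      refine ⟨⟨fun h => h1 (Or.inl h), h2⟩, h3, ?_⟩
      rintro i (h | ⟨h, rfl⟩) h'
      · exact h4 i h h'
      · exact h1 (Or.inr ⟨h, h'⟩)
    · rintro ⟨⟨h1, h2⟩, h3, h4⟩
      refine ⟨?_, h2, h3, fun i h => h4 i (Or.inl h)⟩
      rintro (h | ⟨h, h'⟩)
      · exact h1 h
      · exact h4 j (Or.inr ⟨h, rfl⟩) h'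

theorem red_singleton (i : J) : Red I [i] := by simp [Red, IsHead]

theorem red_reverse {l : List J} : Red I l.reverse ↔ Red I l := by
  induction l with
  | nil => simp
  | cons j l ih =>
    rw [List.reverse_cons, red_append, ih]
    simp only [isTail_reverse, isHead_singleton]
    constructor
    · rintro ⟨h1, -, h2⟩
      exact ⟨fun h => h2 j h rfl, h1⟩
    · rintro ⟨h1, h2⟩
      refine ⟨h2, red_singleton j, ?_⟩
      rintro i h rfl
      exact h1 h

theorem Red.congr {l m : List J} (h : TraceEq I id l m) : Red I l ↔ Red I m := by
  induction h with
  | nil => rfl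
  | cons a h ih => simp only [Red, ih, IsHead.congr h]
  | swap a b u h =>
    have h' : I.Adj a b := h
    have := h'.ne
    have := h'.symm
    simp only [Red, IsHead]
    tauto
  | trans _ _ ih₁ ih₂ => exact ih₁.trans ih₂

theorem IsHead.exists_split {i : J} {w : List α} (h : IsHead I i (w.map col)) :
    ∃ v a y, w = v ++ a :: y ∧ col a = i ∧ ∀ c ∈ v, I.Adj i (col c) := by
  induction w with
  | nil => exact h.elim
  | cons b w ih =>
    rcases h with rfl | ⟨hb, h⟩
    · exact ⟨[], b, w, rfl, rfl, by simp⟩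
    · obtain ⟨v, a, y, rfl, ha, hv⟩ := ih h
      exact ⟨b :: v, a, y, rfl, ha, List.forall_mem_cons.2 ⟨hb, hv⟩⟩

theorem IsHead.exists_traceEq {i : J} {w : List α} (h : IsHead I i (w.map col)) :
    ∃ a y, col a = i ∧ TraceEq I col w (a :: y) := by
  obtain ⟨v, a, y, rfl, rfl, hv⟩ := h.exists_split
  exact ⟨a, _, rfl, TraceEq.move_front hv y⟩

theorem IsTail.exists_traceEq {i : J} {w : List α} (h : IsTail I i (w.map col)) :
    ∃ a y, col a = i ∧ TraceEq I col w (y ++ [a]) := by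
  rw [IsTail, ← List.map_reverse] at h
  obtain ⟨a, y, ha, e⟩ := IsHead.exists_traceEq h
  exact ⟨a, y.reverse, ha, by simpa using e.reverse⟩

variable [LinearOrder J]

theorem LexNF.of_append_right {l m : List J} (h : LexNF I (l ++ m)) : LexNF I m := by
  induction l with
  | nil => exact h
  | cons j l ih => exact ih h.2

theorem LexNF.of_append_left {l m : List J} (h : LexNF I (l ++ m)) : LexNF I l := by
  induction l with
  | nil => trivial
  | cons j l ih => exact ⟨fun i hi hl => h.1 i hi (isHead_append.2 (Or.inl hl)), ih h.2⟩

theorem LexNF.of_infix {l m : List J} (h : LexNF I m) (hl : l <:+: m) : LexNF I l := by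
  obtain ⟨u, v, rfl⟩ := hl
  exact h.of_append_left.of_append_right

/-- Every word has a lexicographic normal form. -/
theorem exists_lexNF (I : SimpleGraph J) (col : α → J) (w : List α) :
    ∃ w', TraceEq I col w w' ∧ LexNF I (w'.map col) := by
  induction hn : w.length generalizing w with
  | zero =>
    obtain rfl := List.eq_nil_of_length_eq_zero hn
    exact ⟨[], .nil, trivial⟩
  | succ n ih =>
    have hfin : {i | IsHead I i (w.map col)}.Finite :=
      (w.map col).finite_toSet.subset fun i hi => hi.mem
    have hne : {i | IsHead I i (w.map col)}.Nonempty := by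
      cases w with
      | nil => simp at hn
      | cons a w => exact ⟨col a, Or.inl rfl⟩
    -- Greedy choice: the word starts with its smallest head. A letter of the rest that could pass
    -- in front of it would be a head of the whole word, hence not smaller.
    obtain ⟨i, hi, hmin⟩ := Set.exists_min_image _ id hfin hne
    obtain ⟨a, y, rfl, e⟩ := IsHead.exists_traceEq hi
    have hy : y.length = n := by
      have := e.perm.length_eq
      simp at this; omega
    obtain ⟨y', ey, hy'⟩ := ih y hy
    have e' := e.trans (.cons a ey)
    refine ⟨a :: y', e', fun j hj hh => not_lt.2 (hmin j ?_), hy'⟩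
    exact (IsHead.congr e'.colours).2 (Or.inr ⟨hj, hh⟩)

/-- A word that is not in lexicographic normal form can be improved. -/
theorem exists_smaller_of_not_lexNF {w : List α} (h : ¬ LexNF I (w.map col)) :
    ∃ x a b y z, w = x ++ b :: z ∧ TraceEq I col w (x ++ a :: y) ∧ col a < col b := by
  induction w with
  | nil => exact absurd trivial h
  | cons b w ih =>
    by_cases hw : LexNF I (w.map col)
    · have : ∃ j, I.Adj j (col b) ∧ IsHead I j (w.map col) ∧ j < col b := by
        by_contra hno
        push Not at hno
        exact h ⟨fun j h1 h2 => not_lt.2 (hno j h1 h2), hw⟩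
      obtain ⟨j, h1, h2, h3⟩ := this
      obtain ⟨a, y, rfl, e⟩ := IsHead.exists_traceEq h2
      exact ⟨[], a, b, b :: y, w, rfl, (TraceEq.cons b e).trans (.swap b a y h1.symm), h3⟩
    · obtain ⟨x, a, c, y, z, rfl, e, hlt⟩ := ih hw
      exact ⟨b :: x, a, c, y, z, rfl, .cons b e, hlt⟩

end Heads

/-! ### Comparison of lexicographic normal forms -/

section Compare

variable [LinearOrder J]

/-- The number of letters of colour `i`. -/
def colCount (col : α → J) (i : J) (w : List α) : ℕ := (w.map col).count i

@[simp] theorem colCount_append (i : J) (u v : List α) :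
    colCount col i (u ++ v) = colCount col i u + colCount col i v := by simp [colCount]

theorem colCount_cons (i : J) (a : α) (v : List α) :
    colCount col i (a :: v) = colCount col i v + if col a = i then 1 else 0 := by
  simp [colCount, List.count_cons]

@[simp] theorem colCount_nil (i : J) : colCount col i [] = 0 := rfl

theorem colCount_pos {i : J} {w : List α} : 0 < colCount col i w ↔ i ∈ w.map col :=
  List.count_pos_iff

/-- The projection of a word to the letters of the colours `i` and `k`. -/
def pairProj (col : α → J) (i k : J) (w : List α) : List α :=
  w.filter fun a => decide (col a = i ∨ col a = k)

theorem pairProj_append (i k : J) (u v : List α) :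
    pairProj col i k (u ++ v) = pairProj col i k u ++ pairProj col i k v := by simp [pairProj]

/-- Letters of non-adjacent colours never pass each other. The case i = k is allowed and projects to
a single colour. -/
theorem TraceEq.pairProj_eq {i k : J} (hik : ¬ I.Adj i k) {u v : List α}
    (h : TraceEq I col u v) : pairProj col i k u = pairProj col i k v := by
  refine h.filter_eq _ fun a b ha hb => ?_
  simp only [decide_eq_true_eq] at ha hb
  rcases ha with ha | ha <;> rcases hb with hb | hb <;> rw [ha, hb]
  · exact I.irrefl
  · exact hik
  · exact fun h => hik h.symm
  · exact I.irrefl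

theorem length_pairProj {i k : J} (hik : i ≠ k) (w : List α) :
    (pairProj col i k w).length = colCount col i w + colCount col k w := by
  induction w with
  | nil => rfl
  | cons a w ih =>
    have : pairProj col i k (a :: w) = pairProj col i k [a] ++ pairProj col i k w :=
      pairProj_append i k [a] w
    rw [this, List.length_append, ih, colCount_cons, colCount_cons]
    by_cases h1 : col a = i
    · have h2 : col a ≠ k := h1 ▸ hik
      simp [pairProj, h1, hik]; omega
    · by_cases h2 : col a = k
      · simp [pairProj, h2, hik.symm]; omega
      · simp [pairProj, h1, h2]

theorem length_pairProj_self (i : J) (w : List α) :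
    (pairProj col i i w).length = colCount col i w := by
  rw [pairProj, colCount, List.count, List.countP_map, List.countP_eq_length_filter]
  congr 1
  refine List.filter_congr fun a _ => ?_
  simp [beq_eq_decide]

theorem colCount_pairProj_left (i k : J) (w : List α) :
    colCount col i (pairProj col i k w) = colCount col i w := by
  simp only [colCount, List.count, List.countP_map, pairProj, List.countP_filter]
  refine List.countP_congr fun a _ => ?_
  simp +contextual

theorem colCount_pairProj_right (i k : J) (w : List α) :
    colCount col k (pairProj col i k w) = colCount col k w := by
  simp only [colCount, List.count, List.countP_map, pairProj, List.countP_filter]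
  refine List.countP_congr fun a _ => ?_
  simp +contextual

/-- The projection of a word containing the colour `k`, and not containing `i`, begins with a letter
of colour `k`. -/
theorem exists_pairProj_eq_cons {i k : J} {v : List α} (hi : i ∉ v.map col)
    (hk : k ∈ v.map col) : ∃ c y, col c = k ∧ pairProj col i k v = c :: y := by
  have hmem : ∀ c ∈ pairProj col i k v, col c = k := by
    intro c hc
    simp only [pairProj, List.mem_filter, decide_eq_true_eq] at hc
    rcases hc.2 with h | h
    · exact absurd (h ▸ List.mem_map_of_mem hc.1) hi
    · exact h
  obtain ⟨c, hc, rfl⟩ := List.mem_map.1 hk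
  have hne : c ∈ pairProj col i (col c) v := by simp [pairProj, hc]
  cases h : pairProj col i (col c) v with
  | nil => rw [h] at hne; simp at hne
  | cons d y => exact ⟨d, y, hmem d (by rw [h]; simp), rfl⟩

theorem exists_first_of_mem {p : α → Prop} {w : List α} (h : ∃ a ∈ w, p a) :
    ∃ v a y, w = v ++ a :: y ∧ p a ∧ ∀ c ∈ v, ¬ p c := by
  induction w with
  | nil => simp at h
  | cons b w ih =>
    by_cases hb : p b
    · exact ⟨[], b, w, rfl, hb, by simp⟩
    · obtain ⟨v, a, y, rfl, ha, hv⟩ := ih (by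
        obtain ⟨a, ha, hpa⟩ := h
        rcases List.mem_cons.1 ha with rfl | ha
        · exact absurd hpa hb
        · exact ⟨a, ha, hpa⟩)
      exact ⟨b :: v, a, y, rfl, ha, by simp [hb]; exact hv⟩

/-- The letter a commutes with everything before it, so a smaller colour would have been moved in
front of b. -/
theorem LexNF.not_lt_of_split {b a : α} {v y : List α} (h : LexNF I ((b :: (v ++ a :: y)).map col))
    (hadj : ∀ k ∈ (b :: v).map col, I.Adj (col a) k) : ¬ col a < col b := by
  refine h.1 _ (hadj _ (by simp)) ?_
  rw [List.map_append]
  refine isHead_append.2 (Or.inr ⟨fun c hc => hadj c (by simp only [List.map_cons]; exact List.mem_cons_of_mem _ hc), Or.inl rfl⟩)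

/-- Look at the first letter of the colour of a in b B. If it commutes with all letters before it,
the normal form excludes a smaller colour. Otherwise some earlier colour k is not adjacent to it;
project to these two colours. The prefixes x₁ and x₂ have projections of equal length, so the next
letters must agree, yet one is a and the other has colour k. -/
theorem not_lt_of_traceEq {Q : Set J} {x₁ x₂ A h₁ B h₂ : List α} {a b : α}
    (h : TraceEq I col (x₁ ++ a :: A ++ h₁) (x₂ ++ b :: B ++ h₂))
    (hB : LexNF I ((b :: B).map col)) (hQ : ∀ i ∈ Q, colCount col i x₁ = colCount col i x₂)
    (hBQ : ∀ i ∈ (b :: B).map col, i ∈ Q) (ha : col a ∈ (b :: B).map col) :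
    ¬ col a < col b := by
  intro hlt
  obtain ⟨v, a', y, e, ha', hv⟩ := exists_first_of_mem (p := fun c => col c = col a)
    (w := b :: B) (List.mem_map.1 ha)
  cases v with
  | nil =>
    simp only [List.nil_append, List.cons.injEq] at e
    exact hlt.ne (by rw [← ha', e.1])
  | cons b' v =>
    simp only [List.cons_append, List.cons.injEq] at e
    obtain ⟨rfl, rfl⟩ := e
    refine LexNF.not_lt_of_split (a := a') hB (fun k hk => ?_) (ha' ▸ hlt)
    rw [ha']
    by_contra hadj
    have hki : k ≠ col a := by
      rintro rfl
      obtain ⟨c, hc, hck⟩ := List.mem_map.1 hk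
      exact hv c hc hck
    have hi : col a ∉ (b :: v).map col := by
      intro hmem
      obtain ⟨c, hc, hck⟩ := List.mem_map.1 hmem
      exact hv c hc hck
    obtain ⟨c, z, hc, hz⟩ := exists_pairProj_eq_cons hi hk
    have hp := h.pairProj_eq hadj
    have e1 : x₁ ++ a :: A ++ h₁ = x₁ ++ (a :: (A ++ h₁)) := by simp
    have e2 : x₂ ++ b :: (v ++ a' :: y) ++ h₂ = x₂ ++ ((b :: v) ++ (a' :: y ++ h₂)) := by simp
    have e3 : pairProj col (col a) k (a :: (A ++ h₁)) = a :: pairProj col (col a) k (A ++ h₁) := by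
      simp [pairProj]
    rw [e1, e2, pairProj_append, pairProj_append _ _ x₂, pairProj_append _ _ (b :: v), hz,
      e3] at hp
    have hkQ : k ∈ Q := hBQ k (by
      rw [List.map_cons, List.map_append, ← List.cons_append, ← List.map_cons]
      exact List.mem_append_left _ hk)
    have := (List.append_inj hp (by
      rw [length_pairProj hki.symm, length_pairProj hki.symm, hQ _ (hBQ _ ha), hQ k hkQ])).2
    simp only [List.cons_append, List.cons.injEq] at this
    exact hki (by rw [← hc, this.1])

/-- If two normal forms occur in words of the same trace after prefixes of equal colour counts, then
they begin with the same letter, as long as each contains the first colour of the other. -/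
theorem head_eq_of_traceEq {Q : Set J} {x₁ x₂ A h₁ B h₂ : List α} {a b : α}
    (h : TraceEq I col (x₁ ++ a :: A ++ h₁) (x₂ ++ b :: B ++ h₂))
    (hA : LexNF I ((a :: A).map col)) (hB : LexNF I ((b :: B).map col))
    (hQ : ∀ i ∈ Q, colCount col i x₁ = colCount col i x₂)
    (hAQ : ∀ i ∈ (a :: A).map col, i ∈ Q) (hBQ : ∀ i ∈ (b :: B).map col, i ∈ Q)
    (ha : col a ∈ (b :: B).map col) (hb : col b ∈ (a :: A).map col) : a = b := by
  have h1 := not_lt_of_traceEq h hB hQ hBQ ha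
  have h2 := not_lt_of_traceEq h.symm hA (fun i hi => (hQ i hi).symm) hAQ hb
  have hab : col a = col b := le_antisymm (not_lt.1 h2) (not_lt.1 h1)
  have hp := h.pairProj_eq (I.irrefl (v := col a))
  have e1 : x₁ ++ a :: A ++ h₁ = x₁ ++ (a :: (A ++ h₁)) := by simp
  have e2 : x₂ ++ b :: B ++ h₂ = x₂ ++ (b :: (B ++ h₂)) := by simp
  have e3 : pairProj col (col a) (col a) (a :: (A ++ h₁)) =
      a :: pairProj col (col a) (col a) (A ++ h₁) := by simp [pairProj]
  have e4 : pairProj col (col a) (col a) (b :: (B ++ h₂)) =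
      b :: pairProj col (col a) (col a) (B ++ h₂) := by simp [pairProj, hab]
  rw [e1, e2, pairProj_append, pairProj_append, e3, e4] at hp
  have := (List.append_inj hp (by
      rw [length_pairProj_self, length_pairProj_self, hQ _ (hBQ _ ha)])).2
  simp only [List.cons.injEq] at this
  exact this.1

/-- Iterates `head_eq_of_traceEq` letter by letter. The remainders A and B contain all colours of Q
and so serve as a reserve: each side keeps containing the first colour of the other. -/
theorem agree_of_traceEq {Q : Set J} {z z' : List α} (hlen : z.length = z'.length)
    {x₁ x₂ A h₁ B h₂ : List α}
    (h : TraceEq I col (x₁ ++ (z ++ A) ++ h₁) (x₂ ++ (z' ++ B) ++ h₂))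
    (hA : LexNF I ((z ++ A).map col)) (hB : LexNF I ((z' ++ B).map col))
    (hQ : ∀ i ∈ Q, colCount col i x₁ = colCount col i x₂)
    (hAQ : ∀ i ∈ (z ++ A).map col, i ∈ Q) (hBQ : ∀ i ∈ (z' ++ B).map col, i ∈ Q)
    (hQA : ∀ i ∈ Q, i ∈ A.map col) (hQB : ∀ i ∈ Q, i ∈ B.map col) : z = z' := by
  induction z generalizing z' x₁ x₂ with
  | nil => exact (List.eq_nil_of_length_eq_zero hlen.symm).symm
  | cons a z ih =>
    cases z' with
    | nil => simp at hlen
    | cons b z' =>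
      have hab : a = b := head_eq_of_traceEq h hA hB hQ hAQ hBQ
        (List.mem_cons_of_mem _ (List.map_append (l₁ := z') ▸
          List.mem_append_right _ (hQB _ (hAQ _ (by simp)))))
        (List.mem_cons_of_mem _ (List.map_append (l₁ := z) ▸
          List.mem_append_right _ (hQA _ (hBQ _ (by simp)))))
      subst hab
      congr 1
      refine ih (by simpa using hlen) (x₁ := x₁ ++ [a]) (x₂ := x₂ ++ [a]) (by simpa using h)
        hA.2 hB.2 (fun i hi => ?_) (fun i hi => hAQ i (List.mem_cons_of_mem _ hi))
        (fun i hi => hBQ i (List.mem_cons_of_mem _ hi))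
      rw [colCount_append, colCount_append, hQ i hi]

/-- Lexicographic normal forms are unique. -/
theorem LexNF.eq_of_traceEq {u v : List α} (hu : LexNF I (u.map col)) (hv : LexNF I (v.map col))
    (h : TraceEq I col u v) : u = v := by
  suffices H : ∀ x, TraceEq I col (x ++ u) (x ++ v) → u = v from H [] h
  clear h
  induction u generalizing v with
  | nil =>
    intro x h
    have := h.perm.length_eq
    simp at this
    exact this.symm
  | cons a u ih =>
    intro x h
    cases v with
    | nil =>
      have := h.perm.length_eq
      simp at this
    | cons b v =>
      have hp : (a :: u).Perm (b :: v) := (List.perm_append_left_iff x).1 h.perm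
      have hab : a = b := head_eq_of_traceEq (Q := Set.univ) (x₁ := x) (x₂ := x) (h₁ := [])
        (h₂ := []) (by simpa using h) hu hv (fun _ _ => rfl) (fun _ _ => trivial)
        (fun _ _ => trivial) ((hp.map col).subset (by simp)) ((hp.map col).symm.subset (by simp))
      subst hab
      rw [ih hu.2 hv.2 (x ++ [a]) (by simpa using h)]

/-- Let b be the first letter of m A whose colour violates the inequality. If an earlier colour k is
not adjacent to that of b, project to the two colours: the projection of x₂ would have to run past
that of x₁, which continues with a letter of colour k, so k would violate the inequality already.
Hence b commutes with all letters before it, and having a colour smaller than the maximal one it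
should precede m. -/
theorem colCount_le_of_traceEq {x₁ x₂ A h₁ R : List α} {m : α}
    (h : TraceEq I col (x₁ ++ m :: A ++ h₁) (x₂ ++ R))
    (hA : LexNF I ((m :: A).map col)) (hmax : ∀ i ∈ (m :: A).map col, i ≤ col m)
    (hm : colCount col (col m) x₂ ≤ colCount col (col m) x₁) {i : J}
    (hi : i ∈ (m :: A).map col) : colCount col i x₂ ≤ colCount col i x₁ := by
  by_contra hbad
  obtain ⟨v, b, y, e, hb, hv⟩ := exists_first_of_mem
    (p := fun c => ¬ colCount col (col c) x₂ ≤ colCount col (col c) x₁) (w := m :: A) (by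
      obtain ⟨c, hc, rfl⟩ := List.mem_map.1 hi
      exact ⟨c, hc, hbad⟩)
  cases v with
  | nil =>
    simp only [List.nil_append, List.cons.injEq] at e
    exact hb (e.1 ▸ hm)
  | cons m' v =>
    simp only [List.cons_append, List.cons.injEq] at e
    obtain ⟨rfl, rfl⟩ := e
    have hnot : ∀ k ∈ (m :: v).map col, colCount col k x₂ ≤ colCount col k x₁ := by
      intro k hk
      obtain ⟨c, hc, rfl⟩ := List.mem_map.1 hk
      exact not_not.1 (hv c hc)
    have hadj : ∀ k ∈ (m :: v).map col, I.Adj (col b) k := by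
      intro k hk
      by_contra hadj
      have hki : col b ≠ k := by rintro rfl; exact hb (hnot _ hk)
      obtain ⟨c, z, hc, hz⟩ := exists_pairProj_eq_cons (i := col b) (fun hmem => hb (hnot _ hmem)) hk
      have hp := h.pairProj_eq hadj
      have e1 : x₁ ++ m :: (v ++ b :: y) ++ h₁ = x₁ ++ ((m :: v) ++ (b :: y ++ h₁)) := by simp
      rw [e1, pairProj_append, pairProj_append _ _ x₂, pairProj_append _ _ (m :: v), hz] at hp
      rcases List.append_eq_append_iff.1 hp with ⟨t, ht, ht'⟩ | ⟨t, ht, -⟩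
      · cases t with
        | nil =>
          apply hb
          rw [← colCount_pairProj_left _ k x₂, ← colCount_pairProj_left _ k x₁, ht]
          simp
        | cons d t =>
          simp only [List.cons_append, List.cons.injEq] at ht'
          have h1 := hnot k hk
          rw [← colCount_pairProj_right (col b) k x₂, ← colCount_pairProj_right (col b) k x₁, ht,
            colCount_append, colCount_cons, ← ht'.1, hc] at h1
          simp at h1
      · apply hb
        rw [← colCount_pairProj_left _ k x₂, ← colCount_pairProj_left _ k x₁, ht]
        simp
    refine LexNF.not_lt_of_split (a := b) hA hadj (lt_of_le_of_ne (hmax _ (by simp)) ?_)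
    exact (hadj (col m) (by simp)).ne

end Compare

end ColouredWords
end GPQuad
end

noncomputable section
namespace GPQuad

/-! ### Powers in lexicographic normal forms -/

section Powers

variable {α : Type*}

/-- The `n`-th power of a word. -/
def wordPow (s : List α) (n : ℕ) : List α := (List.replicate n s).flatten

@[simp] theorem wordPow_zero (s : List α) : wordPow s 0 = [] := rfl

theorem wordPow_succ (s : List α) (n : ℕ) : wordPow s (n + 1) = s ++ wordPow s n := by
  simp [wordPow, List.replicate_succ]

theorem wordPow_succ' (s : List α) (n : ℕ) : wordPow s (n + 1) = wordPow s n ++ s := by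
  simp [wordPow, List.replicate_succ']

@[simp] theorem length_wordPow (s : List α) (n : ℕ) : (wordPow s n).length = n * s.length := by
  simp [wordPow]

theorem map_wordPow {β : Type*} (f : α → β) (s : List α) (n : ℕ) :
    (wordPow s n).map f = wordPow (s.map f) n := by
  simp [wordPow, List.map_flatten]

theorem mem_of_mem_wordPow {s : List α} {n : ℕ} {a : α} (h : a ∈ wordPow s n) : a ∈ s := by
  simp only [wordPow, List.mem_flatten, List.mem_replicate] at h
  obtain ⟨l, ⟨-, rfl⟩, hl⟩ := h
  exact hl

/-- A word `z` that is a prefix of `y z` begins with a power of `y`. -/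
theorem wordPow_prefix_of_prefix {y z : List α} (h : z <+: y ++ z) :
    ∀ e : ℕ, e * y.length ≤ z.length → wordPow y e <+: z
  | 0, _ => List.nil_prefix
  | e + 1, he => by
    have ih := wordPow_prefix_of_prefix h e ((Nat.mul_le_mul_right _ e.le_succ).trans he)
    rw [wordPow_succ]
    exact List.prefix_of_prefix_length_le ((List.prefix_append_right_inj y).2 ih) h
      (by rw [← wordPow_succ, length_wordPow]; exact he)

/-- Among sufficiently many letters, few of which violate `p`, there is a long run of letters
satisfying `p`. -/
theorem exists_long_run (p : α → Bool) (L : ℕ) (y : List α) (c : ℕ)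
    (hc : y.countP (fun a => !p a) ≤ c) (hy : (c + 1) * L ≤ y.length) :
    ∃ P F R, y = P ++ F ++ R ∧ F.length = L ∧ ∀ a ∈ F, p a = true := by
  induction c generalizing y with
  | zero =>
    refine ⟨[], y.take L, y.drop L, by simp, by simp; omega, fun a ha => ?_⟩
    have := List.countP_eq_zero.1 (Nat.le_zero.1 hc) a (List.mem_of_mem_take ha)
    simpa using this
  | succ c ih =>
    by_cases h : ∀ a ∈ y.take L, p a = true
    · refine ⟨[], y.take L, y.drop L, by simp, ?_, h⟩
      rw [List.length_take, min_eq_left]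
      exact le_trans (Nat.le_mul_of_pos_left _ (by omega)) hy
    · push Not at h
      obtain ⟨a, ha, hpa⟩ := h
      have h1 : 0 < (y.take L).countP (fun a => !p a) :=
        List.countP_pos_iff.2 ⟨a, ha, by simpa using hpa⟩
      have h2 : y.countP (fun a => !p a) =
          (y.take L).countP (fun a => !p a) + (y.drop L).countP (fun a => !p a) := by
        rw [← List.countP_append, List.take_append_drop]
      obtain ⟨P, F, R, e, hF, hF'⟩ := ih (y.drop L) (by omega) (by
        rw [List.length_drop]
        have : (c + 1 + 1) * L = (c + 1) * L + L := by ring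
        omega)
      exact ⟨y.take L ++ P, F, R, by
        rw [List.append_assoc, List.append_assoc, ← List.append_assoc P, ← e,
          List.take_append_drop], hF, hF'⟩

variable {J : Type*} [LinearOrder J] {I : SimpleGraph J} {col : α → J}

theorem exists_split_at_colCount {M : J} {d : ℕ} {l : List α} (h : d + 1 ≤ colCount col M l) :
    ∃ x a y, l = x ++ a :: y ∧ col a = M ∧ colCount col M x = d := by
  induction l generalizing d with
  | nil => simp at h
  | cons b l ih =>
    rw [colCount_cons] at h
    by_cases hb : col b = M
    · cases d with
      | zero => exact ⟨[], b, l, rfl, hb, rfl⟩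
      | succ d =>
        obtain ⟨x, a, y, rfl, ha, hx⟩ := ih (d := d) (by simp [hb] at h; omega)
        exact ⟨b :: x, a, y, rfl, ha, by simp [colCount_cons, hb, hx]⟩
    · obtain ⟨x, a, y, rfl, ha, hx⟩ := ih (d := d) (by simp [hb] at h; omega)
      exact ⟨b :: x, a, y, rfl, ha, by simp [colCount_cons, hb, hx]⟩

/-- A word is at least as rich in the colour `M` as it has disjoint factors of length `L`, if all
those contain `M`. -/
theorem le_colCount_of_forall_infix {M : J} {L : ℕ} {l : List α}
    (h : ∀ f, f <:+: l → f.length = L → M ∈ f.map col) :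
    ∀ k, k * L ≤ l.length → k ≤ colCount col M l := by
  intro k
  induction k generalizing l with
  | zero => simp
  | succ k ih =>
    intro hk
    have e : (k + 1) * L = k * L + L := by ring
    rw [← List.take_append_drop L l, colCount_append]
    have h1 := colCount_pos.2 (h (l.take L) (List.take_prefix L l).isInfix
      (by rw [List.length_take]; omega))
    have h2 := ih (l := l.drop L) (fun f hf => h f (hf.trans (List.drop_suffix L l).isInfix))
      (by rw [List.length_drop]; omega)
    omega

theorem length_le_of_colCount_le {u v : List α} (h : ∀ i, colCount col i u ≤ colCount col i v) :
    u.length ≤ v.length := by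
  have : (u.map col).Subperm (v.map col) := List.subperm_iff_count.2 h
  simpa using this.length_le

/-- Two positions of a normal form whose distance is one period contain the same continuation. -/
theorem prefix_of_factor_of_power {s g f₀ A₀ z r h : List α} {m m' : α} {B A : List α} {n : ℕ}
    (hf : LexNF I ((m :: A).map col)) (hA : m :: A = A₀ ++ m' :: B) (hB : m' :: B = z ++ r)
    (hs : TraceEq I col (g ++ (f₀ ++ m :: A) ++ h) (wordPow s n))
    (hmm : col m' = col m) (hmax : ∀ i ∈ (m :: A).map col, i ≤ col m)
    (hr : ∀ i ∈ (m :: A).map col, i ∈ r.map col)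
    (hcount : colCount col (col m) A₀ = colCount col (col m) s) :
    z <+: A₀ ++ z ∧ A₀.length ≤ s.length := by
  have hLB : LexNF I ((m' :: B).map col) := by
    rw [hA, List.map_append] at hf
    exact hf.of_append_right
  have hBA : ∀ i ∈ (m' :: B).map col, i ∈ (m :: A).map col := fun i hi => by
    rw [hA, List.map_append]; exact List.mem_append_right _ hi
  have hAB : ∀ i ∈ (m :: A).map col, i ∈ (m' :: B).map col := fun i hi => by
    rw [hB, List.map_append]; exact List.mem_append_right _ (hr i hi)
  -- Both sides are words for s · sⁿ = sⁿ · s. Adding s on the left on one side and on the right on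
  -- the other shifts the factor by one period.
  have hW : TraceEq I col ((s ++ g ++ f₀) ++ m :: A ++ h) ((g ++ f₀ ++ A₀) ++ m' :: B ++ (h ++ s)) := by
    have e1 : (s ++ g ++ f₀) ++ m :: A ++ h = s ++ (g ++ (f₀ ++ m :: A) ++ h) := by simp
    have e2 : (g ++ f₀ ++ A₀) ++ m' :: B ++ (h ++ s) = (g ++ (f₀ ++ m :: A) ++ h) ++ s := by
      rw [hA]; simp
    rw [e1, e2]
    refine (hs.append_left s).trans (TraceEq.trans (.of_eq ?_) (hs.append_right s).symm)
    rw [← wordPow_succ, wordPow_succ']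
  have hM : colCount col (col m) (s ++ g ++ f₀) = colCount col (col m) (g ++ f₀ ++ A₀) := by
    simp only [colCount_append, hcount]; omega
  -- The letters m and m' both have maximal colour and equally many letters of that colour before
  -- them, so `colCount_le_of_traceEq` applies in both directions.
  have hQ : ∀ i ∈ {i | i ∈ (m :: A).map col},
      colCount col i (s ++ g ++ f₀) = colCount col i (g ++ f₀ ++ A₀) := by
    intro i hi
    refine le_antisymm ?_ ?_
    · refine colCount_le_of_traceEq (I := I) (x₁ := g ++ f₀ ++ A₀) (m := m') (A := B)
        (R := m :: A ++ h) (by simpa using hW.symm) hLB (fun i hi => ?_) ?_ (hAB i hi)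
      · rw [hmm]; exact hmax i (hBA i hi)
      · rw [hmm, hM]
    · exact colCount_le_of_traceEq (I := I) (R := m' :: B ++ (h ++ s)) (by simpa using hW) hf hmax
        hM.ge hi
  constructor
  · have hzle : z.length ≤ (m :: A).length := by rw [hA, hB]; simp; omega
    obtain ⟨z', r', e, hz'⟩ : ∃ z' r', m :: A = z' ++ r' ∧ z'.length = z.length :=
      ⟨(m :: A).take z.length, (m :: A).drop z.length, (List.take_append_drop _ _).symm, by
        rw [List.length_take]; omega⟩
    have hrr : r <:+ r' := by
      refine List.suffix_of_suffix_length_le (l₃ := m :: A) ?_ ?_ ?_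
      · rw [hA, hB]; exact ⟨A₀ ++ z, by simp⟩
      · rw [e]; exact List.suffix_append _ _
      · have h1 := congrArg List.length e
        have h2 := congrArg List.length hA
        have h3 := congrArg List.length hB
        simp at h1 h2 h3
        omega
    have hzz : z' = z := by
      refine agree_of_traceEq (I := I) (Q := {i | i ∈ (m :: A).map col}) hz' (x₁ := s ++ g ++ f₀)
        (x₂ := g ++ f₀ ++ A₀) (A := r') (B := r) (h₁ := h) (h₂ := h ++ s) ?_ ?_ ?_ hQ ?_ ?_ ?_ hr
      · rw [← e, ← hB]; exact hW
      · rw [← e]; exact hf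
      · rw [← hB]; exact hLB
      · rw [← e]; exact fun i hi => hi
      · rw [← hB]; exact hBA
      · exact fun i hi => (hrr.map col).subset (hr i hi)
    refine List.prefix_of_prefix_length_le (l₃ := m :: A) ?_ ?_ (by simp)
    · exact ⟨r', by rw [e, hzz]⟩
    · exact ⟨r, by rw [hA, hB]; simp⟩
  -- Cancelling the counts of g and f₀ in `hQ` shows that each colour of A₀ occurs as often in A₀ as
  -- in s.
  · refine length_le_of_colCount_le (col := col) fun i => ?_
    by_cases hi : i ∈ A₀.map col
    · have := hQ i (by
        rw [Set.mem_ofPred_eq, hA, List.map_append]; exact List.mem_append_left _ hi)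
      simp only [colCount_append] at this
      omega
    · rw [colCount, List.count_eq_zero_of_not_mem hi]
      exact Nat.zero_le _

/-- Long normal forms that are factors of powers of `s` contain high powers. -/
theorem exists_power_of_factor_of_power (I : SimpleGraph J) (col : α → J) (s : List α) (e : ℕ)
    (Q : Finset J) :
    ∃ L : ℕ, ∀ (f g h : List α) (n : ℕ), LexNF I (f.map col) →
      TraceEq I col (g ++ f ++ h) (wordPow s n) → (∀ i ∈ f.map col, i ∈ Q) → L ≤ f.length →
      ∃ y, y ≠ [] ∧ wordPow y e <:+: f := by
  induction Q using Finset.strongInduction with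
  | H Q ih =>
  choose! Lq hLq using fun q (hq : q ∈ Q) => ih (Q.erase q) (Finset.erase_ssubset hq)
  let L' := Q.sup Lq
  -- A first block of length L' contains m; a block of length (d + 1) L' with d ≤ |s| contains m',
  -- one period later; a last block of length L' is the reserve; and e |s| is the room for e
  -- periods. The 1 makes f nonempty, so that Q has a maximum.
  refine ⟨(s.length + 3) * L' + e * s.length + 1, fun f g h n hf hs hQ hlen => ?_⟩
  -- A factor of length L' that misses a colour of Q is itself a factor of a power of s with fewer
  -- colours, so induction applies.
  by_cases hall : ∀ f', f' <:+: f → f'.length = L' → ∀ q ∈ Q, q ∈ f'.map col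
  swap
  · push Not at hall
    obtain ⟨f', hf', hl, q, hq, hqf⟩ := hall
    have hf'' := hf'
    obtain ⟨u, v, rfl⟩ := hf'
    obtain ⟨y, hy, hye⟩ := hLq q hq f' (g ++ u) (v ++ h) n (hf.of_infix (hf''.map col))
      (by simpa using hs)
      (fun i hi => Finset.mem_erase.2 ⟨by rintro rfl; exact hqf hi, hQ i ((hf''.map col).subset hi)⟩)
      (hl ▸ Finset.le_sup hq)
    exact ⟨y, hy, hye.trans hf''⟩
  have hne : Q.Nonempty := by
    cases f with
    | nil => simp at hlen
    | cons a f => exact ⟨col a, hQ _ (by simp)⟩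
  set M := Q.max' hne with hMdef
  have hMQ : M ∈ Q := Q.max'_mem hne
  set d := colCount col M s with hd
  have hds : d ≤ s.length := by
    have := List.count_le_length (a := M) (l := s.map col)
    simpa [hd, colCount] using this
  have hinf : ∀ f', f' <:+: f → L' ≤ f'.length → ∀ q ∈ Q, q ∈ f'.map col := by
    intro f' hf' hl q hq
    have := hall (f'.take L') ((List.take_prefix _ _).isInfix.trans hf')
      (by rw [List.length_take]; omega) q hq
    exact ((List.take_sublist _ _).map col).subset this
  have hmul : (s.length + 3) * L' = (d + 1) * L' + (s.length - d) * L' + 2 * L' := by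
    rw [← Nat.add_mul, ← Nat.add_mul]; congr 1; omega
  obtain ⟨P, f₁, rfl, hP⟩ : ∃ P f₁, f = P ++ f₁ ∧ P.length = L' :=
    ⟨f.take L', f.drop L', (List.take_append_drop _ _).symm, by rw [List.length_take]; omega⟩
  obtain ⟨f₀, m, p, rfl, hm, -⟩ := exists_split_at_colCount (d := 0)
    (colCount_pos.2 (hinf P (List.prefix_append _ _).isInfix hP.ge M hMQ))
  rw [List.length_append, hP] at hlen
  obtain ⟨C, D, hCD, hC⟩ : ∃ C D, m :: p ++ f₁ = C ++ D ∧ C.length = (d + 1) * L' :=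
    ⟨(m :: p ++ f₁).take ((d + 1) * L'), (m :: p ++ f₁).drop ((d + 1) * L'),
      (List.take_append_drop _ _).symm, by
        rw [List.length_take, List.length_append]; omega⟩
  have hfe : (f₀ ++ m :: p) ++ f₁ = f₀ ++ (C ++ D) := by rw [← hCD]; simp
  have hCf : C <:+: f₀ ++ m :: p ++ f₁ := ⟨f₀, D, by rw [hfe]; simp⟩
  have hDf : D <:+: f₀ ++ m :: p ++ f₁ := ⟨f₀ ++ C, [], by rw [hfe]; simp⟩
  have hDlen : L' + e * s.length ≤ D.length := by
    have h1 := congrArg List.length hCD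
    simp only [List.length_append, hC, List.length_cons] at h1
    simp only [List.length_append, List.length_cons] at hP
    omega
  -- From m to m' there are exactly d letters of colour M, as many as in s, so m' lies one period
  -- after m.
  obtain ⟨A₀, m', C', rfl, hm', hA₀⟩ := exists_split_at_colCount (d := d) (M := M) (l := C)
    (le_colCount_of_forall_infix (L := L') (fun f' hf' hl => hinf f' (hf'.trans hCf) hl.ge M hMQ) _
      hC.ge)
  obtain ⟨D', r, rfl, hr⟩ : ∃ D' r, D = D' ++ r ∧ r.length = L' :=
    ⟨D.take (D.length - L'), D.drop (D.length - L'), (List.take_append_drop _ _).symm, by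
      rw [List.length_drop]; omega⟩
  have hsub : ∀ i ∈ (m :: (p ++ f₁)).map col, i ∈ Q := fun i hi => hQ i (by
    have : (m :: (p ++ f₁)) <:+: f₀ ++ m :: p ++ f₁ := ⟨f₀, [], by simp⟩
    exact (this.map col).subset hi)
  -- The colour M occurs in f, hence in sⁿ and in s; so d > 0 and the period is nonempty.
  have hd0 : A₀ ≠ [] := by
    rintro rfl
    have hd0 : d = 0 := by rw [← hA₀]; rfl
    have hmem : M ∈ (wordPow s n).map col := by
      refine (hs.perm.map col).subset ?_
      simp [hm]
    obtain ⟨a, ha, hac⟩ := List.mem_map.1 hmem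
    have : 0 < colCount col M s := colCount_pos.2 (hac ▸ List.mem_map_of_mem (mem_of_mem_wordPow ha))
    omega
  have key := prefix_of_factor_of_power (I := I) (col := col) (s := s) (g := g) (f₀ := f₀) (A₀ := A₀)
    (z := m' :: C' ++ D') (r := r) (h := h) (m := m) (m' := m') (B := C' ++ (D' ++ r))
    (A := p ++ f₁) (n := n) ?_ (by simpa using hCD) (by simp) (by simpa using hs) (by rw [hm', hm])
    (fun i hi => by rw [hm]; exact Q.le_max' i (hsub i hi))
    (fun i hi => hinf r (List.IsInfix.trans ⟨D', [], by simp⟩ hDf) hr.ge i (hsub i hi))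
    (by rw [hm, hA₀])
  · refine ⟨A₀, hd0, ?_⟩
    have h1 := wordPow_prefix_of_prefix key.1 e (by
      have : e * A₀.length ≤ e * s.length := Nat.mul_le_mul_left _ key.2
      simp only [List.length_append, List.length_cons] at hDlen ⊢
      omega)
    refine h1.isInfix.trans ⟨f₀ ++ A₀, r, ?_⟩
    rw [hfe]; simp
  · have : (m :: (p ++ f₁)) <:+: f₀ ++ m :: p ++ f₁ := ⟨f₀, [], by simp⟩
    exact hf.of_infix (this.map col)

/-- The normal forms of the words `u s ^ n v` contain high powers. -/
theorem exists_power_of_traceEq (I : SimpleGraph J) (col : α → J) {s : List α} (hs : s ≠ [])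
    (u v : List α) (e : ℕ) :
    ∃ N : ℕ, ∀ (n : ℕ) (w : List α), N ≤ n → LexNF I (w.map col) →
      TraceEq I col (u ++ wordPow s n ++ v) w → ∃ y, y ≠ [] ∧ wordPow y e <:+: w := by
  obtain ⟨L, hL⟩ := exists_power_of_factor_of_power I col s e (s.map col).toFinset
  have hs1 : 1 ≤ s.length := List.length_pos_iff.2 hs
  refine ⟨(u.length + v.length + 1) * L, fun n w hn hw h => ?_⟩
  -- The letters of sⁿ are marked `true`. At most |u| + |v| letters of the normal form are unmarked,
  -- so it contains a long run F of marked ones.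
  let y : List (α × Bool) := u.map (·, false) ++ wordPow (s.map (·, true)) n ++ v.map (·, false)
  have hid : ∀ (b : Bool) (l : List α), (l.map (·, b)).map Prod.fst = l := fun b l => by
    simp [Function.comp_def]
  obtain ⟨y', rfl, hy'⟩ := h.lift Prod.fst y (by
    simp only [y, List.map_append, map_wordPow, hid])
  have hfilt : y.filter (fun a => a.2) = wordPow (s.map (·, true)) n := by
    simp only [y, List.filter_append]
    have h1 : ∀ l : List α, (l.map (·, false)).filter (fun a => a.2) = [] := fun l => by simp
    rw [h1, h1, List.nil_append, List.append_nil, List.filter_eq_self]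
    intro a ha
    obtain ⟨c, -, rfl⟩ := List.mem_map.1 (mem_of_mem_wordPow ha)
    rfl
  have hcount : y'.countP (fun a => !a.2) ≤ u.length + v.length := by
    rw [← hy'.perm.countP_eq]
    simp only [y, List.countP_append]
    have h1 : (wordPow (s.map (·, true)) n).countP (fun a => !a.2) = 0 := by
      refine List.countP_eq_zero.2 fun a ha => ?_
      obtain ⟨c, -, rfl⟩ := List.mem_map.1 (mem_of_mem_wordPow ha)
      simp
    have h2 : ∀ l : List α, (l.map (·, false)).countP (fun a => !a.2) ≤ l.length := fun l => by
      simpa using List.countP_le_length (p := fun a : α × Bool => !a.2) (l := l.map (·, false))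
    rw [h1]
    have := h2 u
    have := h2 v
    omega
  obtain ⟨P, F, R, rfl, hF, hFt⟩ := exists_long_run (fun a : α × Bool => a.2) L y'
    (u.length + v.length) hcount (by
      rw [← hy'.perm.length_eq]
      simp only [y, List.length_append, length_wordPow, List.length_map]
      have : n * 1 ≤ n * s.length := Nat.mul_le_mul_left _ hs1
      omega)
  -- Erasing the unmarked letters leaves F intact and exhibits it as a factor of a word for sⁿ.
  have hfac := (hy'.filter (fun a => a.2)).map (col' := col) Prod.fst (fun _ => rfl)
  rw [hfilt, map_wordPow, hid, List.filter_append, List.filter_append,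
    List.filter_eq_self.2 hFt, List.map_append, List.map_append] at hfac
  have hFin : F.map Prod.fst <:+: (P ++ F ++ R).map Prod.fst := by
    rw [List.map_append, List.map_append]
    exact ⟨_, _, rfl⟩
  have hcol : ∀ i ∈ (F.map Prod.fst).map col, i ∈ (s.map col).toFinset := fun i hi => by
    rw [List.mem_toFinset]
    obtain ⟨a, ha, rfl⟩ := List.mem_map.1 hi
    have : a ∈ wordPow s n := hfac.perm.symm.subset
      (List.mem_append_left _ (List.mem_append_right _ ha))
    exact List.mem_map_of_mem (mem_of_mem_wordPow this)
  obtain ⟨y, hy, hye⟩ := hL (F.map Prod.fst) _ _ n (hw.of_infix (hFin.map col)) hfac.symm hcol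
    (by simp [hF])
  exact ⟨y, hy, hye.trans hFin⟩

end Powers
end GPQuad
end

noncomputable section
namespace GPQuad

/-! ### Uniqueness of reduced representations in graph products -/

/-! ### Trace monoids in terms of commutations of words. -/

section TraceWords

variable {J : Type*} (I : SimpleGraph J) {A : Type*} (col : A → J)

theorem toTrace_eq_iff (v w : FreeMonoid A) :
    toTrace (I.comap col) v = toTrace (I.comap col) w ↔ TraceEq I col v.toList w.toList := by
  constructor
  · intro h
    let c : Con (FreeMonoid A) :=
      { r := fun v w => TraceEq I col v.toList w.toList
        iseqv := ⟨fun _ => .refl _, .symm, .trans⟩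
        mul' := fun h h' => by
          simpa only [FreeMonoid.toList_mul] using h.append h' }
    have hle : traceCon (I.comap col) ≤ c := by
      refine Con.conGen_le.2 ?_
      rintro x y ⟨a, b, hab, rfl, rfl⟩
      exact TraceEq.swap a b [] hab
    exact hle ((Con.eq _).1 h)
  · intro h
    suffices H : ∀ u u' : List A, TraceEq I col u u' →
        toTrace (I.comap col) (FreeMonoid.ofList u) = toTrace (I.comap col) (FreeMonoid.ofList u') from
      H _ _ h
    intro u u' h
    induction h with
    | nil => rfl
    | cons a _ ih => simp only [FreeMonoid.ofList_cons, map_mul, ih]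
    | swap a b u h =>
      simp only [FreeMonoid.ofList_cons, ← mul_assoc, map_mul]
      congr 1
      rw [← map_mul, ← map_mul]
      exact (Con.eq _).2 (ConGen.Rel.of _ _ ⟨a, b, h, rfl, rfl⟩)
    | trans _ _ ih₁ ih₂ => exact ih₁.trans ih₂

/-- The lexicographically first word of a trace is in normal form for the colours. -/
theorem lexNF_nfLex [LinearOrder J] [LinearOrder A] (hcol : ∀ a b : A, col a < col b → a < b)
    (t : TraceMonoid (I.comap col)) : LexNF I ((nfLex (I.comap col) t).toList.map col) := by
  by_contra h
  obtain ⟨h1, h2⟩ := Classical.choose_spec (exists_lex_first (I.comap col) t)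
  change toTrace _ (nfLex (I.comap col) t) = t at h1
  change ∀ w' : FreeMonoid A, _ → (nfLex (I.comap col) t).toList ≤ _ at h2
  obtain ⟨x, a, b, y, z, e, htr, hlt⟩ := exists_smaller_of_not_lexNF h
  have h3 := h2 (FreeMonoid.ofList (x ++ a :: y)) (by
    rw [← h1, toTrace_eq_iff]; exact htr.symm)
  rw [e] at h3
  change x ++ b :: z ≤ x ++ a :: y at h3
  refine h3.not_gt ?_
  exact List.Lex.append_left _ (List.Lex.rel (hcol _ _ hlt)) x

theorem toTrace_nfLex [LinearOrder A] (t : TraceMonoid (I.comap col)) :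
    toTrace (I.comap col) (nfLex (I.comap col) t) = t :=
  (Classical.choose_spec (exists_lex_first (I.comap col) t)).1

end TraceWords

/-! ### Words over the syllables and their heads. -/

section Reduced

variable {J : Type*} (I : SimpleGraph J) {M : J → Type*} [∀ i, Group (M i)]

/-- The colours of a word over the syllables. -/
def cols (w : List (Syllable M)) : List J := w.map Sigma.fst

@[simp] theorem cols_nil : cols ([] : List (Syllable M)) = [] := rfl

@[simp] theorem cols_cons (s : Syllable M) (w : List (Syllable M)) :
    cols (s :: w) = s.1 :: cols w := rfl

@[simp] theorem cols_append (v w : List (Syllable M)) : cols (v ++ w) = cols v ++ cols w :=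
  List.map_append

/-- Equality of words over the syllables modulo commutation. -/
abbrev SylEq : List (Syllable M) → List (Syllable M) → Prop := TraceEq I Sigma.fst

/-- The element of the graph product represented by a word over the syllables. -/
def evalSyl (w : List (Syllable M)) : GraphProduct I M :=
  (w.map fun s => GraphProduct.of I M s.1 s.2.1).prod

@[simp] theorem evalSyl_nil : evalSyl I ([] : List (Syllable M)) = 1 := rfl

@[simp] theorem evalSyl_cons (s : Syllable M) (w : List (Syllable M)) :
    evalSyl I (s :: w) = GraphProduct.of I M s.1 s.2.1 * evalSyl I w := by simp [evalSyl]

@[simp] theorem evalSyl_append (v w : List (Syllable M)) :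
    evalSyl I (v ++ w) = evalSyl I v * evalSyl I w := by simp [evalSyl]

theorem evalTrace_toTrace (w : FreeMonoid (Syllable M)) :
    evalTrace I M (toTrace _ w) = evalSyl I w.toList := by
  induction w using FreeMonoid.inductionOn' with
  | one => simp
  | of_mul a w ih => simp [ih, evalTrace_of]

variable {I}

theorem TraceEq.evalSyl_eq {v w : List (Syllable M)} (h : SylEq I v w) :
    evalSyl I v = evalSyl I w := by
  have := (toTrace_eq_iff I Sigma.fst (FreeMonoid.ofList v) (FreeMonoid.ofList w)).2 h
  have h2 := congrArg (evalTrace I M) this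
  exact (evalTrace_toTrace I _).symm.trans (h2.trans (evalTrace_toTrace I _))

open Classical in
/-- The product of a letter, possibly trivial, and a word. -/
def consVal {i : J} (g : M i) (w : List (Syllable M)) : List (Syllable M) :=
  if h : g = 1 then w else ⟨i, g, h⟩ :: w

@[simp] theorem consVal_one {i : J} (w : List (Syllable M)) : consVal (1 : M i) w = w := by
  simp [consVal]

theorem consVal_of_ne {i : J} {g : M i} (h : g ≠ 1) (w : List (Syllable M)) :
    consVal g w = ⟨i, g, h⟩ :: w := by simp [consVal, h]

theorem evalSyl_consVal {i : J} (g : M i) (w : List (Syllable M)) :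
    evalSyl I (consVal g w) = GraphProduct.of I M i g * evalSyl I w := by
  by_cases h : g = 1
  · simp [h]
  · simp [consVal_of_ne h]

theorem length_consVal_le {i : J} (g : M i) (w : List (Syllable M)) :
    (consVal g w).length ≤ w.length + 1 := by
  by_cases h : g = 1
  · simp [h]
  · simp [consVal_of_ne h]

theorem TraceEq.consVal {i : J} (g : M i) {v w : List (Syllable M)} (h : SylEq I v w) :
    SylEq I (consVal g v) (consVal g w) := by
  by_cases hg : g = 1
  · simpa [hg] using h
  · rw [consVal_of_ne hg, consVal_of_ne hg]
    exact h.cons _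

theorem consVal_comm {i j : J} (hij : I.Adj i j) (g : M i) (h : M j) (w : List (Syllable M)) :
    SylEq I (consVal g (consVal h w)) (consVal h (consVal g w)) := by
  by_cases hg : g = 1
  · simpa [hg] using TraceEq.refl _
  · by_cases hh : h = 1
    · simpa [hh] using TraceEq.refl _
    · simp only [consVal_of_ne hg, consVal_of_ne hh]
      exact TraceEq.swap _ _ _ hij

variable (I)

open Classical in
/-- The first letter of colour `i` of a word, if it can be moved to the front, and `1` otherwise. -/
def headVal (i : J) : List (Syllable M) → M i
  | [] => 1
  | s :: w => if h : s.1 = i then h ▸ s.2.1 else if I.Adj i s.1 then headVal i w else 1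

open Classical in
/-- The word that is left when `headVal` has been removed. -/
def headRest (i : J) : List (Syllable M) → List (Syllable M)
  | [] => []
  | s :: w => if s.1 = i then w else if I.Adj i s.1 then s :: headRest i w else s :: w

variable {I}

@[simp] theorem headVal_self {i : J} (g : {g : M i // g ≠ 1}) (w : List (Syllable M)) :
    headVal I i (⟨i, g⟩ :: w) = g := by simp [headVal]

@[simp] theorem headRest_self {i : J} (g : {g : M i // g ≠ 1}) (w : List (Syllable M)) :
    headRest I i (⟨i, g⟩ :: w) = w := by simp [headRest]

theorem headVal_of_adj {i : J} {s : Syllable M} (h : I.Adj i s.1) (w : List (Syllable M)) :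
    headVal I i (s :: w) = headVal I i w := by simp [headVal, h, h.ne']

theorem headRest_of_adj {i : J} {s : Syllable M} (h : I.Adj i s.1) (w : List (Syllable M)) :
    headRest I i (s :: w) = s :: headRest I i w := by simp [headRest, h, h.ne']

theorem headVal_of_not_adj {i : J} {s : Syllable M} (h : ¬ I.Adj i s.1) (h' : s.1 ≠ i)
    (w : List (Syllable M)) : headVal I i (s :: w) = 1 := by simp [headVal, h, h']

theorem headRest_of_not_adj {i : J} {s : Syllable M} (h : ¬ I.Adj i s.1) (h' : s.1 ≠ i)
    (w : List (Syllable M)) : headRest I i (s :: w) = s :: w := by simp [headRest, h, h']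

theorem headVal_ne_one_iff {i : J} {w : List (Syllable M)} :
    headVal I i w ≠ 1 ↔ IsHead I i (cols w) := by
  induction w with
  | nil => simp [headVal, IsHead]
  | cons s w ih =>
    by_cases h : s.1 = i
    · obtain ⟨j, g⟩ := s
      change j = i at h
      subst h
      simpa [IsHead] using g.2
    · by_cases h' : I.Adj i s.1
      · rw [headVal_of_adj h', ih]
        simp [IsHead, h', Ne.symm h]
      · simp [headVal_of_not_adj h' h, IsHead, h', Ne.symm h]

theorem headVal_eq_one {i : J} {w : List (Syllable M)} (h : ¬ IsHead I i (cols w)) :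
    headVal I i w = 1 := not_not.1 fun h' => h (headVal_ne_one_iff.1 h')

theorem headRest_eq_self {i : J} {w : List (Syllable M)} (h : ¬ IsHead I i (cols w)) :
    headRest I i w = w := by
  induction w with
  | nil => rfl
  | cons s w ih =>
    simp only [cols_cons, IsHead, not_or, not_and] at h
    by_cases h' : I.Adj i s.1
    · rw [headRest_of_adj h', ih (h.2 h')]
    · rw [headRest_of_not_adj h' (Ne.symm h.1)]

theorem traceEq_consVal_headRest (i : J) (w : List (Syllable M)) :
    SylEq I w (consVal (headVal I i w) (headRest I i w)) := by
  induction w with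
  | nil => simpa [headVal, headRest] using TraceEq.nil
  | cons s w ih =>
    by_cases h : s.1 = i
    · obtain ⟨j, g⟩ := s
      change j = i at h
      subst h
      rw [headVal_self, headRest_self, consVal_of_ne g.2]
      exact .refl _
    · by_cases h' : I.Adj i s.1
      · rw [headVal_of_adj h', headRest_of_adj h']
        refine (TraceEq.cons s ih).trans ?_
        have := consVal_comm (I := I) h'.symm s.2.1 (headVal I i w) (headRest I i w)
        rwa [consVal_of_ne s.2.2, consVal_of_ne s.2.2] at this
      · rw [headVal_of_not_adj h' h, headRest_of_not_adj h' h, consVal_one]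
        exact .refl _

theorem headVal_consVal_self {i : J} (g : M i) {w : List (Syllable M)}
    (h : ¬ IsHead I i (cols w)) : headVal I i (consVal g w) = g := by
  by_cases hg : g = 1
  · rw [hg, consVal_one, headVal_eq_one h]
  · rw [consVal_of_ne hg, headVal_self]

theorem headRest_consVal_self {i : J} (g : M i) {w : List (Syllable M)}
    (h : ¬ IsHead I i (cols w)) : headRest I i (consVal g w) = w := by
  by_cases hg : g = 1
  · rw [hg, consVal_one, headRest_eq_self h]
  · rw [consVal_of_ne hg, headRest_self]

theorem headVal_consVal_of_adj {i j : J} (hij : I.Adj i j) (g : M j) (w : List (Syllable M)) :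
    headVal I i (consVal g w) = headVal I i w := by
  by_cases hg : g = 1
  · rw [hg, consVal_one]
  · rw [consVal_of_ne hg, headVal_of_adj hij]

theorem headRest_consVal_of_adj {i j : J} (hij : I.Adj i j) (g : M j) (w : List (Syllable M)) :
    headRest I i (consVal g w) = consVal g (headRest I i w) := by
  by_cases hg : g = 1
  · rw [hg, consVal_one, consVal_one]
  · rw [consVal_of_ne hg, headRest_of_adj hij, consVal_of_ne hg]

/-- Swapping independent letters neither creates nor blocks a head. Hence the head and the remainder
belong to the trace, which makes `leftMul` well defined. -/
theorem TraceEq.headVal_and_headRest (i : J) {v w : List (Syllable M)} (h : SylEq I v w) :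
    headVal I i v = headVal I i w ∧ SylEq I (headRest I i v) (headRest I i w) := by
  induction h with
  | nil => exact ⟨rfl, .refl _⟩
  | @cons s v w h ih =>
    by_cases hs : s.1 = i
    · obtain ⟨j, g⟩ := s
      change j = i at hs
      subst hs
      simpa using h
    · by_cases h' : I.Adj i s.1
      · rw [headVal_of_adj h', headRest_of_adj h', headVal_of_adj h', headRest_of_adj h']
        exact ⟨ih.1, ih.2.cons s⟩
      · rw [headVal_of_not_adj h' hs, headRest_of_not_adj h' hs, headVal_of_not_adj h' hs,
          headRest_of_not_adj h' hs]
        exact ⟨rfl, h.cons s⟩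
  | swap s t u h =>
    by_cases hs : s.1 = i
    · obtain ⟨j, g⟩ := s
      change j = i at hs
      subst hs
      have h' : I.Adj j t.1 := h
      simp only [headVal_self, headRest_self, headVal_of_adj h', headRest_of_adj h']
      exact ⟨trivial, .refl _⟩
    · by_cases ht : t.1 = i
      · obtain ⟨j, g⟩ := t
        change j = i at ht
        subst ht
        have h' : I.Adj j s.1 := h.symm
        simp only [headVal_self, headRest_self, headVal_of_adj h', headRest_of_adj h']
        exact ⟨trivial, .refl _⟩
      · by_cases hs' : I.Adj i s.1 <;> by_cases ht' : I.Adj i t.1 <;>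
          simp only [headVal_of_adj, headRest_of_adj, headVal_of_not_adj, headRest_of_not_adj,
            hs, hs', ht, ht', not_false_eq_true, ne_eq, true_and] <;>
          exact TraceEq.swap s t _ h
  | trans _ _ ih₁ ih₂ => exact ⟨ih₁.1.trans ih₂.1, ih₁.2.trans ih₂.2⟩

theorem Red.headRest {i : J} {w : List (Syllable M)} (h : Red I (cols w)) :
    Red I (cols (headRest I i w)) ∧ ¬ IsHead I i (cols (GPQuad.headRest I i w)) := by
  by_cases hi : IsHead I i (cols w)
  · have h1 := (Red.congr (traceEq_consVal_headRest (I := I) i w).colours).1 h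
    rw [consVal_of_ne (headVal_ne_one_iff.2 hi)] at h1
    exact ⟨h1.2, h1.1⟩
  · rw [headRest_eq_self hi]
    exact ⟨h, hi⟩

theorem red_consVal {i : J} (g : M i) {w : List (Syllable M)} (h : Red I (cols w))
    (hi : ¬ IsHead I i (cols w)) : Red I (cols (consVal g w)) := by
  by_cases hg : g = 1
  · rwa [hg, consVal_one]
  · rw [consVal_of_ne hg]
    exact ⟨hi, h⟩

/-! ### The action on reduced words and van der Waerden's argument. -/

variable (I M)

/-- Reduced words up to commutation. -/
def redSetoid : Setoid {w : List (Syllable M) // Red I (cols w)} where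
  r v w := SylEq I v.1 w.1
  iseqv := ⟨fun _ => .refl _, .symm, .trans⟩

/-- The set of reduced words up to commutation. -/
def ReducedClass : Type _ := Quotient (redSetoid I M)

variable {I M}

/-- The left multiplication of reduced words by the elements of a local group. -/
def leftMul {i : J} (g : M i) : ReducedClass I M → ReducedClass I M :=
  Quotient.map' (s₁ := redSetoid I M) (s₂ := redSetoid I M)
    (fun w => ⟨consVal (g * headVal I i w.1) (headRest I i w.1),
      red_consVal _ w.2.headRest.1 w.2.headRest.2⟩)
    (fun v w h => by
      have := TraceEq.headVal_and_headRest i h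
      change SylEq I (consVal _ _) (consVal _ _)
      rw [this.1]
      exact TraceEq.consVal _ this.2)

theorem leftMul_one (i : J) (c : ReducedClass I M) : leftMul (1 : M i) c = c := by
  refine Quotient.inductionOn' c fun w => Quotient.sound' ?_
  change SylEq I (consVal _ _) _
  rw [one_mul]
  exact (traceEq_consVal_headRest i w.1).symm

theorem leftMul_mul {i : J} (g h : M i) (c : ReducedClass I M) :
    leftMul (g * h) c = leftMul g (leftMul h c) := by
  refine Quotient.inductionOn' c fun w => Quotient.sound' ?_
  change SylEq I (consVal _ _) (consVal (g * headVal I i (consVal _ _)) (headRest I i (consVal _ _)))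
  rw [headVal_consVal_self _ w.2.headRest.2, headRest_consVal_self _ w.2.headRest.2, mul_assoc]
  exact .refl _

/-- Heads of adjacent colours do not obstruct each other, and removing them in either order leaves
the same trace. So the local actions satisfy the defining relations of the graph product. -/
theorem leftMul_comm {i j : J} (hij : I.Adj i j) (g : M i) (h : M j) (c : ReducedClass I M) :
    leftMul g (leftMul h c) = leftMul h (leftMul g c) := by
  refine Quotient.inductionOn' c fun w => Quotient.sound' ?_
  obtain ⟨w, hw⟩ := w
  change SylEq I (consVal (g * headVal I i (consVal _ _)) (headRest I i (consVal _ _)))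
    (consVal (h * headVal I j (consVal _ _)) (headRest I j (consVal _ _)))
  rw [headVal_consVal_of_adj hij, headRest_consVal_of_adj hij,
    headVal_consVal_of_adj hij.symm, headRest_consVal_of_adj hij.symm]
  have hi := hw.headRest (i := i)
  have hj := hw.headRest (i := j)
  have e1 := traceEq_consVal_headRest (I := I) i w
  have e2 := traceEq_consVal_headRest (I := I) j w
  have a1 := e2.headVal_and_headRest i
  rw [headVal_consVal_of_adj hij, headRest_consVal_of_adj hij] at a1
  have a2 := e1.headVal_and_headRest j
  rw [headVal_consVal_of_adj hij.symm, headRest_consVal_of_adj hij.symm] at a2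
  have a3 := (a1.2.headVal_and_headRest j).2
  have hj' : ¬ IsHead I j (cols (headRest I i (headRest I j w))) := by
    intro hh
    apply hj.2
    refine (IsHead.congr (traceEq_consVal_headRest (I := I) i (headRest I j w)).colours).2 ?_
    change IsHead I j (cols _)
    rw [← headVal_ne_one_iff, headVal_consVal_of_adj hij.symm, headVal_ne_one_iff]
    exact hh
  rw [headRest_consVal_self _ hj'] at a3
  rw [← a1.1, ← a2.1]
  refine (consVal_comm hij _ _ _).trans ?_
  exact ((a3.symm.consVal _).consVal _)

variable (I) in
/-- The action of a local group on reduced words. -/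
def leftMulHom (i : J) : M i →* Function.End (ReducedClass I M) where
  toFun g := (leftMul g : ReducedClass I M → ReducedClass I M)
  map_one' := funext fun c => leftMul_one i c
  map_mul' g h := funext fun c => leftMul_mul g h c

/-- The action of the graph product on reduced words. -/
def actHom (I : SimpleGraph J) (M : J → Type*) [∀ i, Group (M i)] :
    GraphProduct I M →* Function.End (ReducedClass I M) :=
  (graphProductCon I M).lift (Monoid.CoprodI.lift (leftMulHom I))
    (Con.conGen_le.2 (by
      rintro x y ⟨j, k, a, b, hjk, rfl, rfl⟩
      change Monoid.CoprodI.lift _ _ = Monoid.CoprodI.lift _ _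
      rw [map_mul, map_mul, Monoid.CoprodI.lift_of, Monoid.CoprodI.lift_of]
      exact funext fun c => leftMul_comm hjk a b c))

theorem actHom_of {i : J} (g : M i) :
    actHom I M (GraphProduct.of I M i g) = leftMulHom I i g := by
  change Monoid.CoprodI.lift (leftMulHom I) (Monoid.CoprodI.of g) = _
  rw [Monoid.CoprodI.lift_of]

/-- Acting on the empty word rebuilds a reduced word letter by letter, as no letter meets a head of
its own colour. Thus the element determines the reduced word up to commutation. -/
theorem actHom_evalSyl {w : List (Syllable M)} (hw : Red I (cols w)) :
    actHom I M (evalSyl I w) (Quotient.mk'' ⟨[], trivial⟩) = Quotient.mk'' ⟨w, hw⟩ := by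
  induction w with
  | nil => rw [evalSyl_nil, map_one]; rfl
  | cons s w ih =>
    have h : actHom I M (evalSyl I (s :: w)) (Quotient.mk'' ⟨[], trivial⟩) =
        leftMul s.2.1 (actHom I M (evalSyl I w) (Quotient.mk'' ⟨[], trivial⟩)) := by
      rw [evalSyl_cons, map_mul, actHom_of]; rfl
    rw [h, ih hw.2]
    refine Quotient.sound' ?_
    change SylEq I (consVal _ _) _
    rw [headVal_eq_one hw.1, headRest_eq_self hw.1, mul_one, consVal_of_ne s.2.2]
    exact .refl _

/-- Reduced representations are unique up to commutation. -/
theorem Red.traceEq_of_evalSyl_eq {v w : List (Syllable M)} (hv : Red I (cols v))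
    (hw : Red I (cols w)) (h : evalSyl I v = evalSyl I w) : SylEq I v w := by
  have := actHom_evalSyl hv
  rw [h, actHom_evalSyl hw] at this
  exact (Quotient.exact' this).symm

/-! ### Reduction of words and syllable length. -/

theorem exists_shorter_of_not_red {w : List (Syllable M)} (h : ¬ Red I (cols w)) :
    ∃ (y z : List (Syllable M)) (i : J) (a b : {g : M i // g ≠ 1}),
      SylEq I w (y ++ ⟨i, a⟩ :: ⟨i, b⟩ :: z) := by
  induction w with
  | nil => exact absurd trivial h
  | cons s w ih =>
    by_cases hw : Red I (cols w)
    · have hs : IsHead I s.1 (cols w) := by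
        by_contra hs; exact h ⟨hs, hw⟩
      obtain ⟨⟨j, b⟩, z, hj, e⟩ := IsHead.exists_traceEq hs
      obtain ⟨i, a⟩ := s
      change j = i at hj
      subst hj
      exact ⟨[], z, j, a, b, e.cons _⟩
    · obtain ⟨y, z, i, a, b, e⟩ := ih hw
      exact ⟨s :: y, z, i, a, b, e.cons s⟩

theorem exists_red_of_not_red {w : List (Syllable M)} (h : ¬ Red I (cols w)) :
    ∃ w', evalSyl I w' = evalSyl I w ∧ cols w' ⊆ cols w ∧ w'.length < w.length := by
  obtain ⟨y, z, i, a, b, e⟩ := exists_shorter_of_not_red h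
  refine ⟨y ++ consVal (a.1 * b.1) z, ?_, ?_, ?_⟩
  · rw [e.evalSyl_eq]
    simp [evalSyl_consVal, mul_assoc]
  · refine List.Subset.trans ?_ (e.perm.map Sigma.fst).symm.subset
    change _ ⊆ cols _
    by_cases hab : a.1 * b.1 = 1
    · intro c hc
      simp only [hab, consVal_one, cols_append, cols_cons, List.mem_append, List.mem_cons] at hc ⊢
      tauto
    · simp [consVal_of_ne hab]
  · have h1 := length_consVal_le (a.1 * b.1) z
    have h2 := e.perm.length_eq
    simp at h2 ⊢
    omega

theorem exists_red_le (w : List (Syllable M)) :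
    ∃ w', Red I (cols w') ∧ evalSyl I w' = evalSyl I w ∧ cols w' ⊆ cols w ∧
      w'.length ≤ w.length := by
  induction hn : w.length using Nat.strong_induction_on generalizing w with
  | _ n ih =>
    by_cases h : Red I (cols w)
    · exact ⟨w, h, rfl, List.Subset.refl _, hn.le⟩
    · obtain ⟨w', e, hc, hlt⟩ := exists_red_of_not_red h
      obtain ⟨w'', h1, h2, h3, h4⟩ := ih w'.length (hn ▸ hlt) w' rfl
      exact ⟨w'', h1, h2.trans e, List.Subset.trans h3 hc, by omega⟩

theorem exists_evalSyl_eq (x : GraphProduct I M) : ∃ w, evalSyl I w = x := by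
  obtain ⟨t, ht⟩ := evalTrace_surjective I M x
  obtain ⟨w, rfl⟩ := toTrace_surjective _ t
  exact ⟨w.toList, by rw [← evalTrace_toTrace, ht]⟩

theorem exists_red_evalSyl_eq (x : GraphProduct I M) :
    ∃ w, Red I (cols w) ∧ evalSyl I w = x := by
  obtain ⟨w, rfl⟩ := exists_evalSyl_eq x
  obtain ⟨w', h1, h2, -, -⟩ := exists_red_le (I := I) w
  exact ⟨w', h1, h2⟩

variable (I) in
/-- The length of the reduced representation. -/
def gpLen (x : GraphProduct I M) : ℕ := (Classical.choose (exists_red_evalSyl_eq x)).length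

theorem Red.gpLen_eq {w : List (Syllable M)} (h : Red I (cols w)) :
    gpLen I (evalSyl I w) = w.length := by
  obtain ⟨h1, h2⟩ := Classical.choose_spec (exists_red_evalSyl_eq (evalSyl I w))
  exact (h1.traceEq_of_evalSyl_eq h h2).perm.length_eq

theorem gpLen_evalSyl_le (w : List (Syllable M)) : gpLen I (evalSyl I w) ≤ w.length := by
  obtain ⟨w', h1, h2, -, h3⟩ := exists_red_le (I := I) w
  rw [← h2, h1.gpLen_eq]
  exact h3

theorem gpLen_mul_le (x y : GraphProduct I M) : gpLen I (x * y) ≤ gpLen I x + gpLen I y := by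
  obtain ⟨v, hv, rfl⟩ := exists_red_evalSyl_eq x
  obtain ⟨w, hw, rfl⟩ := exists_red_evalSyl_eq y
  rw [← evalSyl_append, hv.gpLen_eq, hw.gpLen_eq]
  simpa using gpLen_evalSyl_le (I := I) (v ++ w)

/-- The inverse of a word. -/
def invSyl (w : List (Syllable M)) : List (Syllable M) :=
  (w.map fun s => (⟨s.1, s.2.1⁻¹, inv_ne_one.2 s.2.2⟩ : Syllable M)).reverse

theorem evalSyl_invSyl (w : List (Syllable M)) : evalSyl I (invSyl w) = (evalSyl I w)⁻¹ := by
  induction w with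
  | nil => simp [invSyl]
  | cons s w ih =>
    have : invSyl (s :: w) = invSyl w ++ [⟨s.1, s.2.1⁻¹, inv_ne_one.2 s.2.2⟩] := by simp [invSyl]
    rw [this, evalSyl_append, ih]
    simp

theorem gpLen_inv_le (x : GraphProduct I M) : gpLen I x⁻¹ ≤ gpLen I x := by
  obtain ⟨w, hw, rfl⟩ := exists_red_evalSyl_eq x
  rw [hw.gpLen_eq, ← evalSyl_invSyl]
  simpa [invSyl] using gpLen_evalSyl_le (I := I) (invSyl w)

end Reduced
end GPQuad
end

noncomputable section
namespace GPQuad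

/-! ### Exponents of periodicity -/

section Exponents

variable {A : Type*}

theorem bddAbove_exponents (w : FreeMonoid A) :
    BddAbove {e : ℕ | ∃ u p v : FreeMonoid A, p ≠ 1 ∧ w = u * p ^ e * v} := by
  refine ⟨w.length, ?_⟩
  rintro e ⟨u, p, v, hp, rfl⟩
  have h1 : ∀ n : ℕ, (p ^ n).length = n * p.length := by
    intro n
    induction n with
    | zero => simp
    | succ n ih => rw [pow_succ, FreeMonoid.length_mul, ih]; ring
  have h2 : 1 ≤ p.length := Nat.one_le_iff_ne_zero.2 fun h => hp (FreeMonoid.length_eq_zero.1 h)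
  rw [FreeMonoid.length_mul, FreeMonoid.length_mul, h1]
  nlinarith

theorem le_wordExp {w u p v : FreeMonoid A} {e : ℕ} (hp : p ≠ 1) (h : w = u * p ^ e * v) :
    e ≤ wordExp w :=
  le_csSup (bddAbove_exponents w) ⟨u, p, v, hp, h⟩

/-- The supremum is attained once the set of exponents is nonempty. Over an empty alphabet there is
no nonempty p and the value is the default 0, which the hypothesis excludes. -/
theorem exists_of_wordExp_ne_zero {w : FreeMonoid A} (h : wordExp w ≠ 0) :
    ∃ u p v : FreeMonoid A, p ≠ 1 ∧ w = u * p ^ wordExp w * v := by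
  have hne : {e : ℕ | ∃ u p v : FreeMonoid A, p ≠ 1 ∧ w = u * p ^ e * v}.Nonempty := by
    by_contra hne
    rw [Set.not_nonempty_iff_eq_empty] at hne
    exact h (by rw [wordExp, hne]; exact csSup_empty)
  exact Nat.sSup_mem hne (bddAbove_exponents w)

theorem langExp_eq_top_iff {L : Set (FreeMonoid A)} :
    langExp L = ⊤ ↔ ∀ e : ℕ, ∃ w ∈ L, e ≤ wordExp w := by
  constructor
  · intro h e
    by_contra hno
    push Not at hno
    have : langExp L ≤ (e : ℕ∞) :=
      iSup₂_le fun w hw => by exact_mod_cast (hno w hw).le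
    rw [h] at this
    exact absurd (top_le_iff.1 this) (ENat.natCast_ne_top e)
  · intro h
    refine ENat.eq_top_iff_forall_ge.2 fun e => ?_
    obtain ⟨w, hw, he⟩ := h e
    exact le_trans (by exact_mod_cast he) (le_iSup₂ (f := fun w (_ : w ∈ L) => (wordExp w : ℕ∞)) w hw)

theorem langExp_mono {L L' : Set (FreeMonoid A)} (h : L ⊆ L') (hL : langExp L = ⊤) :
    langExp L' = ⊤ := by
  rw [langExp_eq_top_iff] at hL ⊢
  intro e
  obtain ⟨w, hw, he⟩ := hL e
  exact ⟨w, h hw, he⟩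

theorem infinite_of_langExp_eq_top {L : Set (FreeMonoid A)} (h : langExp L = ⊤) : L.Infinite := by
  intro hfin
  rw [langExp_eq_top_iff] at h
  obtain ⟨b, hb⟩ := (hfin.image wordExp).bddAbove
  obtain ⟨w, hw, he⟩ := h (b + 1)
  have := hb ⟨w, hw, rfl⟩
  omega

/-- If all normal forms of sets `u p^* v` have infinite exponent, then the group is torsion-free. -/
theorem pow_ne_one_of_langExp {G : Type*} [Group G] {nf : G → FreeMonoid A} {p : G}
    (h : langExp (nf '' pumpSet 1 p 1) = ⊤) (n : ℕ) (hn : n ≠ 0) : p ^ n ≠ 1 := by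
  intro hpn
  refine infinite_of_langExp_eq_top h (Set.Finite.image _ ?_)
  refine ((Set.finite_Iio n).image fun k => p ^ k).subset ?_
  rintro _ ⟨k, rfl⟩
  refine ⟨k % n, Nat.mod_lt _ (Nat.pos_of_ne_zero hn), ?_⟩
  simp [pow_eq_pow_mod k hpn]

end Exponents

/-! ### The global normal form -/

section GlobalNF

variable {J : Type*} (I : SimpleGraph J) {M : J → Type*} [∀ i, Group (M i)]
  {Γ : J → Type*}

/-- The word over `Γ` obtained by replacing the syllables by their local normal forms. -/
def expandWord (nf : ∀ i, M i → FreeMonoid (Γ i)) (w : List (Syllable M)) : List (Letter Γ) :=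
  w.flatMap fun s => (includeWord Γ s.1 (nf s.1 s.2.1)).toList

/-- The colour of a letter. -/
def letterCol (a : Letter Γ) : J := (ofLex a).1

variable {I}

theorem isHead_replicate {i j : J} {k : ℕ} (hk : k ≠ 0) (l : List J) :
    IsHead I i (List.replicate k j ++ l) ↔ IsHead I i (j :: l) := by
  induction k with
  | zero => exact absurd rfl hk
  | succ k ih =>
    rw [List.replicate_succ, List.cons_append]
    rcases Nat.eq_zero_or_pos k with rfl | hk'
    · rfl
    · simp only [IsHead, ih hk'.ne']
      tauto

theorem lexNF_replicate [LinearOrder J] {j : J} (k : ℕ) {l : List J} (h : LexNF I (j :: l)) :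
    LexNF I (List.replicate k j ++ l) := by
  induction k with
  | zero => exact h.2
  | succ k ih =>
    refine ⟨fun i hi hh => h.1 i hi ?_, ih⟩
    change IsHead I i (List.replicate k j ++ l) at hh
    rcases Nat.eq_zero_or_pos k with rfl | hk'
    · exact hh
    · rw [isHead_replicate hk'.ne'] at hh
      rcases hh with rfl | hh
      · exact absurd hi I.irrefl
      · exact hh.2

variable {nf : ∀ i, M i → FreeMonoid (Γ i)}

theorem length_includeWord (i : J) (v : FreeMonoid (Γ i)) :
    (includeWord Γ i v).length = v.length := List.length_map _

theorem map_letterCol_includeWord (i : J) (v : FreeMonoid (Γ i)) :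
    (includeWord Γ i v).toList.map letterCol = List.replicate v.length i := by
  rw [includeWord, FreeMonoid.toList_map, List.map_map]
  exact List.map_const'

theorem expandWord_cons (s : Syllable M) (w : List (Syllable M)) :
    expandWord nf (s :: w) = (includeWord Γ s.1 (nf s.1 s.2.1)).toList ++ expandWord nf w := by
  simp [expandWord]

theorem expandWord_append (v w : List (Syllable M)) :
    expandWord nf (v ++ w) = expandWord nf v ++ expandWord nf w := by
  simp [expandWord]

theorem expandWord_wordPow (w : List (Syllable M)) (n : ℕ) :
    expandWord nf (wordPow w n) = wordPow (expandWord nf w) n := by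
  induction n with
  | zero => rfl
  | succ n ih => rw [wordPow_succ, wordPow_succ, expandWord_append, ih]

theorem isHead_expandWord (hne : ∀ i (g : M i), g ≠ 1 → nf i g ≠ 1) {i : J}
    (w : List (Syllable M)) :
    IsHead I i ((expandWord nf w).map letterCol) ↔ IsHead I i (cols w) := by
  induction w with
  | nil => rfl
  | cons s w ih =>
    rw [expandWord_cons, List.map_append, map_letterCol_includeWord, isHead_replicate]
    · simp only [IsHead, ih, cols_cons]
    · exact fun h => hne _ _ s.2.2 (FreeMonoid.length_eq_zero.1 h)

/-- Each syllable expands to a nonempty block of one colour, and repeating a colour creates no new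
way of moving a letter forward. So normal forms over the syllables expand to normal forms over the
letters. -/
theorem lexNF_expandWord [LinearOrder J] (hne : ∀ i (g : M i), g ≠ 1 → nf i g ≠ 1) {w : List (Syllable M)}
    (h : LexNF I (cols w)) : LexNF I ((expandWord nf w).map letterCol) := by
  induction w with
  | nil => trivial
  | cons s w ih =>
    rw [expandWord_cons, List.map_append, map_letterCol_includeWord]
    exact lexNF_replicate _ ⟨fun i hi hh => h.1 i hi ((isHead_expandWord hne w).1 hh), ih h.2⟩

theorem expandTrace_toTrace (w : FreeMonoid (Syllable M)) :
    expandTrace I nf (toTrace _ w) =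
      toTrace (letterGraph I Γ) (FreeMonoid.ofList (expandWord nf w.toList)) := by
  induction w using FreeMonoid.inductionOn' with
  | one => simp [expandWord]
  | of_mul a w ih =>
    rw [map_mul, map_mul, ih, FreeMonoid.toList_mul, FreeMonoid.toList_of, List.singleton_append,
      expandWord_cons, FreeMonoid.ofList_append, map_mul]
    congr 1

theorem IsReducedTrace.red {w : FreeMonoid (Syllable M)}
    (h : IsReducedTrace I M (toTrace _ w)) : Red I (cols w.toList) := by
  by_contra hr
  obtain ⟨y, z, i, a, b, e⟩ := exists_shorter_of_not_red hr
  refine h (toTrace _ (FreeMonoid.ofList y)) (toTrace _ (FreeMonoid.ofList z)) ⟨i, a⟩ ⟨i, b⟩ ?_ rfl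
  rw [← map_mul, ← map_mul, ← map_mul]
  refine (toTrace_eq_iff I Sigma.fst _ _).2 (e.trans (.of_eq ?_))
  simp [FreeMonoid.toList_mul]

/-- Uniqueness of reduced words makes the chosen trace irrelevant, and uniqueness of normal forms
for the colours identifies the lexicographically first word with the expansion. The orders inside
the local alphabets play no role. -/
theorem globalNF_evalSyl [LinearOrder J] [∀ i, LinearOrder (Γ i)] (hne : ∀ i (g : M i), g ≠ 1 → nf i g ≠ 1)
    {w : List (Syllable M)} (hr : Red I (cols w)) (hl : LexNF I (cols w)) :
    globalNF I nf (evalSyl I w) = FreeMonoid.ofList (expandWord nf w) := by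
  obtain ⟨h1, h2⟩ := Classical.choose_spec (exists_reducedTrace I M (evalSyl I w))
  change IsReducedTrace I M (nfSyllable I M (evalSyl I w)) at h1
  change evalTrace I M (nfSyllable I M (evalSyl I w)) = _ at h2
  obtain ⟨v, hv⟩ := toTrace_surjective _ (nfSyllable I M (evalSyl I w))
  rw [← hv] at h1 h2
  rw [evalTrace_toTrace] at h2
  have hvw : toTrace (syllableGraph I M) v = toTrace _ (FreeMonoid.ofList w) :=
    (toTrace_eq_iff I Sigma.fst _ _).2 (h1.red.traceEq_of_evalSyl_eq hr h2)
  have e : globalNF I nf (evalSyl I w) =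
      nfLex (letterGraph I Γ) (toTrace _ (FreeMonoid.ofList (expandWord nf w))) := by
    rw [globalNF, ← hv, hvw, expandTrace_toTrace]; rfl
  rw [e]
  refine FreeMonoid.toList.injective (LexNF.eq_of_traceEq (I := I) (col := letterCol)
    (lexNF_nfLex I letterCol (fun a b hab => Sigma.Lex.lt_def.2 (Or.inl hab)) _)
    (lexNF_expandWord hne hl) ?_)
  exact (toTrace_eq_iff I letterCol _ _).1 (toTrace_nfLex I letterCol _)

/-- The global normal form is the expansion of a normal form over the syllables. -/
theorem exists_globalNF_eq [LinearOrder J] [∀ i, LinearOrder (Γ i)] (hne : ∀ i (g : M i), g ≠ 1 → nf i g ≠ 1)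
    {w : List (Syllable M)} (hr : Red I (cols w)) :
    ∃ w', SylEq I w w' ∧ LexNF I (cols w') ∧
      globalNF I nf (evalSyl I w) = FreeMonoid.ofList (expandWord nf w') := by
  obtain ⟨w', e, hl⟩ := exists_lexNF I Sigma.fst w
  exact ⟨w', e, hl, by rw [e.evalSyl_eq]; exact globalNF_evalSyl hne ((Red.congr e.colours).1 hr) hl⟩

/-- Passing to the normal form permutes whole syllables, so the local normal form of s survives as a
contiguous factor. -/
theorem wordExp_le_globalNF [LinearOrder J] [∀ i, LinearOrder (Γ i)] (hne : ∀ i (g : M i), g ≠ 1 → nf i g ≠ 1)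
    {w : List (Syllable M)} (hr : Red I (cols w)) {s : Syllable M} (hs : s ∈ w) :
    wordExp (nf s.1 s.2.1) ≤ wordExp (globalNF I nf (evalSyl I w)) := by
  by_cases h0 : wordExp (nf s.1 s.2.1) = 0
  · rw [h0]; exact Nat.zero_le _
  obtain ⟨w', e, -, he⟩ := exists_globalNF_eq hne hr
  obtain ⟨a, b, rfl⟩ := List.append_of_mem (e.perm.subset hs)
  obtain ⟨u, p, v, hp, hw⟩ := exists_of_wordExp_ne_zero h0
  refine le_wordExp (u := FreeMonoid.ofList (expandWord nf a) * includeWord Γ s.1 u)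
    (p := includeWord Γ s.1 p) (v := includeWord Γ s.1 v * FreeMonoid.ofList (expandWord nf b)) ?_ ?_
  · intro h
    apply hp
    have := congrArg FreeMonoid.length h
    rw [length_includeWord] at this
    exact FreeMonoid.length_eq_zero.1 this
  · rw [he, expandWord_append, expandWord_cons, FreeMonoid.ofList_append, FreeMonoid.ofList_append,
      FreeMonoid.ofList_toList, hw, map_mul, map_mul, map_pow, ← hw]
    simp only [mul_assoc]

theorem le_wordExp_globalNF [LinearOrder J] [∀ i, LinearOrder (Γ i)] (hne : ∀ i (g : M i), g ≠ 1 → nf i g ≠ 1)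
    {w w' y : List (Syllable M)} (hr : Red I (cols w)) (hw : SylEq I w w') (hl : LexNF I (cols w'))
    {e : ℕ} (hy : y ≠ []) (h : wordPow y e <:+: w') :
    e ≤ wordExp (globalNF I nf (evalSyl I w)) := by
  rw [hw.evalSyl_eq, globalNF_evalSyl hne ((Red.congr hw.colours).1 hr) hl]
  obtain ⟨a, b, rfl⟩ := h
  refine le_wordExp (u := FreeMonoid.ofList (expandWord nf a))
    (p := FreeMonoid.ofList (expandWord nf y)) (v := FreeMonoid.ofList (expandWord nf b)) ?_ ?_
  · intro h
    cases y with
    | nil => exact hy rfl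
    | cons s y =>
      rw [expandWord_cons, FreeMonoid.ofList_append] at h
      have := congrArg FreeMonoid.length h
      rw [FreeMonoid.length_mul, FreeMonoid.ofList_toList, length_includeWord,
        FreeMonoid.length_one] at this
      exact hne _ _ s.2.2 (FreeMonoid.length_eq_zero.1 (by omega))
  · rw [expandWord_append, expandWord_append, expandWord_wordPow, FreeMonoid.ofList_append,
      FreeMonoid.ofList_append]
    congr 2
    clear hl hw
    induction e with
    | zero => rfl
    | succ e ih => rw [wordPow_succ, FreeMonoid.ofList_append, ih, pow_succ']

end GlobalNF
end GPQuad
end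

noncomputable section
namespace GPQuad

/-! ### Powers in graph products -/

section PowersInGraphProducts

variable {J : Type*} {I : SimpleGraph J} {M : J → Type*} [∀ i, Group (M i)]

/-- A head coming from a later copy would have to pass the same colour in the first copy, and no
colour is adjacent to itself. -/
theorem isHead_wordPow {i : J} {l : List J} {n : ℕ} (h : IsHead I i (wordPow l n)) :
    IsHead I i l := by
  cases n with
  | zero => exact h.elim
  | succ n =>
    rw [wordPow_succ] at h
    rcases isHead_append.1 h with h | ⟨h1, h2⟩
    · exact h
    · exact absurd (h1 i (mem_of_mem_wordPow h2.mem)) I.irrefl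

theorem isTail_wordPow {i : J} {l : List J} {n : ℕ} (h : IsTail I i (wordPow l n)) :
    IsTail I i l := by
  cases n with
  | zero => exact h.elim
  | succ n =>
    rw [wordPow_succ'] at h
    rcases isTail_append.1 h with h | ⟨h1, h2⟩
    · exact h
    · exact absurd (h1 i (mem_of_mem_wordPow h2.mem)) I.irrefl

theorem red_wordPow {l : List J} (hr : Red I l) (h : ∀ i, IsTail I i l → ¬ IsHead I i l) (n : ℕ) :
    Red I (wordPow l n) := by
  induction n with
  | zero => trivial
  | succ n ih =>
    rw [wordPow_succ]
    exact red_append.2 ⟨hr, ih, fun i h1 h2 => h i h1 (isHead_wordPow h2)⟩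

theorem evalSyl_wordPow (s : List (Syllable M)) (n : ℕ) :
    evalSyl I (wordPow s n) = evalSyl I s ^ n := by
  induction n with
  | zero => simp
  | succ n ih => rw [wordPow_succ, evalSyl_append, ih, pow_succ']

theorem cols_wordPow (s : List (Syllable M)) (n : ℕ) : cols (wordPow s n) = wordPow (cols s) n :=
  map_wordPow _ _ _

theorem IsHead.exists_evalSyl {i : J} {w : List (Syllable M)} (h : IsHead I i (cols w)) :
    ∃ (g : M i) (y : List (Syllable M)), evalSyl I w = GraphProduct.of I M i g * evalSyl I y ∧
      w.length = y.length + 1 := by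
  obtain ⟨⟨j, a⟩, y, hj, e⟩ := h.exists_traceEq
  change j = i at hj
  subst hj
  exact ⟨a, y, by rw [e.evalSyl_eq, evalSyl_cons], by simpa using e.perm.length_eq⟩

theorem IsTail.exists_evalSyl {i : J} {w : List (Syllable M)} (h : IsTail I i (cols w)) :
    ∃ (g : M i) (y : List (Syllable M)), evalSyl I w = evalSyl I y * GraphProduct.of I M i g ∧
      w.length = y.length + 1 := by
  obtain ⟨⟨j, a⟩, y, hj, e⟩ := h.exists_traceEq
  change j = i at hj
  subst hj
  exact ⟨a, y, by rw [e.evalSyl_eq, evalSyl_append]; simp, by simpa using e.perm.length_eq⟩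

theorem commute_evalSyl_of_adj {i : J} (g : M i) {w : List (Syllable M)}
    (h : ∀ c ∈ cols w, I.Adj i c) : Commute (GraphProduct.of I M i g) (evalSyl I w) := by
  induction w with
  | nil => exact Commute.one_right _
  | cons s w ih =>
    rw [evalSyl_cons]
    exact Commute.mul_right (GraphProduct.of_comm I M (h _ (by simp)) g s.2.1)
      (ih fun c hc => h c (by simp [hc]))

theorem gpLen_of_le {i : J} (g : M i) : gpLen I (GraphProduct.of I M i g) ≤ 1 := by
  have := gpLen_evalSyl_le (I := I) (consVal g [])
  rw [evalSyl_consVal, evalSyl_nil, mul_one] at this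
  exact this.trans (length_consVal_le g [])

theorem gpLen_mul_of_mul_le {i : J} (u v : List (Syllable M)) (g : M i) :
    gpLen I (evalSyl I u * GraphProduct.of I M i g * evalSyl I v) ≤ u.length + 1 + v.length :=
  (gpLen_mul_le _ _).trans (add_le_add ((gpLen_mul_le _ _).trans
    (add_le_add (gpLen_evalSyl_le u) (gpLen_of_le g))) (gpLen_evalSyl_le v))

theorem gpLen_mul_of_le {i : J} (u : List (Syllable M)) (g : M i) :
    gpLen I (evalSyl I u * GraphProduct.of I M i g) ≤ u.length + 1 :=
  (gpLen_mul_le _ _).trans (add_le_add (gpLen_evalSyl_le u) (gpLen_of_le g))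

/-- If no letter of the reduced word `s` cancels with a letter of another copy of `s`, then the
elements `u s ^ n v` have reduced representations `x s ^ (n - m) y` for fixed words `x` and `y`. -/
theorem exists_reduced_power {s : List (Syllable M)} (hs : Red I (cols s))
    (hht : ∀ i, IsTail I i (cols s) → ¬ IsHead I i (cols s)) (u v : GraphProduct I M) :
    ∃ (x y : List (Syllable M)) (m : ℕ), ∀ n : ℕ, n ≠ 0 →
      Red I (cols (x ++ wordPow s n ++ y)) ∧
      evalSyl I (x ++ wordPow s n ++ y) = u * evalSyl I s ^ (n + m) * v := by
  set S := evalSyl I s with hS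
  have hpow : ∀ m : ℕ, gpLen I (S ^ m) = m * s.length := fun m => by
    have : Red I (cols (wordPow s m)) := by rw [cols_wordPow]; exact red_wordPow hs hht m
    rw [hS, ← evalSyl_wordPow, this.gpLen_eq, length_wordPow]
  have hlower : ∀ (a b : GraphProduct I M) (m : ℕ), (∀ n : ℕ, a * S ^ n * b = u * S ^ (n + m) * v) →
      m * s.length ≤ gpLen I a + gpLen I b + gpLen I u + gpLen I v := by
    intro a b m h
    have h0 := h 0
    have e : S ^ m = u⁻¹ * (a * b) * v⁻¹ := by
      simp only [pow_zero, mul_one, zero_add] at h0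
      rw [h0]; group
    rw [← hpow m, e]
    have h1 := gpLen_mul_le (u⁻¹ * (a * b)) v⁻¹
    have h2 := gpLen_mul_le u⁻¹ (a * b)
    have h3 := gpLen_mul_le a b
    have h4 := gpLen_inv_le u
    have h5 := gpLen_inv_le v
    omega
  -- Descent on k = |a| + |b| + |u| + |v| − m |s|, which `hlower` shows to be nonnegative. Absorbing
  -- a copy of s into a or b raises m by one, and each cancellation makes k strictly smaller.
  suffices H : ∀ (k : ℕ) (a b : GraphProduct I M) (m : ℕ),
      (∀ n : ℕ, a * S ^ n * b = u * S ^ (n + m) * v) →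
      gpLen I a + gpLen I b + gpLen I u + gpLen I v = m * s.length + k →
      ∃ (x y : List (Syllable M)) (m : ℕ), ∀ n : ℕ, n ≠ 0 →
        Red I (cols (x ++ wordPow s n ++ y)) ∧
        evalSyl I (x ++ wordPow s n ++ y) = u * S ^ (n + m) * v from
    H _ u v 0 (fun n => rfl) (by rw [Nat.zero_mul, Nat.zero_add])
  intro k
  induction k using Nat.strong_induction_on with
  | _ k ih =>
  intro a b m hab hk
  have next : ∀ (a' b' : GraphProduct I M) (m' : ℕ),
      (∀ n : ℕ, a' * S ^ n * b' = u * S ^ (n + m') * v) →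
      gpLen I a' + gpLen I b' + m * s.length < gpLen I a + gpLen I b + m' * s.length →
      ∃ (x y : List (Syllable M)) (m : ℕ), ∀ n : ℕ, n ≠ 0 →
        Red I (cols (x ++ wordPow s n ++ y)) ∧
        evalSyl I (x ++ wordPow s n ++ y) = u * S ^ (n + m) * v := by
    intro a' b' m' h' hlt
    have hl := hlower a' b' m' h'
    exact ih (gpLen I a' + gpLen I b' + gpLen I u + gpLen I v - m' * s.length) (by omega) a' b' m' h'
      (by omega)
  obtain ⟨x, hx, rfl⟩ := exists_red_evalSyl_eq a
  obtain ⟨y, hy, rfl⟩ := exists_red_evalSyl_eq b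
  rw [hx.gpLen_eq, hy.gpLen_eq] at next
  by_cases h1 : ∃ i, IsTail I i (cols x) ∧ IsHead I i (cols s)
  · obtain ⟨i, h1, h2⟩ := h1
    obtain ⟨g, x', ex, hx'⟩ := h1.exists_evalSyl
    obtain ⟨g', s', es, hs'⟩ := h2.exists_evalSyl
    refine next (evalSyl I x * S) (evalSyl I y) (m + 1) (fun n => ?_) ?_
    · rw [mul_assoc (evalSyl I x), ← pow_succ', hab]
      congr 3; omega
    · have e : evalSyl I x * S = evalSyl I x' * GraphProduct.of I M i (g * g') * evalSyl I s' := by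
        rw [hS, ex, es, map_mul]; simp only [mul_assoc]
      have := gpLen_mul_of_mul_le (I := I) x' s' (g * g')
      rw [← e] at this
      rw [hy.gpLen_eq, Nat.add_mul]
      omega
  by_cases h2 : ∃ i, IsTail I i (cols s) ∧ IsHead I i (cols y)
  · obtain ⟨i, h1, h2⟩ := h2
    obtain ⟨g, s', es, hs'⟩ := h1.exists_evalSyl
    obtain ⟨g', y', ey, hy'⟩ := h2.exists_evalSyl
    refine next (evalSyl I x) (S * evalSyl I y) (m + 1) (fun n => ?_) ?_
    · rw [← mul_assoc, mul_assoc (evalSyl I x), ← pow_succ, hab]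
      congr 3; omega
    · have e : S * evalSyl I y = evalSyl I s' * GraphProduct.of I M i (g * g') * evalSyl I y' := by
        rw [hS, ey, es, map_mul]; simp only [mul_assoc]
      have := gpLen_mul_of_mul_le (I := I) s' y' (g * g')
      rw [← e] at this
      rw [hx.gpLen_eq, Nat.add_mul]
      omega
  -- A letter of y may also reach x by commuting with all of s. It is then merged into the left
  -- factor and m is unchanged.
  by_cases h3 : ∃ i, IsTail I i (cols x) ∧ IsHead I i (cols y) ∧ ∀ c ∈ cols s, I.Adj i c
  · obtain ⟨i, h1, h2, h3⟩ := h3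
    obtain ⟨g, x', ex, hx'⟩ := h1.exists_evalSyl
    obtain ⟨g', y', ey, hy'⟩ := h2.exists_evalSyl
    refine next (evalSyl I x' * GraphProduct.of I M i (g * g')) (evalSyl I y') m (fun n => ?_) ?_
    · rw [← hab, ex, ey, map_mul]
      have hc := (commute_evalSyl_of_adj g' h3).pow_right n
      rw [← hS] at hc
      simp only [mul_assoc]
      rw [← mul_assoc (GraphProduct.of I M i g'), hc.eq]
      simp only [mul_assoc]
    · have h4 := gpLen_mul_of_le (I := I) x' (g * g')
      have h5 := gpLen_evalSyl_le (I := I) y'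
      omega
  push Not at h1 h2 h3
  refine ⟨x, y, m, fun n hn => ⟨?_, ?_⟩⟩
  -- At least one copy of s must be present to keep the tails of x away from the heads of y.
  · obtain ⟨n, rfl⟩ := Nat.exists_eq_succ_of_ne_zero hn
    simp only [cols_append, cols_wordPow]
    refine red_append.2 ⟨red_append.2 ⟨hx, red_wordPow hs hht _, fun i ht hh =>
      h1 i ht (isHead_wordPow hh)⟩, hy, fun i ht hh => ?_⟩
    rcases isTail_append.1 ht with ht | ⟨hadj, ht⟩
    · exact h2 i (isTail_wordPow ht) hh
    · obtain ⟨c, hc, hnc⟩ := h3 i ht hh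
      refine hnc (hadj c ?_)
      rw [wordPow_succ]
      exact List.mem_append_left _ hc
  · rw [evalSyl_append, evalSyl_append, evalSyl_wordPow, ← hab]

/-- A right factor with colours in the star of `i` is split off from an element. -/
theorem exists_star_decomposition (i : J) (u : GraphProduct I M) :
    ∃ (u₀ : List (Syllable M)) (x : M i) (u₁ : List (Syllable M)),
      u = evalSyl I u₀ * GraphProduct.of I M i x * evalSyl I u₁ ∧
      (∀ c ∈ cols u₁, I.Adj i c) ∧ Red I (cols u₀) ∧
      ∀ j, IsTail I j (cols u₀) → j ≠ i ∧ ¬ I.Adj i j := by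
  suffices H : ∀ (k : ℕ) (u₀ : List (Syllable M)) (x : M i) (u₁ : List (Syllable M)),
      u₀.length = k → u = evalSyl I u₀ * GraphProduct.of I M i x * evalSyl I u₁ →
      (∀ c ∈ cols u₁, I.Adj i c) → Red I (cols u₀) →
      ∃ (u₀ : List (Syllable M)) (x : M i) (u₁ : List (Syllable M)),
      u = evalSyl I u₀ * GraphProduct.of I M i x * evalSyl I u₁ ∧
      (∀ c ∈ cols u₁, I.Adj i c) ∧ Red I (cols u₀) ∧
      ∀ j, IsTail I j (cols u₀) → j ≠ i ∧ ¬ I.Adj i j by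
    obtain ⟨w, hw, rfl⟩ := exists_red_evalSyl_eq u
    exact H _ w 1 [] rfl (by simp) (by simp) hw
  intro k
  induction k with
  | zero =>
    intro u₀ x u₁ hk e h1 h2
    obtain rfl := List.eq_nil_of_length_eq_zero hk
    exact ⟨[], x, u₁, e, h1, h2, fun j hj => hj.elim⟩
  | succ k ih =>
    intro u₀ x u₁ hk e h1 h2
    by_cases hall : ∀ j, IsTail I j (cols u₀) → j ≠ i ∧ ¬ I.Adj i j
    · exact ⟨u₀, x, u₁, e, h1, h2, hall⟩
    · simp only [not_forall, not_and_or, not_not] at hall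
      obtain ⟨j, hj, hij⟩ := hall
      obtain ⟨⟨j', a⟩, y, hj', ey⟩ := hj.exists_traceEq
      change j' = j at hj'
      subst hj'
      have hy : Red I (cols y) := by
        have := (Red.congr ey.colours).1 h2
        change Red I (cols _) at this
        rw [cols_append] at this
        exact (red_append.1 this).1
      have hlen : y.length = k := by
        have := ey.perm.length_eq; simp at this; omega
      rw [ey.evalSyl_eq, evalSyl_append, evalSyl_cons, evalSyl_nil, mul_one] at e
      rcases hij with rfl | hij
      · exact ih y (a * x) u₁ hlen (by rw [e, map_mul]; simp only [mul_assoc]) h1 hy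
      · refine ih y x (⟨j', a⟩ :: u₁) hlen ?_ (by simpa [hij] using h1) hy
        rw [e, evalSyl_cons, mul_assoc (evalSyl I y), GraphProduct.of_comm I M hij.symm]
        simp only [mul_assoc]

theorem cols_invSyl (w : List (Syllable M)) : cols (invSyl w) = (cols w).reverse := by
  simp [cols, invSyl, List.map_reverse, Function.comp_def]

/-- Powers of a letter that commutes with the remaining letters stay together. -/
theorem exists_reduced_letter_power {i : J} (d : M i) {r : List (Syllable M)}
    (hr : ∀ c ∈ cols r, I.Adj i c) (u v : GraphProduct I M) :
    ∃ x y : M i, ∀ (n : ℕ) (h : x * d ^ n * y ≠ 1), ∃ w : List (Syllable M), Red I (cols w) ∧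
      evalSyl I w = u * (GraphProduct.of I M i d * evalSyl I r) ^ n * v ∧
      (⟨i, x * d ^ n * y, h⟩ : Syllable M) ∈ w := by
  obtain ⟨u₀, x, u₁, rfl, hu₁, hu₀, hut⟩ := exists_star_decomposition i u
  -- Decomposing v⁻¹ splits a left factor off v, hence the inverses of y, v₀ and v₁ below.
  obtain ⟨v₀, y, v₁, hv, hv₁, hv₀, hvt⟩ := exists_star_decomposition i v⁻¹
  refine ⟨x, y⁻¹, fun n h => ?_⟩
  -- Everything adjacent to i is collected in m. The outer words u₀ and v₀⁻¹ are blocked by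
  -- non-adjacent colours, so the syllable x dⁿ y⁻¹ cannot merge with anything.
  obtain ⟨m, hm, em, hmc, -⟩ := exists_red_le (I := I) (u₁ ++ wordPow r n ++ invSyl v₁)
  have hmadj : ∀ c ∈ cols m, I.Adj i c := by
    intro c hc
    have := hmc hc
    simp only [cols_append, cols_wordPow, cols_invSyl, List.mem_append, List.mem_reverse] at this
    rcases this with (h | h) | h
    · exact hu₁ c h
    · exact hr c (mem_of_mem_wordPow h)
    · exact hv₁ c h
  have hvh : ∀ j, IsHead I j (cols (invSyl v₀)) → j ≠ i ∧ ¬ I.Adj i j := by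
    intro j hj
    rw [cols_invSyl] at hj
    exact hvt j hj
  refine ⟨u₀ ++ ⟨i, x * d ^ n * y⁻¹, h⟩ :: (m ++ invSyl v₀), ?_, ?_, by simp⟩
  · rw [cols_append, cols_cons, cols_append]
    refine red_append.2 ⟨hu₀, ⟨fun hh => ?_, red_append.2 ⟨hm, ?_, fun j ht hh => ?_⟩⟩,
      fun j ht hh => ?_⟩
    · rcases isHead_append.1 hh with hh | ⟨-, hh⟩
      · exact I.irrefl (hmadj i hh.mem)
      · exact (hvh i hh).1 rfl
    · rw [cols_invSyl]; exact red_reverse.2 hv₀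
    · exact (hvh j hh).2 (hmadj j ht.mem)
    · rcases hh with rfl | ⟨hh, -⟩
      · exact (hut j ht).1 rfl
      · exact (hut j ht).2 hh.symm
  · have hcr : Commute (GraphProduct.of I M i d) (evalSyl I r) := commute_evalSyl_of_adj d hr
    have e : v = (evalSyl I v₁)⁻¹ * (GraphProduct.of I M i y)⁻¹ * (evalSyl I v₀)⁻¹ := by
      rw [← inv_inv v, hv]; group
    simp only [evalSyl_append, evalSyl_cons, em, evalSyl_invSyl, evalSyl_wordPow, map_mul, map_pow,
      map_inv]
    rw [hcr.mul_pow, e]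
    have c1 : Commute (GraphProduct.of I M i d ^ n) (evalSyl I u₁) :=
      (commute_evalSyl_of_adj d hu₁).pow_left n
    have c2 : Commute (GraphProduct.of I M i y)⁻¹ (evalSyl I u₁ * (evalSyl I r ^ n * (evalSyl I v₁)⁻¹)) :=
      ((commute_evalSyl_of_adj y hu₁).mul_right (((commute_evalSyl_of_adj y hr).pow_right n).mul_right
        (commute_evalSyl_of_adj y hv₁).inv_right)).inv_left
    calc _ = evalSyl I u₀ * GraphProduct.of I M i x * GraphProduct.of I M i d ^ n *
          ((GraphProduct.of I M i y)⁻¹ * (evalSyl I u₁ * (evalSyl I r ^ n * (evalSyl I v₁)⁻¹))) *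
          (evalSyl I v₀)⁻¹ := by simp only [mul_assoc]
      _ = evalSyl I u₀ * GraphProduct.of I M i x * (GraphProduct.of I M i d ^ n * evalSyl I u₁) *
          evalSyl I r ^ n * (evalSyl I v₁)⁻¹ * (GraphProduct.of I M i y)⁻¹ *
          (evalSyl I v₀)⁻¹ := by rw [c2.eq]; simp only [mul_assoc]
      _ = _ := by rw [c1.eq]; simp only [mul_assoc]

/-- A reduced word is cyclically reduced without isolated letters, or it has an isolated letter, or
it can be shortened by conjugation. -/
theorem Red.trichotomy {w : List (Syllable M)} :
    (∀ i, IsTail I i (cols w) → ¬ IsHead I i (cols w)) ∨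
    (∃ (i : J) (d : {g : M i // g ≠ 1}) (r : List (Syllable M)), SylEq I w (⟨i, d⟩ :: r) ∧
      ∀ c ∈ cols r, I.Adj i c) ∨
    ∃ (i : J) (a b : {g : M i // g ≠ 1}) (r : List (Syllable M)),
      SylEq I w (⟨i, a⟩ :: (r ++ [⟨i, b⟩])) := by
  by_cases h : ∀ i, IsTail I i (cols w) → ¬ IsHead I i (cols w)
  · exact Or.inl h
  push Not at h
  obtain ⟨i, ht, hh⟩ := h
  obtain ⟨⟨j, a⟩, r, hj, e⟩ := hh.exists_traceEq
  change j = i at hj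
  subst hj
  -- The colour j is a head and a tail: either two different letters witness this, or one letter
  -- commuting with all the others.
  rcases isTail_cons.1 ((IsTail.congr e.colours).1 ht) with ht | ⟨hadj, -⟩
  · obtain ⟨⟨k, b⟩, r', hk, e'⟩ := ht.exists_traceEq
    change k = j at hk
    subst hk
    exact Or.inr (Or.inr ⟨k, a, b, r', e.trans (e'.cons _)⟩)
  · exact Or.inr (Or.inl ⟨j, a, r, e, hadj⟩)

/-- The normal forms of a set `u p^* v` with `p ≠ 1` have unbounded exponents of periodicity. -/
theorem langExp_globalNF_pumpSet [LinearOrder J] {Γ : J → Type*} [∀ i, LinearOrder (Γ i)]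
    {nf : ∀ i, M i → FreeMonoid (Γ i)} (hne : ∀ i (g : M i), g ≠ 1 → nf i g ≠ 1)
    (hexp : ∀ i (u p v : M i), p ≠ 1 → langExp (nf i '' pumpSet u p v) = ⊤)
    {p : GraphProduct I M} (hp : p ≠ 1) (u v : GraphProduct I M) :
    langExp (globalNF I nf '' pumpSet u p v) = ⊤ := by
  induction hk : gpLen I p using Nat.strong_induction_on generalizing p u v with
  | _ k ih =>
  obtain ⟨w, hw, rfl⟩ := exists_red_evalSyl_eq p
  rw [hw.gpLen_eq] at hk
  have hw0 : w ≠ [] := by rintro rfl; exact hp rfl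
  rcases Red.trichotomy (I := I) (w := w) with h | ⟨i, d, r, e, hr⟩ | ⟨i, a, b, r, e⟩
  · rw [langExp_eq_top_iff]
    intro c
    obtain ⟨x, y, m, H⟩ := exists_reduced_power hw h u v
    obtain ⟨N, hN⟩ := exists_power_of_traceEq I Sigma.fst hw0 x y c
    obtain ⟨h1, h2⟩ := H (N + 1) (by omega)
    obtain ⟨w', e, hl⟩ := exists_lexNF I Sigma.fst (x ++ wordPow w (N + 1) ++ y)
    obtain ⟨z, hz, hzw⟩ := hN (N + 1) w' (by omega) hl e
    exact ⟨_, ⟨_, ⟨N + 1 + m, rfl⟩, rfl⟩, by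
      simp only [← h2]; exact le_wordExp_globalNF hne h1 e hl hz hzw⟩
  · rw [langExp_eq_top_iff]
    intro c
    obtain ⟨x, y, H⟩ := exists_reduced_letter_power d.1 hr u v
    -- The word `nf i 1` need not be empty. Exceeding its exponent guarantees that x dⁿ y is
    -- nontrivial and hence a syllable.
    obtain ⟨_, ⟨_, ⟨n, rfl⟩, rfl⟩, hc⟩ := langExp_eq_top_iff.1 (hexp i x d.1 y d.2)
      (max c (wordExp (nf i 1) + 1))
    have hn : x * d.1 ^ n * y ≠ 1 := by
      intro h1
      simp only [h1] at hc
      have := (le_max_right _ _).trans hc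
      omega
    obtain ⟨w', h1, h2, h3⟩ := H n hn
    refine ⟨_, ⟨_, ⟨n, rfl⟩, rfl⟩, ?_⟩
    simp only [e.evalSyl_eq, evalSyl_cons, ← h2]
    exact ((le_max_left _ _).trans hc).trans (wordExp_le_globalNF hne h1 h3)
  · set A := GraphProduct.of I M i a.1 with hA
    -- The word a r b is conjugate to r (b a), which is shorter, and conjugating p only changes u
    -- and v.
    have e1 : evalSyl I w = A * (evalSyl I r * GraphProduct.of I M i (b.1 * a.1)) * A⁻¹ := by
      rw [e.evalSyl_eq, map_mul, evalSyl_cons, evalSyl_append, evalSyl_cons, evalSyl_nil, ← hA]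
      simp only [mul_assoc, mul_inv_cancel, mul_one]
    have hp' : evalSyl I r * GraphProduct.of I M i (b.1 * a.1) ≠ 1 := by
      intro h1
      rw [e1, h1] at hp
      simp at hp
    have hlt : gpLen I (evalSyl I r * GraphProduct.of I M i (b.1 * a.1)) < k := by
      have h1 := gpLen_mul_of_le (I := I) r (b.1 * a.1)
      have h2 := e.perm.length_eq
      simp at h2
      omega
    refine langExp_mono ?_ (ih _ hlt hp' (u * A) (A⁻¹ * v) rfl)
    rintro _ ⟨_, ⟨n, rfl⟩, rfl⟩
    refine ⟨_, ⟨n, rfl⟩, ?_⟩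
    simp only [e1, conj_pow]
    congr 1
    simp only [mul_assoc]

end PowersInGraphProducts
end GPQuad
end

noncomputable section
namespace GPQuad

/-! ### Square roots in graph products -/

section SquareRoots

variable {J : Type*} {I : SimpleGraph J} {M : J → Type*} [∀ i, Group (M i)]

variable (I) in
/-- All colours of the word are equal or adjacent to `i`. -/
def Central (i : J) (w : List (Syllable M)) : Prop := ∀ c ∈ cols w, c = i ∨ I.Adj i c

variable (I) in
/-- The heads of `w'` are those of `w`, up to the squaring of central letters. -/
def HeadRel (w w' : List (Syllable M)) : Prop :=
  ∀ i, headVal I i w' = headVal I i w ∨ (Central I i w ∧ headVal I i w' = headVal I i w ^ 2)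

theorem isHead_of_central {i : J} {w : List (Syllable M)} (h : Central I i w) (hi : i ∈ cols w) :
    IsHead I i (cols w) := by
  induction w with
  | nil => simp at hi
  | cons s w ih =>
    rcases h s.1 (by simp) with hs | hs
    · exact Or.inl hs.symm
    · refine Or.inr ⟨hs, ih (fun c hc => h c (by simp [hc])) ?_⟩
      rcases List.mem_cons.1 hi with rfl | hi
      · exact absurd hs I.irrefl
      · exact hi

theorem TraceEq.cols_perm {v w : List (Syllable M)} (h : SylEq I v w) : (cols v).Perm (cols w) :=
  h.perm.map _

theorem HeadRel.congr {v v' w w' : List (Syllable M)} (hv : SylEq I v v') (hw : SylEq I w w')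
    (h : HeadRel I v w) : HeadRel I v' w' := by
  intro i
  rw [← (hv.headVal_and_headRest i).1, ← (hw.headVal_and_headRest i).1]
  rcases h i with h | ⟨h1, h2⟩
  · exact Or.inl h
  · exact Or.inr ⟨fun c hc => h1 c (hv.cols_perm.symm.subset hc), h2⟩

theorem headVal_append_of_isHead {i : J} {v : List (Syllable M)} (h : IsHead I i (cols v))
    (w : List (Syllable M)) : headVal I i (v ++ w) = headVal I i v := by
  induction v with
  | nil => exact h.elim
  | cons s v ih =>
    by_cases hs : s.1 = i
    · obtain ⟨j, g⟩ := s
      change j = i at hs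
      subst hs
      simp
    · rcases h with h | ⟨hadj, h⟩
      · exact absurd h.symm hs
      · rw [List.cons_append, headVal_of_adj hadj, headVal_of_adj hadj, ih h]

theorem headVal_append_singleton {i : J} {s : Syllable M} (h : i ≠ s.1) (v : List (Syllable M)) :
    headVal I i (v ++ [s]) = headVal I i v := by
  by_cases hv : IsHead I i (cols v)
  · exact headVal_append_of_isHead hv _
  · rw [headVal_eq_one hv, headVal_eq_one]
    rw [cols_append, isHead_append]
    rintro (h' | ⟨-, h'⟩)
    · exact hv h'
    · exact h (isHead_singleton.1 h')

theorem headRel_append_self (w : List (Syllable M)) : HeadRel I w (w ++ w) := by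
  intro i
  left
  by_cases h : IsHead I i (cols w)
  · exact headVal_append_of_isHead h w
  · rw [headVal_eq_one h, headVal_eq_one]
    rw [cols_append, isHead_append]
    tauto

/-- Since d commutes with r, squaring turns d into d² and leaves the heads of r to the hypothesis;
this is the source of the squared central heads. -/
theorem HeadRel.isolated {i : J} {d : {g : M i // g ≠ 1}} (hd : d.1 ^ 2 ≠ 1)
    {r r' : List (Syllable M)} (hr : ∀ c ∈ cols r, I.Adj i c) (h : HeadRel I r r') :
    HeadRel I (⟨i, d⟩ :: r) (⟨i, d.1 ^ 2, hd⟩ :: r') := by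
  intro j
  by_cases hj : i = j
  · subst hj
    right
    refine ⟨fun c hc => ?_, by simp⟩
    rcases List.mem_cons.1 hc with rfl | hc
    · exact Or.inl rfl
    · exact Or.inr (hr c hc)
  · by_cases hadj : I.Adj j i
    · rw [headVal_of_adj (s := ⟨i, d⟩) hadj, headVal_of_adj (s := ⟨i, d.1 ^ 2, hd⟩) hadj]
      rcases h j with h | ⟨h1, h2⟩
      · exact Or.inl h
      · refine Or.inr ⟨fun c hc => ?_, h2⟩
        rcases List.mem_cons.1 hc with rfl | hc
        · exact Or.inr hadj
        · exact h1 c hc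
    · left
      rw [headVal_of_not_adj (s := ⟨i, d⟩) hadj hj,
        headVal_of_not_adj (s := ⟨i, d.1 ^ 2, hd⟩) hadj hj]

/-- Behind the first letter, only heads of colours adjacent to i remain visible, so r and r' need be
compared at those colours alone. -/
theorem headRel_conj {i : J} (a b : {g : M i // g ≠ 1}) {r r' : List (Syllable M)}
    (h : ∀ j, I.Adj j i → headVal I j r' = headVal I j r ∨
      (Central I j r ∧ headVal I j r' = headVal I j r ^ 2)) :
    HeadRel I (⟨i, a⟩ :: (r ++ [⟨i, b⟩])) (⟨i, a⟩ :: (r' ++ [⟨i, b⟩])) := by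
  intro j
  by_cases hj : i = j
  · subst hj
    left
    simp
  · by_cases hadj : I.Adj j i
    · rw [headVal_of_adj (s := ⟨i, a⟩) hadj, headVal_of_adj (s := ⟨i, a⟩) hadj,
        headVal_append_singleton (Ne.symm hj), headVal_append_singleton (Ne.symm hj)]
      rcases h j hadj with h | ⟨h1, h2⟩
      · exact Or.inl h
      · refine Or.inr ⟨fun c hc => ?_, h2⟩
        simp only [cols_cons, cols_append, cols_nil, List.mem_cons, List.mem_append,
          List.not_mem_nil, or_false] at hc
        rcases hc with rfl | hc | rfl
        · exact Or.inr hadj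
        · exact h1 c hc
        · exact Or.inr hadj
    · left
      rw [headVal_of_not_adj (s := ⟨i, a⟩) hadj hj, headVal_of_not_adj (s := ⟨i, a⟩) hadj hj]

variable (I) in
/-- The reduced word `w'` represents the square of the reduced word `w`, and has the same colours,
heads and tails, up to the squaring of central letters. -/
structure IsSquareOf (w w' : List (Syllable M)) : Prop where
  red : Red I (cols w')
  eval : evalSyl I w' = evalSyl I w ^ 2
  mem_cols : ∀ i, i ∈ cols w' ↔ i ∈ cols w
  head : HeadRel I w w'
  tail : HeadRel I w.reverse w'.reverse

theorem IsSquareOf.congr {v w w' : List (Syllable M)} (h : IsSquareOf I v w') (e : SylEq I v w) :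
    IsSquareOf I w w' where
  red := h.red
  eval := by rw [h.eval, e.evalSyl_eq]
  mem_cols i := (h.mem_cols i).trans e.cols_perm.mem_iff
  head := h.head.congr e (.refl _)
  tail := h.tail.congr e.reverse (.refl _)

theorem cols_reverse (w : List (Syllable M)) : cols w.reverse = (cols w).reverse :=
  List.map_reverse

/-- Some letter of r must keep b from being moved next to a. -/
theorem not_central_of_red {i : J} {a b : {g : M i // g ≠ 1}} {r : List (Syllable M)}
    (h : Red I (cols ((⟨i, a⟩ : Syllable M) :: (r ++ [⟨i, b⟩])))) :
    ∃ c ∈ cols r, c ≠ i ∧ ¬ I.Adj i c := by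
  by_contra hno
  push Not at hno
  refine h.1 (isHead_of_central (w := r ++ [⟨i, b⟩]) (fun c hc => ?_) (by simp))
  simp only [cols_cons, cols_append, cols_nil, List.mem_cons, List.mem_append,
    List.not_mem_nil, or_false] at hc
  rcases hc with hc | rfl
  · exact or_iff_not_imp_left.2 (hno c hc)
  · exact Or.inl rfl

theorem HeadRel.not_isHead {i : J} {w w' : List (Syllable M)} (h : HeadRel I w w')
    (hi : ¬ IsHead I i (cols w)) : ¬ IsHead I i (cols w') := by
  rw [← headVal_ne_one_iff, not_not] at hi ⊢
  rcases h i with h | ⟨-, h⟩ <;> simp [h, hi]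

theorem IsSquareOf.of_cyclically_reduced {w : List (Syllable M)} (hw : Red I (cols w))
    (h : ∀ i, IsTail I i (cols w) → ¬ IsHead I i (cols w)) : IsSquareOf I w (w ++ w) where
  red := by rw [cols_append]; exact red_append.2 ⟨hw, hw, h⟩
  eval := by rw [evalSyl_append, pow_two]
  mem_cols i := by simp
  head := headRel_append_self w
  tail := by rw [List.reverse_append]; exact headRel_append_self _

theorem IsSquareOf.isolated {i : J} {d : {g : M i // g ≠ 1}} (hd : d.1 ^ 2 ≠ 1)
    {r r' : List (Syllable M)} (hr : ∀ c ∈ cols r, I.Adj i c) (h : IsSquareOf I r r') :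
    IsSquareOf I (⟨i, d⟩ :: r) (⟨i, d.1 ^ 2, hd⟩ :: r') := by
  have hr' : ∀ c ∈ cols r', I.Adj i c := fun c hc => hr c ((h.mem_cols c).1 hc)
  have hrev : ∀ (s : Syllable M), s.1 = i → ∀ v : List (Syllable M), (∀ c ∈ cols v, I.Adj i c) →
      SylEq I (s :: v.reverse) (s :: v).reverse := by
    rintro s rfl v hv
    rw [List.reverse_cons]
    have := (TraceEq.move_front (I := I) (col := Sigma.fst) (a := s) (v := v.reverse) (fun c hc =>
      hv _ (List.mem_map_of_mem (List.mem_reverse.1 hc))) []).symm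
    simpa using this
  refine ⟨⟨fun hh => I.irrefl (hr' i hh.mem), h.red⟩, ?_, fun j => ?_, h.head.isolated hd hr,
    HeadRel.congr (hrev ⟨i, d⟩ rfl r hr) (hrev ⟨i, _⟩ rfl r' hr')
      (h.tail.isolated hd fun c hc => hr c (List.mem_reverse.1 (cols_reverse r ▸ hc)))⟩
  · rw [evalSyl_cons, evalSyl_cons, h.eval, (commute_evalSyl_of_adj d.1 hr).mul_pow, map_pow]
  · simp [h.mem_cols]

/-- With t = r (b a) one has (a r b)² = a t² a⁻¹. If b a ≠ 1, the reduced word of t² still ends in b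
a, say z (b a), and the square is a z b. If b a = 1, it is a r² b. -/
theorem IsSquareOf.conj {i : J} {a b : {g : M i // g ≠ 1}} {r t' : List (Syllable M)}
    (hw : Red I (cols ((⟨i, a⟩ : Syllable M) :: (r ++ [⟨i, b⟩]))))
    (h : IsSquareOf I (r ++ consVal (b.1 * a.1) []) t') :
    ∃ z, IsSquareOf I (⟨i, a⟩ :: (r ++ [⟨i, b⟩])) (⟨i, a⟩ :: (z ++ [⟨i, b⟩])) := by
  obtain ⟨c, hcr, hci, hc⟩ := not_central_of_red hw
  have hrev : ∀ (a b : {g : M i // g ≠ 1}) (v : List (Syllable M)),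
      ((⟨i, a⟩ : Syllable M) :: (v ++ [⟨i, b⟩])).reverse = ⟨i, b⟩ :: (v.reverse ++ [⟨i, a⟩]) := by
    intro a b v; simp
  obtain ⟨h1, h2⟩ := hw
  change ¬ IsHead I i (cols (r ++ [⟨i, b⟩])) at h1
  change Red I (cols (r ++ [⟨i, b⟩])) at h2
  rw [cols_append] at h1 h2
  obtain ⟨h3, -, h4⟩ := red_append.1 h2
  by_cases hba : b.1 * a.1 = 1
  · rw [hba, consVal_one, List.append_nil] at h
    have ht1 : ¬ IsHead I i (cols t') :=
      h.head.not_isHead fun hh => h1 (isHead_append.2 (Or.inl hh))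
    have ht2 : ¬ IsTail I i (cols t') := by
      rw [IsTail, ← cols_reverse]
      refine h.tail.not_isHead fun hh => h4 i ?_ (isHead_singleton.2 rfl)
      rw [cols_reverse] at hh
      exact hh
    refine ⟨t', ⟨?_, ?_⟩, ?_, fun j => ?_, headRel_conj a b fun j _ => h.head j, ?_⟩
    · change ¬ IsHead I i (cols (t' ++ [⟨i, b⟩]))
      rw [cols_append, isHead_append]
      rintro (hh | ⟨hh, -⟩)
      · exact ht1 hh
      · exact hc (hh c ((h.mem_cols c).2 hcr))
    · change Red I (cols (t' ++ [⟨i, b⟩]))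
      rw [cols_append]
      exact red_append.2 ⟨h.red, red_singleton i,
        fun j hj hj' => ht2 ((show j = i from isHead_singleton.1 hj') ▸ hj)⟩
    · have hB : GraphProduct.of I M i b.1 * GraphProduct.of I M i a.1 = 1 := by
        rw [← map_mul, hba, map_one]
      simp only [evalSyl_cons, evalSyl_append, evalSyl_nil, mul_one, h.eval, pow_two, mul_assoc]
      rw [← mul_assoc (GraphProduct.of I M i b.1), hB, one_mul]
    · simp [h.mem_cols]
    · rw [hrev, hrev]
      exact headRel_conj b a fun j _ => h.tail j
  · set e : Syllable M := ⟨i, b.1 * a.1, hba⟩ with he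
    rw [consVal_of_ne hba] at h
    have hnc : ¬ Central I i (r ++ [e]) := fun hcen => by
      rcases hcen c (by simp [hcr]) with h | h
      · exact hci h
      · exact hc h
    have hrt : (r ++ [e]).reverse = e :: r.reverse := by simp
    -- The colour i is not central in r (b a), so `HeadRel` leaves the last letter of colour i
    -- unsquared.
    have hlast : headVal I i t'.reverse = b.1 * a.1 := by
      have h0 : headVal I i (e :: r.reverse) = b.1 * a.1 := headVal_self _ _
      rcases h.tail i with h' | ⟨h', -⟩
      · rw [h', hrt, h0]
      · refine absurd (fun c hc => h' c ?_) hnc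
        rw [cols_reverse]; exact List.mem_reverse.2 hc
    have het := traceEq_consVal_headRest (I := I) i t'.reverse
    rw [hlast, consVal_of_ne hba] at het
    set z := (headRest I i t'.reverse).reverse with hz
    have het' : SylEq I t' (z ++ [e]) := by simpa [hz] using het.reverse
    have hhead := HeadRel.congr (.refl _) het' h.head
    have htail := HeadRel.congr (.refl _) het'.reverse h.tail
    have hcz : cols (z ++ [⟨i, b⟩]) = cols (z ++ [e]) := by simp [he]
    refine ⟨z, ⟨?_, ?_⟩, ?_, fun j => ?_, headRel_conj a b fun j hj => ?_, ?_⟩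
    · change ¬ IsHead I i (cols (z ++ [⟨i, b⟩]))
      rw [hcz]
      exact hhead.not_isHead (by rw [cols_append]; exact h1)
    · change Red I (cols (z ++ [⟨i, b⟩]))
      rw [hcz]
      exact (Red.congr het'.colours).1 h.red
    · have hev : evalSyl I z * (GraphProduct.of I M i b.1 * GraphProduct.of I M i a.1) =
          (evalSyl I r * (GraphProduct.of I M i b.1 * GraphProduct.of I M i a.1)) ^ 2 := by
        have := het'.evalSyl_eq.symm.trans h.eval
        simpa only [evalSyl_append, evalSyl_cons, evalSyl_nil, mul_one, he, map_mul] using this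
      have hev' : evalSyl I z * GraphProduct.of I M i b.1 =
          (evalSyl I r * (GraphProduct.of I M i b.1 * GraphProduct.of I M i a.1)) *
          (evalSyl I r * GraphProduct.of I M i b.1) := by
        rw [← mul_left_inj (GraphProduct.of I M i a.1), mul_assoc, hev, pow_two]
        simp only [mul_assoc]
      simp only [evalSyl_cons, evalSyl_append, evalSyl_nil, mul_one, hev', pow_two, mul_assoc]
    · have h5 := h.mem_cols j
      rw [het'.cols_perm.mem_iff] at h5
      simp [he] at h5 ⊢
      tauto
    · have := hhead j
      rw [headVal_append_singleton hj.ne, headVal_append_singleton hj.ne] at this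
      rcases this with h | ⟨h6, h7⟩
      · exact Or.inl h
      · exact Or.inr ⟨fun c hc => h6 c (by simp [hc]), h7⟩
    · rw [hrev, hrev]
      refine headRel_conj b a fun j hj => ?_
      have := htail j
      rw [hrt, List.reverse_append, List.reverse_singleton, List.singleton_append,
        headVal_of_adj (s := e) hj, headVal_of_adj (s := e) hj] at this
      rcases this with h | ⟨h6, h7⟩
      · exact Or.inl h
      · exact Or.inr ⟨fun c hc => h6 c (by rw [cols_cons]; exact List.mem_cons_of_mem _ hc), h7⟩

theorem red_conj_core {i : J} {a b : {g : M i // g ≠ 1}} {r : List (Syllable M)}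
    (hw : Red I (cols ((⟨i, a⟩ : Syllable M) :: (r ++ [⟨i, b⟩])))) :
    Red I (cols (r ++ consVal (b.1 * a.1) [])) := by
  have h2 : Red I (cols (r ++ [⟨i, b⟩])) := hw.2
  rw [cols_append] at h2
  by_cases hba : b.1 * a.1 = 1
  · rw [hba, consVal_one, List.append_nil]
    exact (red_append.1 h2).1
  · rw [consVal_of_ne hba, cols_append]
    exact h2

/-- The squares of reduced words. -/
theorem exists_isSquareOf (htf : ∀ i (g : M i), g ≠ 1 → g ^ 2 ≠ 1) {w : List (Syllable M)}
    (hw : Red I (cols w)) : ∃ w', IsSquareOf I w w' := by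
  induction hn : w.length using Nat.strong_induction_on generalizing w with
  | _ n ih =>
  rcases Red.trichotomy (I := I) (w := w) with h | ⟨i, d, r, e, hr⟩ | ⟨i, a, b, r, e⟩
  · exact ⟨_, IsSquareOf.of_cyclically_reduced hw h⟩
  · have hw' : Red I (cols ((⟨i, d⟩ : Syllable M) :: r)) := (Red.congr e.colours).1 hw
    obtain ⟨r', hr'⟩ := ih r.length (by
      have := e.perm.length_eq; simp at this; omega) hw'.2 rfl
    exact ⟨_, (hr'.isolated (htf i d.1 d.2) hr).congr e.symm⟩
  · have hw' : Red I (cols ((⟨i, a⟩ : Syllable M) :: (r ++ [⟨i, b⟩]))) :=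
      (Red.congr e.colours).1 hw
    obtain ⟨t', ht'⟩ := ih (r ++ consVal (b.1 * a.1) []).length (by
      have h1 := e.perm.length_eq
      have h2 := length_consVal_le (b.1 * a.1) ([] : List (Syllable M))
      simp at h1 h2 ⊢; omega) (red_conj_core hw') rfl
    obtain ⟨z, hz⟩ := ht'.conj hw'
    exact ⟨_, hz.congr e.symm⟩

theorem finite_setOf_traceEq (w : List (Syllable M)) : {v | SylEq I v w}.Finite :=
  (List.finite_toSet w.permutations).subset fun _ hv =>
    List.mem_permutations.2 (TraceEq.perm hv)

/-- Graph products of groups without elements of order two and with finitely many square roots have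
finitely many square roots. -/
theorem finite_sqrt_graphProduct (htf : ∀ i (g : M i), g ≠ 1 → g ^ 2 ≠ 1)
    (hsq : ∀ i (g : M i), {h : M i | h ^ 2 = g}.Finite) (g : GraphProduct I M) :
    {h : GraphProduct I M | h ^ 2 = g}.Finite := by
  induction hn : gpLen I g using Nat.strong_induction_on generalizing g with
  | _ n ih =>
  obtain ⟨g₀, hg₀, rfl⟩ := exists_red_evalSyl_eq g
  rw [hg₀.gpLen_eq] at hn
  -- Candidates read off a word v for g, one set per case of `Red.trichotomy`. `A₀` holds prefixes
  -- of v, since w w is then reduced. `A₁` holds local roots of the first letter times roots of the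
  -- rest. `A₂` holds conjugates of roots of s⁻¹ g s, for s the first letter, when this element is
  -- shorter.
  let A₀ : List (Syllable M) → Set (GraphProduct I M) := fun v =>
    {h | ∃ x ∈ v.inits, h = evalSyl I x}
  let A₁ : List (Syllable M) → Set (GraphProduct I M) := fun v =>
    {h | ∃ (s : Syllable M) (y : List (Syllable M)), v = s :: y ∧
      h ∈ Set.image2 (fun d k => GraphProduct.of I M s.1 d * k) {d | d ^ 2 = s.2.1}
        {k | k ^ 2 = evalSyl I y}}
  let A₂ : List (Syllable M) → Set (GraphProduct I M) := fun v =>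
    {h | ∃ (s : Syllable M) (y : List (Syllable M)), v = s :: y ∧
      gpLen I ((GraphProduct.of I M s.1 s.2.1)⁻¹ * evalSyl I g₀ * GraphProduct.of I M s.1 s.2.1) < n ∧
      h ∈ (fun k => GraphProduct.of I M s.1 s.2.1 * k * (GraphProduct.of I M s.1 s.2.1)⁻¹) ''
        {k | k ^ 2 = (GraphProduct.of I M s.1 s.2.1)⁻¹ * evalSyl I g₀ *
          GraphProduct.of I M s.1 s.2.1}}
  have hfin : (⋃ v ∈ {v | SylEq I v g₀}, (A₀ v ∪ (A₁ v ∪ A₂ v))).Finite := by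
    refine (finite_setOf_traceEq g₀).biUnion fun v hv => ?_
    have hlen : v.length = n := hv.perm.length_eq.trans hn
    refine Set.Finite.union ?_ (Set.Finite.union ?_ ?_)
    · refine ((List.finite_toSet v.inits).image (evalSyl I)).subset ?_
      rintro _ ⟨x, hx, rfl⟩
      exact ⟨x, hx, rfl⟩
    · cases v with
      | nil => exact Set.finite_empty.subset (by rintro h ⟨s, y, e, -⟩; simp at e)
      | cons s y =>
        have hk := ih (gpLen I (evalSyl I y)) (by
          have := gpLen_evalSyl_le (I := I) y
          simp at hlen; omega) (evalSyl I y) rfl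
        refine (Set.Finite.image2 (fun d k => GraphProduct.of I M s.1 d * k)
          (hsq s.1 s.2.1) hk).subset ?_
        rintro h ⟨s', y', e, hh⟩
        simp only [List.cons.injEq] at e
        obtain ⟨rfl, rfl⟩ := e
        exact hh
    · cases v with
      | nil => exact Set.finite_empty.subset (by rintro h ⟨s, y, e, -⟩; simp at e)
      | cons s y =>
        by_cases hlt : gpLen I ((GraphProduct.of I M s.1 s.2.1)⁻¹ * evalSyl I g₀ *
            GraphProduct.of I M s.1 s.2.1) < n
        · refine ((ih _ hlt _ rfl).image (fun k => GraphProduct.of I M s.1 s.2.1 * k *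
            (GraphProduct.of I M s.1 s.2.1)⁻¹)).subset ?_
          rintro h ⟨s', y', e, -, hh⟩
          simp only [List.cons.injEq] at e
          obtain ⟨rfl, rfl⟩ := e
          exact hh
        · refine Set.finite_empty.subset ?_
          rintro h ⟨s', y', e, hlt', -⟩
          simp only [List.cons.injEq] at e
          obtain ⟨rfl, rfl⟩ := e
          exact hlt hlt'
  refine hfin.subset fun h hh => ?_
  change h ^ 2 = evalSyl I g₀ at hh
  obtain ⟨w, hw, rfl⟩ := exists_red_evalSyl_eq h
  rcases Red.trichotomy (I := I) (w := w) with h | ⟨i, d, r, e, hr⟩ | ⟨i, a, b, r, e⟩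
  · have hs := IsSquareOf.of_cyclically_reduced hw h
    exact Set.mem_biUnion (hs.red.traceEq_of_evalSyl_eq hg₀ (hs.eval.trans hh))
      (Or.inl ⟨w, List.mem_inits _ _ |>.2 (List.prefix_append _ _), rfl⟩)
  · have hw' : Red I (cols ((⟨i, d⟩ : Syllable M) :: r)) := (Red.congr e.colours).1 hw
    obtain ⟨r', hr'⟩ := exists_isSquareOf htf hw'.2
    have hs := (hr'.isolated (htf i d.1 d.2) hr).congr e.symm
    refine Set.mem_biUnion (hs.red.traceEq_of_evalSyl_eq hg₀ (hs.eval.trans hh))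
      (Or.inr (Or.inl ⟨_, r', rfl, d.1, rfl, evalSyl I r, hr'.eval.symm, ?_⟩))
    rw [e.evalSyl_eq, evalSyl_cons]
  · have hw' : Red I (cols ((⟨i, a⟩ : Syllable M) :: (r ++ [⟨i, b⟩]))) :=
      (Red.congr e.colours).1 hw
    obtain ⟨t', ht'⟩ := exists_isSquareOf htf (red_conj_core hw')
    obtain ⟨z, hz⟩ := ht'.conj hw'
    have hs := hz.congr e.symm
    have hg := hs.red.traceEq_of_evalSyl_eq hg₀ (hs.eval.trans hh)
    refine Set.mem_biUnion hg (Or.inr (Or.inr ⟨⟨i, a⟩, z ++ [⟨i, b⟩], rfl, ?_,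
      (GraphProduct.of I M i a.1)⁻¹ * evalSyl I w * GraphProduct.of I M i a.1, ?_, ?_⟩))
    · have e1 : (GraphProduct.of I M i a.1)⁻¹ * evalSyl I g₀ * GraphProduct.of I M i a.1 =
          evalSyl I z * GraphProduct.of I M i (b.1 * a.1) := by
        rw [← hg.evalSyl_eq, evalSyl_cons, evalSyl_append, evalSyl_cons, evalSyl_nil, map_mul]
        simp [mul_assoc]
      have h1 := gpLen_mul_of_le (I := I) z (b.1 * a.1)
      have h2 := hg.perm.length_eq
      rw [e1]
      simp at h2
      omega
    · change (_ * _ * _) ^ 2 = _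
      rw [← hh, pow_two, pow_two]
      simp [mul_assoc]
    · simp [mul_assoc]

end SquareRoots
end GPQuad
end
-- The dichotomy for graph products.
theorem corollary5p2 {J : Type*} [Finite J] [LinearOrder J] (I : SimpleGraph J)
    (G : J → Type*) [∀ i, Group (G i)]
    (Γ : J → Type*) [∀ i, Finite (Γ i)] [∀ i, LinearOrder (Γ i)]
    (π : ∀ i, FreeMonoid (Γ i) →* G i) (nf : ∀ i, G i → FreeMonoid (Γ i))
    (hnf : ∀ i (g : G i), π i (nf i g) = g)
    (hsqrt : ∀ i (g : G i), {h : G i | h ^ 2 = g}.Finite)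
    (hexp : ∀ i (u p v : G i), p ≠ 1 → GPQuad.langExp (nf i '' GPQuad.pumpSet u p v) = ⊤)
    {X : Type*} (S : Finset (GPQuad.EquationGroup (GPQuad.GraphProduct I G) X))
    (hS : GPQuad.IsQuadratic S)
    (L : X → Set (GPQuad.GraphProduct I G)) (hL : ∀ x, GPQuad.IsRecognizable (L x)) :
    (GPQuad.solutionSet S L).Finite ∨
      GPQuad.langExp (GPQuad.globalNF I nf '' GPQuad.solutionSet S L) = ⊤ := by
  have hne : ∀ i (g : G i), g ≠ 1 → nf i g ≠ 1 := fun i g hg h => hg (by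
    rw [← hnf i g, h, map_one])
  have hpump {p : GPQuad.GraphProduct I G} (hp : p ≠ 1) (u v : GPQuad.GraphProduct I G) :
      GPQuad.langExp (GPQuad.globalNF I nf '' GPQuad.pumpSet u p v) = ⊤ :=
    GPQuad.langExp_globalNF_pumpSet hne hexp hp u v
  rcases subsingleton_or_nontrivial (GPQuad.GraphProduct I G) with _ | _
  -- Pumping a free variable needs a nontrivial element, so the trivial group is treated separately.
  · exact Or.inl (Set.subsingleton_of_subsingleton.finite)
  · have hfin := GPQuad.finite_sqrt_graphProduct (I := I)
      -- The sets 1 g^* 1 have unbounded exponent, so the local groups have no element of order two.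
      (fun i g hg => GPQuad.pow_ne_one_of_langExp (hexp i 1 g 1 hg) 2 two_ne_zero) hsqrt
    refine (GPQuad.solutionSet_finite_or_pumpSet_subset
      (fun p hp => GPQuad.pow_ne_one_of_langExp (hpump hp 1 1)) hfin S hS L hL).imp_right ?_
    rintro ⟨u, p, v, hp, hsub⟩
    exact GPQuad.langExp_mono (Set.image_mono hsub) (hpump hp u v)
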